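/- Let $p,q\in(1,\infty)$ and $r\in(1/2,\infty)$ satisfy $1/p+1/q=1/r$. For real-valued discrete-time processes $f=(f_n)_{n\ge0}$, $g=(g_n)_{n\ge0}$ write $df_n=f_n-f_{n-1}$, $dg_n=g_n-g_{n-1}$ for $n\ge1$, and define the truncated paraproducts $$\Pi_{n,n'}(f,g)=\sum_{n<i<j\le n'}df_i\,dg_j\qquad(0\le n<n').$$ For a random variable $h$ with values in $[-\infty,\infty]$ and $s\in(0,\infty)$ put $\|h\|_{L^s}=(\mathbb E|h|^s)^{1/s}\in[0,\infty]$, and for a martingale $f$ put $\|f\|_{L^s}=\sup_{n\ge0}\|f_n\|_{L^s}\in[0,\infty]$. In products below, $0\cdot\infty=0$. (i) For every $\varrho\in(1,\infty)$ there is a constant $C_{p,q,\varrho}\in[0,\infty)$, depending only on $p,q,\varrho$, such that for every probability space, every filtration $(\mathcal F_n)_{n\ge0}$ on it, and all real-valued martingales $f,g$ with respect to $(\mathcal F_n)_{n\ge0}$, $$\Bigg\|\sup_{m\in\mathbb N,\ n_0<n_1<\cdots<n_m}\Big(\sum_{k=1}^m|\Pi_{n_{k-1},n_k}(f,g)|^\varrho\Big)^{1/\varrho}\Bigg\|_{L^r}\le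 C_{p,q,\varrho}\,\|f\|_{L^p}\|g\|_{L^q}.$$ (ii) There is a constant $C_{p,q}\in[0,\infty)$, depending only on $p,q$, such that for every probability space, every filtration $(\mathcal F_n)_{n\ge0}$ on it, all real-valued martingales $f,g$ with respect to $(\mathcal F_n)_{n\ge0}$, and every $\lambda\in(0,\infty)$, $$\Bigg\|\sup_{m\in\mathbb N,\ n_0<n_1<\cdots<n_m}\operatorname{card}\big\{k\in\{1,\dots,m\}:|\Pi_{n_{k-1},n_k}(f,g)|\ge\lambda\big\}\Bigg\|_{L^r}\le C_{p,q}\,\lambda^{-1}\|f\|_{L^p}\|g\|_{L^q}.$$ In both parts the suprema are taken over all $m$ and all integers $0\le n_0<n_1<\cdots<n_m$. -/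

import Mathlib

open MeasureTheory
open scoped ENNReal NNReal

/-- The difference `df_n = f_n - f_{n-1}` of a process, meaningful for `n ≥ 1`. -/
def procDiff {Ω : Type*} (f : ℕ → Ω → ℝ) (n : ℕ) (ω : Ω) : ℝ :=
  f n ω - f (n - 1) ω

/-- The truncated paraproduct `Π_{n,n'}(f,g) = ∑_{n < i < j ≤ n'} df_i dg_j`. Only indices
`i, j ≥ 1` occur in the sum. -/
def truncParaproduct {Ω : Type*} (f g : ℕ → Ω → ℝ) (n n' : ℕ) (ω : Ω) : ℝ :=
  ∑ j ∈ Finset.Ioc n n', ∑ i ∈ Finset.Ioo n j, procDiff f i ω * procDiff g j ω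

/-- The `ϱ`-variation of the truncated paraproducts: the supremum over all `m` and all
`n_0 < n_1 < ⋯ < n_m` of `(∑_{k=1}^m |Π_{n_{k-1},n_k}(f,g)|^ϱ)^{1/ϱ}`, with values in `[0,∞]`. -/
noncomputable def paraproductVariation {Ω : Type*} (ϱ : ℝ) (f g : ℕ → Ω → ℝ) (ω : Ω) : ℝ≥0∞ :=
  ⨆ (m : ℕ) (n : Fin (m + 1) → ℕ) (_ : StrictMono n),
    (∑ k : Fin m, ENNReal.ofReal |truncParaproduct f g (n k.castSucc) (n k.succ) ω| ^ ϱ) ^ (1 / ϱ)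

/-- The `lam`-jump counting function of the truncated paraproducts: the supremum over all `m` and
all `n_0 < n_1 < ⋯ < n_m` of the number of `k ∈ {1,…,m}` with `|Π_{n_{k-1},n_k}(f,g)| ≥ lam`,
with values in `[0,∞]`. -/
noncomputable def paraproductJumpCount {Ω : Type*} (lam : ℝ) (f g : ℕ → Ω → ℝ) (ω : Ω) : ℝ≥0∞ :=
  ⨆ (m : ℕ) (n : Fin (m + 1) → ℕ) (_ : StrictMono n),
    ((Finset.univ.filter fun k : Fin m =>
      lam ≤ |truncParaproduct f g (n k.castSucc) (n k.succ) ω|).card : ℝ≥0∞)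

/-- The norm `‖f‖_{L^p} = sup_{n ≥ 0} ‖f_n‖_{L^p}` of a martingale, with values in `[0,∞]`. -/
noncomputable def martingaleLpNorm {Ω : Type*} [MeasurableSpace Ω] (μ : Measure Ω) (p : ℝ)
    (f : ℕ → Ω → ℝ) : ℝ≥0∞ :=
  ⨆ n : ℕ, eLpNorm (f n) (ENNReal.ofReal p) μ

/-!
Everything is controlled through *resets*. Restart the paraproduct greedily: time `n + 1` is a reset
as soon as some `|Π_{u,n+1}|` with `u` in the current block reaches the threshold `λ`. The
intervals of a partition on which `|Π| ≥ λ` use up distinct blocks, and by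
`Π_{u,v} = Π_{a,v} - Π_{a,u} - (f_u - f_a)(g_v - g_u)` all values of `Π` inside the block opened at
`a` are at most a weight made of the maximal functions of `f`, `g` and the paraproduct on that
block. Hence `λ` times the jump count is at most the total weight of the blocks.

It remains to bound the total weight in `L^r`, uniformly over all adapted sequences of resets. The
`ℓ²` norm over the blocks of the maximal functions of a martingale, and the `ℓ¹` norm of the maximal
functions of a martingale on the blocks in terms of its block square functions, satisfy pathwise
inequalities of Burkholder and Davis type, in which the error is a martingale transform with bounded
integrand. Taking expectations gives `L¹` bounds; restarting and the Garsia–Neveu argument upgrade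
them to `L^t` for `t > 1`. As `r ≤ 1` is allowed, the block sums of `f` in the paraproduct are first
divided by a power of their `ℓ²` norm, which makes the integrability exponent larger than `1`;
Hölder's inequality restores the power.

For the variation, the resets are made at the heights `2^{-l}` relative to a running majorant of
`|Π|`. Intervals on which the majorant doubles form a telescoping sum, and on the others
`|Π|^ϱ` is summed level by level, `ϱ > 1` leaving a geometric factor to spare.
-/

section PathwiseFunctionals

/-- The sequence with increments `d` starting from `0`. -/
def partialSum (d : ℕ → ℝ) (n : ℕ) : ℝ := ∑ i ∈ Finset.range n, d i

/-- The maximal function `max_{k ≤ n} |d 0 + ⋯ + d (k - 1)|` of the sequence with increments `d`. -/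
noncomputable def maxFn (d : ℕ → ℝ) (n : ℕ) : ℝ := partialSups (fun k => |partialSum d k|) n

/-- The square function of the sequence with increments `d`. -/
noncomputable def squareFn (d : ℕ → ℝ) (n : ℕ) : ℝ := √(∑ i ∈ Finset.range n, d i ^ 2)

variable {d e w : ℕ → ℝ} {c : ℝ}

@[simp]
lemma partialSum_zero (d : ℕ → ℝ) : partialSum d 0 = 0 := Finset.sum_range_zero d

lemma partialSum_succ (d : ℕ → ℝ) (n : ℕ) : partialSum d (n + 1) = partialSum d n + d n :=
  Finset.sum_range_succ d n

lemma partialSum_add (d e : ℕ → ℝ) (n : ℕ) :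
    partialSum (d + e) n = partialSum d n + partialSum e n :=
  Finset.sum_add_distrib

lemma partialSum_indicator_Iio (d : ℕ → ℝ) (i n : ℕ) :
    partialSum ((Set.Iio i).indicator d) n = partialSum d (min i n) := by
  have h : {k ∈ Finset.range n | k ∈ Set.Iio i} = Finset.range (min i n) := by
    ext k
    simp [and_comm]
  simp only [partialSum, Set.indicator_apply, ← Finset.sum_filter, h]

lemma abs_partialSum_le_maxFn (d : ℕ → ℝ) {i n : ℕ} (h : i ≤ n) : |partialSum d i| ≤ maxFn d n :=
  le_partialSups_of_le (fun k => |partialSum d k|) h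

lemma maxFn_le {n : ℕ} (h : ∀ i ≤ n, |partialSum d i| ≤ c) : maxFn d n ≤ c :=
  partialSups_le _ n c h

lemma maxFn_nonneg (d : ℕ → ℝ) (n : ℕ) : 0 ≤ maxFn d n :=
  (abs_nonneg _).trans (abs_partialSum_le_maxFn d le_rfl)

lemma maxFn_mono (d : ℕ → ℝ) : Monotone (maxFn d) := partialSups_monotone _

@[simp]
lemma maxFn_zero (d : ℕ → ℝ) : maxFn d 0 = 0 := by simp [maxFn]

@[simp]
lemma maxFn_zero_left (n : ℕ) : maxFn 0 n = 0 :=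
  le_antisymm (maxFn_le fun i _ => by simp [partialSum]) (maxFn_nonneg 0 n)

lemma maxFn_succ (d : ℕ → ℝ) (n : ℕ) :
    maxFn d (n + 1) = max (maxFn d n) |partialSum d n + d n| := by
  rw [maxFn, partialSups_add_one, partialSum_succ]
  rfl

lemma maxFn_succ_le (d : ℕ → ℝ) (n : ℕ) : maxFn d (n + 1) ≤ maxFn d n + |d n| := by
  rw [maxFn_succ]
  refine max_le (le_add_of_nonneg_right (abs_nonneg _)) ((abs_add_le _ _).trans ?_)
  gcongr
  exact abs_partialSum_le_maxFn d le_rfl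

lemma abs_le_maxFn_add_maxFn (d : ℕ → ℝ) (n : ℕ) : |d n| ≤ maxFn d n + maxFn d (n + 1) := by
  have h := abs_sub (partialSum d (n + 1)) (partialSum d n)
  rw [partialSum_succ, add_sub_cancel_left, ← partialSum_succ] at h
  linarith [abs_partialSum_le_maxFn d (le_refl n), abs_partialSum_le_maxFn d (le_refl (n + 1))]

lemma maxFn_add_le (d e : ℕ → ℝ) (n : ℕ) : maxFn (d + e) n ≤ maxFn d n + maxFn e n :=
  maxFn_le fun i hi => by
    rw [partialSum_add]
    exact (abs_add_le _ _).trans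
      (add_le_add (abs_partialSum_le_maxFn d hi) (abs_partialSum_le_maxFn e hi))

lemma maxFn_le_maxFn_add_tail (d : ℕ → ℝ) (i n : ℕ) :
    maxFn d n ≤ maxFn d i + maxFn ((Set.Ici i).indicator d) n := by
  have hsplit : (Set.Iio i).indicator d + (Set.Ici i).indicator d = d := by
    rw [← Set.compl_Iio, Set.indicator_self_add_compl]
  have hhead : maxFn ((Set.Iio i).indicator d) n ≤ maxFn d i := maxFn_le fun k _ => by
    rw [partialSum_indicator_Iio]
    exact abs_partialSum_le_maxFn d (min_le_left i k)
  calc maxFn d n = maxFn ((Set.Iio i).indicator d + (Set.Ici i).indicator d) n := by rw [hsplit]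
    _ ≤ _ := (maxFn_add_le _ _ _).trans (add_le_add_left hhead _)

lemma maxFn_tail_le (d : ℕ → ℝ) (i n : ℕ) :
    maxFn ((Set.Ici i).indicator d) n ≤ 2 * maxFn d n := by
  refine maxFn_le fun k hk => ?_
  have hsplit : partialSum ((Set.Ici i).indicator d) k
      = partialSum d k - partialSum d (min i k) := by
    rw [← partialSum_indicator_Iio, eq_sub_iff_add_eq', ← partialSum_add, ← Set.compl_Iio,
      Set.indicator_self_add_compl]
  rw [hsplit]
  have h := abs_sub (partialSum d k) (partialSum d (min i k))
  linarith [abs_partialSum_le_maxFn d hk,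
    abs_partialSum_le_maxFn d ((min_le_right i k).trans hk)]

lemma maxFn_mul_le (hw : Monotone w) (hw0 : 0 ≤ w 0) (d : ℕ → ℝ) (n : ℕ) :
    maxFn (fun k => w k * d k) n ≤ 2 * w n * maxFn d n := by
  refine maxFn_le fun k hk => ?_
  have hw_nonneg (i : ℕ) : 0 ≤ w i := hw0.trans (hw i.zero_le)
  have hfirst : |w (k - 1) * partialSum d k| ≤ w (k - 1) * maxFn d n := by
    rw [abs_mul, abs_of_nonneg (hw_nonneg _)]
    exact mul_le_mul_of_nonneg_left (abs_partialSum_le_maxFn d hk) (hw_nonneg _)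
  have hsecond : |∑ i ∈ Finset.range (k - 1), (w (i + 1) - w i) * partialSum d (i + 1)|
      ≤ (w (k - 1) - w 0) * maxFn d n := by
    rw [← Finset.sum_range_sub, Finset.sum_mul]
    refine (Finset.abs_sum_le_sum_abs _ _).trans (Finset.sum_le_sum fun i hi => ?_)
    have hstep : 0 ≤ w (i + 1) - w i := sub_nonneg.2 (hw i.le_succ)
    rw [abs_mul, abs_of_nonneg hstep]
    refine mul_le_mul_of_nonneg_left (abs_partialSum_le_maxFn d ?_) hstep
    have := Finset.mem_range.1 hi
    omega
  have hparts : partialSum (fun i => w i * d i) k = w (k - 1) * partialSum d k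
      - ∑ i ∈ Finset.range (k - 1), (w (i + 1) - w i) * partialSum d (i + 1) :=
    Finset.sum_range_by_parts w d k
  have hwk : w (k - 1) * maxFn d n ≤ w n * maxFn d n :=
    mul_le_mul_of_nonneg_right (hw (by omega)) (maxFn_nonneg d n)
  rw [hparts]
  refine (abs_sub _ _).trans ?_
  linarith [mul_nonneg hw0 (maxFn_nonneg d n)]

lemma squareFn_nonneg (d : ℕ → ℝ) (n : ℕ) : 0 ≤ squareFn d n := Real.sqrt_nonneg _

@[simp]
lemma squareFn_zero (d : ℕ → ℝ) : squareFn d 0 = 0 := by simp [squareFn]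

lemma squareFn_sq (d : ℕ → ℝ) (n : ℕ) : squareFn d n ^ 2 = ∑ i ∈ Finset.range n, d i ^ 2 :=
  Real.sq_sqrt (Finset.sum_nonneg fun _ _ => sq_nonneg _)

lemma squareFn_succ (d : ℕ → ℝ) (n : ℕ) :
    squareFn d (n + 1) = √(squareFn d n ^ 2 + d n ^ 2) := by
  rw [squareFn_sq, ← Finset.sum_range_succ, squareFn]

lemma sqrt_sq_add_sq_le_add_abs {a : ℝ} (ha : 0 ≤ a) (b : ℝ) : √(a ^ 2 + b ^ 2) ≤ a + |b| := by
  refine Real.sqrt_le_iff.2 ⟨by positivity, ?_⟩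
  nlinarith [sq_abs b, mul_nonneg ha (abs_nonneg b)]

lemma squareFn_succ_le (d : ℕ → ℝ) (n : ℕ) : squareFn d (n + 1) ≤ squareFn d n + |d n| :=
  squareFn_succ d n ▸ sqrt_sq_add_sq_le_add_abs (squareFn_nonneg d n) (d n)

lemma abs_le_squareFn (d : ℕ → ℝ) {i n : ℕ} (h : i < n) : |d i| ≤ squareFn d n := by
  refine Real.le_sqrt_of_sq_le ?_
  rw [sq_abs]
  exact Finset.single_le_sum (f := fun k => d k ^ 2) (fun _ _ => sq_nonneg _)
    (Finset.mem_range.2 h)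

lemma squareFn_mono_of_abs_le {n : ℕ} (h : ∀ i < n, |d i| ≤ |e i|) :
    squareFn d n ≤ squareFn e n :=
  Real.sqrt_le_sqrt (Finset.sum_le_sum fun i hi => sq_le_sq.2 (h i (Finset.mem_range.1 hi)))

end PathwiseFunctionals

section Davis

lemma add_abs_div_three_le_sqrt {S d : ℝ} (hS : 0 ≤ S) (h : S ≤ |d|) :
    S + |d| / 3 ≤ √(S ^ 2 + d ^ 2) := by
  apply Real.le_sqrt_of_sq_le
  nlinarith [sq_abs d, abs_nonneg d]

lemma sq_div_le_sqrt_sub {S c d : ℝ} (hS : 0 ≤ S) (hc : 0 < c) (hSc : S ≤ c) (hd : |d| ≤ c) :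
    d ^ 2 / c ≤ 3 * (√(S ^ 2 + d ^ 2) - S) := by
  set S' := √(S ^ 2 + d ^ 2)
  have hsq : S' ^ 2 = S ^ 2 + d ^ 2 := Real.sq_sqrt (by positivity)
  have hSS' : S ≤ S' := Real.le_sqrt_of_sq_le (by nlinarith [sq_nonneg d])
  have hS' : S' ≤ S + |d| := sqrt_sq_add_sq_le_add_abs hS d
  rw [div_le_iff₀ hc]
  calc d ^ 2 = (S' - S) * (S' + S) := by linear_combination -hsq
    _ ≤ (S' - S) * (3 * c) := mul_le_mul_of_nonneg_left (by linarith) (by linarith)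
    _ = 3 * (S' - S) * c := by ring

lemma div_le_div_sub_mul_sub {L c c' κ : ℝ} (hc : 0 < c) (hcc' : c ≤ c') (h : κ * (c * c') ≤ L) :
    L / c' ≤ L / c - κ * (c' - c) := by
  have hc' : 0 < c' := hc.trans_le hcc'
  have heq : L / c - L / c' = L * (c' - c) / (c * c') := by field_simp
  have hle : κ * (c' - c) ≤ L * (c' - c) / (c * c') := by
    rw [le_div_iff₀ (by positivity)]
    nlinarith
  linarith

lemma sq_div_add_le_of_le_max {y c c' δ : ℝ} (hc : 0 < c) (hcc' : c ≤ c') (hδ : 0 ≤ δ)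
    (hc' : c' ≤ max (c + δ) |y|) : y ^ 2 / c' + c' ≤ y ^ 2 / c + c + δ := by
  rcases le_max_iff.1 hc' with h | h
  · have : y ^ 2 / c' ≤ y ^ 2 / c := by gcongr
    linarith
  · have : y ^ 2 / c' ≤ y ^ 2 / c - 1 * (c' - c) := by
      refine div_le_div_sub_mul_sub hc hcc' ?_
      nlinarith [sq_abs y]
    linarith

lemma davis_step {x m S d : ℝ} (hxm : |x| ≤ m) (hS : 0 ≤ S) :
    (x + d) ^ 2 / max (max m |x + d|) √(S ^ 2 + d ^ 2) + max (max m |x + d|) √(S ^ 2 + d ^ 2)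
      ≤ x ^ 2 / max m S + max m S + 2 * (x / max m S * d) + 18 * (√(S ^ 2 + d ^ 2) - S) := by
  set c := max m S
  set S' := √(S ^ 2 + d ^ 2)
  set c' := max (max m |x + d|) S'
  have hmc : m ≤ c := le_max_left _ _
  have hSc : S ≤ c := le_max_right _ _
  have hxc : |x| ≤ c := hxm.trans hmc
  have hc0 : 0 ≤ c := (abs_nonneg _).trans hxc
  have hSS' : S ≤ S' := Real.le_sqrt_of_sq_le (by nlinarith [sq_nonneg d])
  have hS'le : S' ≤ S + |d| := sqrt_sq_add_sq_le_add_abs hS d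
  have hcc' : c ≤ c' := max_le_max (le_max_left _ _) hSS'
  rcases le_or_gt c |d| with hlarge | hsmall
  · have hc'le : c' ≤ c + |d| :=
      max_le (max_le (by linarith [abs_nonneg d]) ((abs_add_le x d).trans (by linarith)))
        (by linarith)
    have hnew : (x + d) ^ 2 / c' ≤ c' := by
      refine div_le_of_le_mul₀ (hc0.trans hcc') (hc0.trans hcc') ?_
      nlinarith [sq_abs (x + d), abs_nonneg (x + d), (le_max_right m |x + d|).trans
        (le_max_left _ S')]
    have hold : 0 ≤ x ^ 2 / c := by positivity
    have hint : |x / c * d| ≤ 1 * |d| := by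
      rw [abs_mul, abs_div, abs_of_nonneg hc0]
      gcongr
      exact div_le_one_of_le₀ hxc hc0
    linarith [neg_abs_le (x / c * d), add_abs_div_three_le_sqrt hS (hSc.trans hlarge)]
  · have hc : 0 < c := (abs_nonneg d).trans_lt hsmall
    have hc' : c' ≤ max (c + (S' - S)) |x + d| :=
      max_le (max_le (le_max_of_le_left (by linarith)) (le_max_right _ _))
        (le_max_of_le_left (by linarith))
    have hstep := sq_div_add_le_of_le_max hc hcc' (sub_nonneg.2 hSS') hc'
    have hexpand : (x + d) ^ 2 / c = x ^ 2 / c + 2 * (x / c * d) + d ^ 2 / c := by ring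
    linarith [sq_div_le_sqrt_sub hS hc hSc hsmall.le]

/-- The bounded predictable integrand in the pathwise form of Davis' inequality. -/
noncomputable def davisIntegrand (d : ℕ → ℝ) (n : ℕ) : ℝ :=
  partialSum d n / max (maxFn d n) (squareFn d n)

lemma abs_davisIntegrand_le (d : ℕ → ℝ) (n : ℕ) : |davisIntegrand d n| ≤ 1 := by
  have h : |partialSum d n| ≤ max (maxFn d n) (squareFn d n) :=
    (abs_partialSum_le_maxFn d le_rfl).trans (le_max_left _ _)
  have h0 := (abs_nonneg _).trans h
  rw [davisIntegrand, abs_div, abs_of_nonneg h0]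
  exact div_le_one_of_le₀ h h0

lemma maxFn_le_integral_add_squareFn (d : ℕ → ℝ) (N : ℕ) :
    maxFn d N ≤ 2 * ∑ n ∈ Finset.range N, davisIntegrand d n * d n + 18 * squareFn d N := by
  have hpotential (n : ℕ) : partialSum d n ^ 2 / max (maxFn d n) (squareFn d n)
      + max (maxFn d n) (squareFn d n)
        ≤ 2 * ∑ k ∈ Finset.range n, davisIntegrand d k * d k + 18 * squareFn d n := by
    induction n with
    | zero => simp
    | succ n ih =>
      have hstep := davis_step (d := d n) (abs_partialSum_le_maxFn d (le_refl n))
        (squareFn_nonneg d n)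
      rw [← maxFn_succ, ← squareFn_succ, ← partialSum_succ, ← davisIntegrand] at hstep
      rw [Finset.sum_range_succ]
      linarith
  have hnonneg : 0 ≤ partialSum d N ^ 2 / max (maxFn d N) (squareFn d N) :=
    div_nonneg (sq_nonneg _) ((maxFn_nonneg d N).trans (le_max_left _ _))
  linarith [hpotential N, le_max_left (maxFn d N) (squareFn d N)]

end Davis

section BlockFunctionals

variable {ι : Type*}

/-- The subsequence of the increments `d` labelled `a` by `σ`, extended by zero. -/
noncomputable def block (σ : ℕ → ι) (d : ℕ → ℝ) (a : ι) : ℕ → ℝ := (σ ⁻¹' {a}).indicator d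

lemma block_mul (σ : ℕ → ι) (w d : ℕ → ℝ) (a : ι) :
    block σ (fun k => w k * d k) a = fun k => w k * block σ d a k :=
  funext fun _ => Set.indicator_mul_right _ _ _

lemma block_indicator (σ : ℕ → ι) (s : Set ℕ) (d : ℕ → ℝ) (a : ι) :
    block σ (s.indicator d) a = s.indicator (block σ d a) := by
  rw [block, block, Set.indicator_indicator, Set.indicator_indicator, Set.inter_comm]

lemma block_self (σ : ℕ → ι) (d : ℕ → ℝ) (n : ℕ) : block σ d (σ n) n = d n :=
  Set.indicator_of_mem (s := σ ⁻¹' {σ n}) rfl d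

lemma abs_block_le_abs {d e : ℕ → ℝ} {i : ℕ} (h : |d i| ≤ |e i|) (σ : ℕ → ι) (a : ι) :
    |block σ d a i| ≤ |block σ e a i| := by
  by_cases hi : i ∈ σ ⁻¹' {a} <;> simp [block, hi, h]

variable [Fintype ι]

/-- The Euclidean norm of the vector of maximal functions of the blocks. -/
noncomputable def blockNorm (σ : ℕ → ι) (d : ℕ → ℝ) (n : ℕ) : ℝ :=
  √(∑ a, maxFn (block σ d a) n ^ 2)

/-- The sum of the maximal functions of the blocks. -/
noncomputable def blockTotal (σ : ℕ → ι) (d : ℕ → ℝ) (n : ℕ) : ℝ := ∑ a, maxFn (block σ d a) n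

/-- The sum of the square functions of the blocks. -/
noncomputable def blockSquare (σ : ℕ → ι) (d : ℕ → ℝ) (n : ℕ) : ℝ := ∑ a, squareFn (block σ d a) n

variable (σ : ℕ → ι) (d e : ℕ → ℝ)

lemma sum_mul_block (g : ι → ℝ) (n : ℕ) : ∑ a, g a * block σ d a n = g (σ n) * d n := by
  classical
  rw [Fintype.sum_eq_single (σ n), block_self]
  intro a ha
  simp [block, ha.symm]

lemma sum_abs_block (n : ℕ) : ∑ a, |block σ d a n| = |d n| := by
  rw [Fintype.sum_eq_single (σ n), block_self]
  intro a ha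
  simp [block, ha.symm]

lemma sum_block_sq (n : ℕ) : ∑ a, block σ d a n ^ 2 = d n ^ 2 := by
  rw [Fintype.sum_eq_single (σ n), block_self]
  intro a ha
  simp [block, ha.symm]

lemma sqrt_sum_add_sq_le (x y : ι → ℝ) :
    √(∑ a, (x a + y a) ^ 2) ≤ √(∑ a, x a ^ 2) + √(∑ a, y a ^ 2) := by
  simpa [EuclideanSpace.norm_eq] using norm_add_le (WithLp.toLp 2 x) (WithLp.toLp 2 y)

lemma blockNorm_nonneg (n : ℕ) : 0 ≤ blockNorm σ d n := Real.sqrt_nonneg _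

lemma blockNorm_sq (n : ℕ) : blockNorm σ d n ^ 2 = ∑ a, maxFn (block σ d a) n ^ 2 :=
  Real.sq_sqrt (Finset.sum_nonneg fun _ _ => sq_nonneg _)

@[simp]
lemma blockNorm_zero : blockNorm σ d 0 = 0 := by simp [blockNorm]

lemma blockNorm_le_sqrt {x : ι → ℝ} {n : ℕ} (h : ∀ a, maxFn (block σ d a) n ≤ x a) :
    blockNorm σ d n ≤ √(∑ a, x a ^ 2) :=
  Real.sqrt_le_sqrt (Finset.sum_le_sum fun a _ => pow_le_pow_left₀ (maxFn_nonneg _ n) (h a) 2)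

lemma blockNorm_mono : Monotone (blockNorm σ d) := fun _ _ h =>
  blockNorm_le_sqrt σ d fun _ => maxFn_mono _ h

lemma maxFn_block_le_blockNorm (a : ι) (n : ℕ) : maxFn (block σ d a) n ≤ blockNorm σ d n :=
  Real.le_sqrt_of_sq_le (Finset.single_le_sum (f := fun a => maxFn (block σ d a) n ^ 2)
    (fun _ _ => sq_nonneg _) (Finset.mem_univ a))

lemma blockNorm_succ_le (n : ℕ) : blockNorm σ d (n + 1) ≤ blockNorm σ d n + |d n| := by
  refine (blockNorm_le_sqrt σ d fun _ => maxFn_succ_le _ n).trans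
    ((sqrt_sum_add_sq_le _ _).trans_eq ?_)
  simp only [sq_abs, sum_block_sq, Real.sqrt_sq_eq_abs, blockNorm]

lemma blockNorm_le_add_tail (i n : ℕ) :
    blockNorm σ d n ≤ blockNorm σ d i + blockNorm σ ((Set.Ici i).indicator d) n := by
  simp only [blockNorm, block_indicator]
  exact (blockNorm_le_sqrt σ d fun _ => maxFn_le_maxFn_add_tail _ i n).trans
    (sqrt_sum_add_sq_le _ _)

lemma blockTotal_nonneg (n : ℕ) : 0 ≤ blockTotal σ d n :=
  Finset.sum_nonneg fun _ _ => maxFn_nonneg _ _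

@[simp]
lemma blockTotal_zero : blockTotal σ d 0 = 0 := by simp [blockTotal]

lemma blockTotal_mono : Monotone (blockTotal σ d) := fun _ _ h =>
  Finset.sum_le_sum fun _ _ => maxFn_mono _ h

lemma blockTotal_succ_le (n : ℕ) : blockTotal σ d (n + 1) ≤ blockTotal σ d n + |d n| := by
  rw [← sum_abs_block σ, blockTotal, blockTotal, ← Finset.sum_add_distrib]
  exact Finset.sum_le_sum fun a _ => maxFn_succ_le _ n

lemma blockTotal_le_add_tail (i n : ℕ) :
    blockTotal σ d n ≤ blockTotal σ d i + blockTotal σ ((Set.Ici i).indicator d) n := by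
  simp only [blockTotal, block_indicator, ← Finset.sum_add_distrib]
  exact Finset.sum_le_sum fun a _ => maxFn_le_maxFn_add_tail _ i n

lemma blockTotal_mul_le {w : ℕ → ℝ} (hw : Monotone w) (hw0 : 0 ≤ w 0) (n : ℕ) :
    blockTotal σ (fun k => w k * d k) n ≤ 2 * w n * blockTotal σ d n := by
  simp only [blockTotal, block_mul, Finset.mul_sum]
  exact Finset.sum_le_sum fun a _ => maxFn_mul_le hw hw0 _ n

lemma blockSquare_nonneg (n : ℕ) : 0 ≤ blockSquare σ d n :=
  Finset.sum_nonneg fun _ _ => squareFn_nonneg _ _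

lemma abs_le_blockSquare {i n : ℕ} (h : i < n) : |d i| ≤ blockSquare σ d n := by
  rw [← block_self σ d i]
  exact (abs_le_squareFn _ h).trans
    (Finset.single_le_sum (fun _ _ => squareFn_nonneg _ _) (Finset.mem_univ (σ i)))

variable {d e} in
lemma blockSquare_mono_of_abs_le {n : ℕ} (h : ∀ i < n, |d i| ≤ |e i|) :
    blockSquare σ d n ≤ blockSquare σ e n :=
  Finset.sum_le_sum fun a _ => squareFn_mono_of_abs_le fun i hi => abs_block_le_abs (h i hi) σ a

@[simp]
lemma blockSquare_zero_left (n : ℕ) : blockSquare σ 0 n = 0 := by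
  simp [blockSquare, squareFn, block]

variable {σ} in
lemma squareFn_le_blockNorm_of_injOn {N : ℕ} (hσ : Set.InjOn σ (Finset.range N)) :
    squareFn d N ≤ blockNorm σ d N := by
  classical
  have hterm {i : ℕ} (hi : i ∈ Finset.range N) : |d i| ≤ maxFn (block σ d (σ i)) N := by
    have hpast : partialSum (block σ d (σ i)) i = 0 := Finset.sum_eq_zero fun k hk => by
      have hki := Finset.mem_range.1 hk
      have hkN := Finset.mem_range.2 (hki.trans (Finset.mem_range.1 hi))
      exact Set.indicator_of_notMem (s := σ ⁻¹' {σ i}) (f := d) fun h => hki.ne (hσ hkN hi h)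
    have h := abs_partialSum_le_maxFn (block σ d (σ i)) (Finset.mem_range.1 hi)
    rwa [Nat.succ_eq_add_one, partialSum_succ, hpast, zero_add, block_self] at h
  refine Real.sqrt_le_sqrt ?_
  calc ∑ i ∈ Finset.range N, d i ^ 2
      ≤ ∑ i ∈ Finset.range N, maxFn (block σ d (σ i)) N ^ 2 := Finset.sum_le_sum fun i hi => by
        rw [← sq_abs]
        exact pow_le_pow_left₀ (abs_nonneg _) (hterm hi) 2
    _ = ∑ a ∈ (Finset.range N).image σ, maxFn (block σ d a) N ^ 2 :=
        (Finset.sum_image (f := fun a => maxFn (block σ d a) N ^ 2) hσ).symm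
    _ ≤ ∑ a, maxFn (block σ d a) N ^ 2 :=
        Finset.sum_le_univ_sum_of_nonneg fun _ => sq_nonneg _

end BlockFunctionals

section VectorMaximalInequality

lemma jump_step_of_le_abs {L L' c c' Q Q' d H : ℝ} (hc : 0 ≤ c) (hcc' : c ≤ c')
    (hd : c ≤ |d|) (hc' : c' ≤ c + 4 * |d|) (hL' : L' ≤ c' ^ 2) (hL : -c ^ 2 ≤ L)
    (hH : |H| ≤ 7 * c) (hQc : 4 * Q ≤ c) (hdQ : |d| ≤ Q + Q') :
    L' / c' + 3 / 8 * c' ≤ L / c + 3 / 8 * c + H / c * d + 36 * (Q' - Q) := by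
  have hnew : L' / c' ≤ c' :=
    div_le_of_le_mul₀ (hc.trans hcc') (hc.trans hcc') (hL'.trans_eq (sq c'))
  have hold : -c ≤ L / c := by
    rcases hc.eq_or_lt with rfl | hc
    · simp
    · rw [le_div_iff₀ hc]
      linarith
  have hint : |H / c * d| ≤ 7 * |d| := by
    rw [abs_mul, abs_div, abs_of_nonneg hc]
    gcongr
    exact div_le_of_le_mul₀ hc (by norm_num) hH
  linarith [neg_abs_le (H / c * d)]

lemma jump_step_of_abs_lt {F' L L' c Q Q' d H : ℝ} (hc : 0 < c) (hcc' : c ≤ max F' (4 * Q'))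
    (hd : |d| < c) (hc' : max F' (4 * Q') ≤ c + 4 * |d|) (hLL' : L' ≤ L + H * d)
    (hL' : F' ^ 2 / 2 - 2 * Q' ^ 2 ≤ L') (hQ' : 0 ≤ Q') (hQQ' : Q ≤ Q') (hQc : 4 * Q ≤ c) :
    L' / max F' (4 * Q') + 3 / 8 * max F' (4 * Q')
      ≤ L / c + 3 / 8 * c + H / c * d + 36 * (Q' - Q) := by
  set c' := max F' (4 * Q') with hc'_def
  have hdiv : L' / c ≤ L / c + H / c * d := by
    rw [div_mul_eq_mul_div, ← add_div]
    gcongr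
  have hQ'c' : 4 * Q' ≤ c' := le_max_right _ _
  rcases le_total (4 * Q') F' with h | h
  · have hF' : c' = F' := max_eq_left h
    have : L' / c' ≤ L' / c - 3 / 8 * (c' - c) := div_le_div_sub_mul_sub hc hcc' (by
      rw [← hF'] at hL'
      nlinarith)
    linarith
  · have hF' : c' = 4 * Q' := max_eq_right h
    have : L' / c' ≤ L' / c - -(5 / 8) * (c' - c) := div_le_div_sub_mul_sub hc hcc' (by
      rw [show Q' = c' / 4 by linarith] at hL'
      nlinarith [sq_nonneg F'])
    linarith

lemma jump_step {F F' G G' x Q d H : ℝ} (hF : 0 ≤ F) (hxQ : |x| ≤ Q)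
    (hFF' : F ≤ F') (hF' : F' ≤ F + |d|) (hG : F ^ 2 / 2 ≤ G) (hG' : F' ^ 2 / 2 ≤ G')
    (hG'F' : G' ≤ F' ^ 2) (hH : |H| ≤ 7 * max F (4 * Q))
    (hstep : G' - 2 * (x + d) ^ 2 ≤ G - 2 * x ^ 2 + H * d) :
    (G' - 2 * (x + d) ^ 2) / max F' (4 * max Q |x + d|) + 3 / 8 * max F' (4 * max Q |x + d|)
      ≤ (G - 2 * x ^ 2) / max F (4 * Q) + 3 / 8 * max F (4 * Q) + H / max F (4 * Q) * d
        + 36 * (max Q |x + d| - Q) := by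
  set c := max F (4 * Q)
  set Q' := max Q |x + d|
  have hQ : 0 ≤ Q := (abs_nonneg _).trans hxQ
  have hFc : F ≤ c := le_max_left _ _
  have hQc : 4 * Q ≤ c := le_max_right _ _
  have hc : 0 ≤ c := hF.trans hFc
  have hQQ' : Q ≤ Q' := le_max_left _ _
  have hxQ' : |x + d| ≤ Q' := le_max_right _ _
  have hcc' : c ≤ max F' (4 * Q') := max_le_max hFF' (by linarith)
  have hd := abs_nonneg d
  have hQ' : Q' ≤ Q + |d| := max_le (by linarith) ((abs_add_le _ _).trans (by linarith))
  have hc' : max F' (4 * Q') ≤ c + 4 * |d| := max_le (by linarith) (by linarith)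
  have hx : x ^ 2 ≤ Q ^ 2 := sq_le_sq' (neg_le_of_abs_le hxQ) (le_of_abs_le hxQ)
  have hx' : (x + d) ^ 2 ≤ Q' ^ 2 := sq_le_sq' (neg_le_of_abs_le hxQ') (le_of_abs_le hxQ')
  rcases le_or_gt c |d| with hlarge | hsmall
  · have hF'c' : F' ^ 2 ≤ max F' (4 * Q') ^ 2 :=
      pow_le_pow_left₀ (hF.trans hFF') (le_max_left _ _) 2
    have hdQ : |d| ≤ |x + d| + |x| := by simpa using abs_sub (x + d) x
    exact jump_step_of_le_abs hc hcc' hlarge hc' (by nlinarith) (by nlinarith) hH hQc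
      (by linarith)
  · exact jump_step_of_abs_lt (hd.trans_lt hsmall) hcc' hsmall hc' hstep (by linarith)
      (hQ.trans hQQ') hQQ' hQc

/-- Burkholder's potential for the maximal function: up to a factor `2` it is the square of the
maximum `M`, but unlike `M ^ 2` its increments are controlled by a linear and a quadratic term in
the increment of `u`. -/
noncomputable def maxPotential (u M : ℝ) : ℝ := (M - |u|) ^ 2 + u ^ 2

lemma sq_div_two_le_maxPotential (u M : ℝ) : M ^ 2 / 2 ≤ maxPotential u M := by
  unfold maxPotential
  nlinarith [sq_nonneg (M - 2 * |u|), sq_abs u]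

lemma maxPotential_le_sq {u M : ℝ} (h : |u| ≤ M) : maxPotential u M ≤ M ^ 2 := by
  unfold maxPotential
  nlinarith [sq_abs u, abs_nonneg u]

lemma abs_add_div_abs_mul_le (u d : ℝ) : |u| + u / |u| * d ≤ |u + d| := by
  rcases eq_or_ne u 0 with rfl | hu
  · simp
  have hu' : |u| ≠ 0 := abs_ne_zero.2 hu
  calc |u| + u / |u| * d = u / |u| * (u + d) := by
        field_simp
        rw [sq_abs]
        ring
    _ ≤ |u / |u| * (u + d)| := le_abs_self _
    _ = |u + d| := by rw [abs_mul, abs_div, abs_abs, div_self hu', one_mul]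

lemma maxPotential_add_le {u M : ℝ} (h : |u| ≤ M) (d : ℝ) :
    maxPotential (u + d) (max M |u + d|) ≤
      maxPotential u M + (4 * u - 2 * M * (u / |u|)) * d + 2 * d ^ 2 := by
  have hM : 0 ≤ M := (abs_nonneg _).trans h
  have hv : |u + d| ^ 2 = u ^ 2 + 2 * u * d + d ^ 2 := by rw [sq_abs]; ring
  have hlin := mul_le_mul_of_nonneg_left (abs_add_div_abs_mul_le u d) hM
  unfold maxPotential
  rw [← sq_abs (u + d)]
  rcases le_total M |u + d| with h' | h'
  · rw [max_eq_right h']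
    nlinarith [sq_abs u, sq_nonneg (M - |u|)]
  · rw [max_eq_left h']
    nlinarith [sq_abs u]

variable {ι : Type*} [Fintype ι] (σ : ℕ → ι) (d : ℕ → ℝ)

/-- The total maximal potential of the blocks. -/
noncomputable def blockPotential (n : ℕ) : ℝ :=
  ∑ a, maxPotential (partialSum (block σ d a) n) (maxFn (block σ d a) n)

lemma blockNorm_sq_div_two_le_blockPotential (n : ℕ) :
    blockNorm σ d n ^ 2 / 2 ≤ blockPotential σ d n := by
  rw [blockNorm_sq, Finset.sum_div]
  exact Finset.sum_le_sum fun a _ => sq_div_two_le_maxPotential _ _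

lemma blockPotential_le_blockNorm_sq (n : ℕ) : blockPotential σ d n ≤ blockNorm σ d n ^ 2 := by
  rw [blockNorm_sq]
  exact Finset.sum_le_sum fun a _ => maxPotential_le_sq (abs_partialSum_le_maxFn _ le_rfl)

/-- The derivative of `blockPotential σ d - 2 * partialSum d ^ 2` in the direction of the
increment at time `n`. -/
noncomputable def blockGradient (n : ℕ) : ℝ :=
  4 * partialSum (block σ d (σ n)) n
    - 2 * maxFn (block σ d (σ n)) n
      * (partialSum (block σ d (σ n)) n / |partialSum (block σ d (σ n)) n|)
    - 4 * partialSum d n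

lemma blockPotential_succ_sub_le (n : ℕ) :
    blockPotential σ d (n + 1) - 2 * (partialSum d n + d n) ^ 2 ≤
      blockPotential σ d n - 2 * partialSum d n ^ 2 + blockGradient σ d n * d n := by
  have hsum : blockPotential σ d (n + 1) ≤ ∑ a, (maxPotential (partialSum (block σ d a) n)
      (maxFn (block σ d a) n) + (4 * partialSum (block σ d a) n - 2 * maxFn (block σ d a) n
        * (partialSum (block σ d a) n / |partialSum (block σ d a) n|)) * block σ d a n
      + 2 * block σ d a n ^ 2) := by
    refine Finset.sum_le_sum fun a _ => ?_
    rw [partialSum_succ, maxFn_succ]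
    exact maxPotential_add_le (abs_partialSum_le_maxFn _ le_rfl) _
  rw [Finset.sum_add_distrib, Finset.sum_add_distrib, sum_mul_block, ← Finset.mul_sum,
    sum_block_sq, ← blockPotential] at hsum
  rw [blockGradient]
  linarith

lemma abs_blockGradient_le (n : ℕ) :
    |blockGradient σ d n| ≤ 7 * max (blockNorm σ d n) (4 * maxFn d n) := by
  have hu := abs_partialSum_le_maxFn (block σ d (σ n)) (le_refl n)
  have hM := maxFn_block_le_blockNorm σ d (σ n) n
  have hx := abs_partialSum_le_maxFn d (le_refl n)
  unfold blockGradient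
  set u := partialSum (block σ d (σ n)) n
  set M := maxFn (block σ d (σ n)) n
  have hsign : |M * (u / |u|)| ≤ M := by
    have hM0 : 0 ≤ M := maxFn_nonneg _ _
    rw [abs_mul, abs_of_nonneg hM0, abs_div, abs_abs]
    exact mul_le_of_le_one_right hM0 (div_self_le_one _)
  rw [abs_le] at hu hx hsign ⊢
  have hF := le_max_left (blockNorm σ d n) (4 * maxFn d n)
  have hQ := le_max_right (blockNorm σ d n) (4 * maxFn d n)
  constructor <;> linarith [hu.1, hu.2, hx.1, hx.2, hsign.1, hsign.2]

/-- The bounded predictable integrand in the pathwise maximal inequality for `blockNorm`. -/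
noncomputable def blockIntegrand (n : ℕ) : ℝ :=
  blockGradient σ d n / max (blockNorm σ d n) (4 * maxFn d n)

lemma max_blockNorm_maxFn_nonneg (n : ℕ) : 0 ≤ max (blockNorm σ d n) (4 * maxFn d n) :=
  (blockNorm_nonneg σ d n).trans (le_max_left _ _)

lemma abs_blockIntegrand_le (n : ℕ) : |blockIntegrand σ d n| ≤ 7 := by
  rw [blockIntegrand, abs_div, abs_of_nonneg (max_blockNorm_maxFn_nonneg σ d n)]
  exact div_le_of_le_mul₀ (max_blockNorm_maxFn_nonneg σ d n) (by norm_num)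
    (abs_blockGradient_le σ d n)

lemma neg_div_eight_le_blockPotential_div (n : ℕ) :
    -(max (blockNorm σ d n) (4 * maxFn d n) / 8) ≤
      (blockPotential σ d n - 2 * partialSum d n ^ 2)
        / max (blockNorm σ d n) (4 * maxFn d n) := by
  have hc := max_blockNorm_maxFn_nonneg σ d n
  set c := max (blockNorm σ d n) (4 * maxFn d n)
  have hQc : 4 * maxFn d n ≤ c := le_max_right _ _
  have hx : |partialSum d n| ≤ maxFn d n := abs_partialSum_le_maxFn d le_rfl
  rcases hc.eq_or_lt with h | h
  · simp [← h]
  rw [le_div_iff₀ h]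
  have hxc : (4 * partialSum d n) ^ 2 ≤ c ^ 2 := sq_le_sq.2 (by
    rw [abs_mul, abs_of_pos four_pos, abs_of_pos h]
    linarith)
  linarith [blockNorm_sq_div_two_le_blockPotential σ d n, sq_nonneg (blockNorm σ d n)]

lemma blockNorm_le_integral_add_maxFn (N : ℕ) :
    blockNorm σ d N ≤
      4 * ∑ n ∈ Finset.range N, blockIntegrand σ d n * d n + 144 * maxFn d N := by
  have hpotential (n : ℕ) : (blockPotential σ d n - 2 * partialSum d n ^ 2)
      / max (blockNorm σ d n) (4 * maxFn d n) + 3 / 8 * max (blockNorm σ d n) (4 * maxFn d n)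
        ≤ ∑ k ∈ Finset.range n, blockIntegrand σ d k * d k + 36 * maxFn d n := by
    induction n with
    | zero => simp
    | succ n ih =>
      have hstep := jump_step (blockNorm_nonneg σ d n) (abs_partialSum_le_maxFn d (le_refl n))
        (blockNorm_mono σ d n.le_succ) (blockNorm_succ_le σ d n)
        (blockNorm_sq_div_two_le_blockPotential σ d n)
        (blockNorm_sq_div_two_le_blockPotential σ d (n + 1))
        (blockPotential_le_blockNorm_sq σ d (n + 1)) (abs_blockGradient_le σ d n)
        (blockPotential_succ_sub_le σ d n)
      rw [← maxFn_succ, ← partialSum_succ, ← blockIntegrand] at hstep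
      rw [Finset.sum_range_succ]
      linarith
  linarith [hpotential N, neg_div_eight_le_blockPotential_div σ d N,
    le_max_left (blockNorm σ d N) (4 * maxFn d N)]

end VectorMaximalInequality

section WeightedBlockSquare

lemma sub_mul_rpow_neg_le {x y s : ℝ} (hy : 0 ≤ y) (hyx : y ≤ x) (hs0 : 0 < s) (hs1 : s < 1) :
    (x - y) * x ^ (-s) ≤ (1 - s)⁻¹ * (x ^ (1 - s) - y ^ (1 - s)) := by
  rcases (hy.trans hyx).eq_or_lt with h | hx
  · obtain rfl : y = x := le_antisymm hyx (h ▸ hy)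
    simp
  have hs : 0 < 1 - s := by linarith
  have hpow : x ^ (1 - s) = x * x ^ (-s) := by
    rw [sub_eq_add_neg, Real.rpow_add hx, Real.rpow_one]
  have hbernoulli : (1 + (y / x - 1)) ^ (1 - s) ≤ 1 + (1 - s) * (y / x - 1) :=
    rpow_one_add_le_one_add_mul_self (by linarith [div_nonneg hy hx.le]) hs.le (by linarith)
  rw [add_sub_cancel, Real.div_rpow hy hx.le, div_le_iff₀ (by positivity), hpow] at hbernoulli
  have hexpand : (1 + (1 - s) * (y / x - 1)) * (x * x ^ (-s))
      = x * x ^ (-s) - (1 - s) * ((x - y) * x ^ (-s)) := by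
    field_simp
    ring
  rw [inv_mul_eq_div, le_div_iff₀ hs, hpow]
  linarith

lemma rpow_neg_mul_le_sum {v z : ℕ → ℝ} {s : ℝ} (hs : 0 ≤ s) (hz : Monotone z) (hz0 : z 0 = 0)
    (hv : Monotone v) (hzv : ∀ n, z n ≤ v n) {n N : ℕ} (hn : n ≤ N) :
    v n ^ (-s) * z n ≤ ∑ i ∈ Finset.range N, (z (i + 1) - z i) * v (i + 1) ^ (-s) := by
  have hz_nonneg (i : ℕ) : 0 ≤ z i := hz0 ▸ hz i.zero_le
  have hterm (i : ℕ) : 0 ≤ (z (i + 1) - z i) * v (i + 1) ^ (-s) :=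
    mul_nonneg (sub_nonneg.2 (hz i.le_succ))
      (Real.rpow_nonneg ((hz_nonneg _).trans (hzv _)) _)
  calc v n ^ (-s) * z n = ∑ i ∈ Finset.range n, (z (i + 1) - z i) * v n ^ (-s) := by
        rw [← Finset.sum_mul, Finset.sum_range_sub, hz0, sub_zero, mul_comm]
    _ ≤ ∑ i ∈ Finset.range n, (z (i + 1) - z i) * v (i + 1) ^ (-s) := by
        refine Finset.sum_le_sum fun i hi => ?_
        rcases (hz_nonneg (i + 1)).eq_or_lt with h | h
        · have : z i = 0 := le_antisymm (h ▸ hz i.le_succ) (hz_nonneg i)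
          simp [← h, this]
        · exact mul_le_mul_of_nonneg_left (Real.rpow_le_rpow_of_nonpos (h.trans_le (hzv _))
            (hv (Finset.mem_range.1 hi)) (neg_nonpos.2 hs)) (sub_nonneg.2 (hz i.le_succ))
    _ ≤ _ := Finset.sum_le_sum_of_subset_of_nonneg (Finset.range_subset_range.2 hn)
        fun i _ _ => hterm i

lemma sum_sub_mul_rpow_neg_le {v : ℕ → ℝ} {s : ℝ} (hs0 : 0 < s) (hs1 : s < 1)
    (hv : Monotone v) (hv0 : v 0 = 0) (N : ℕ) :
    ∑ i ∈ Finset.range N, (v (i + 1) - v i) * v (i + 1) ^ (-s) ≤ (1 - s)⁻¹ * v N ^ (1 - s) :=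
  calc ∑ i ∈ Finset.range N, (v (i + 1) - v i) * v (i + 1) ^ (-s)
      ≤ ∑ i ∈ Finset.range N, (1 - s)⁻¹ * (v (i + 1) ^ (1 - s) - v i ^ (1 - s)) :=
        Finset.sum_le_sum fun i _ =>
          sub_mul_rpow_neg_le (hv0 ▸ hv i.zero_le) (hv i.le_succ) hs0 hs1
    _ = (1 - s)⁻¹ * v N ^ (1 - s) := by
        rw [← Finset.mul_sum, Finset.sum_range_sub (fun i => v i ^ (1 - s)), hv0,
          Real.zero_rpow (by linarith), sub_zero]

lemma squareFn_mul_le {w e : ℕ → ℝ} {B : ℝ} {N : ℕ} (h : ∀ i < N, w i ^ 2 ≤ B) :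
    squareFn (fun i => w i * e i) N ≤ √B * squareFn e N := by
  rw [squareFn, squareFn, ← Real.sqrt_mul' _ (by positivity), Finset.mul_sum]
  refine Real.sqrt_le_sqrt (Finset.sum_le_sum fun i hi => ?_)
  rw [mul_pow]
  exact mul_le_mul_of_nonneg_right (h i (Finset.mem_range.1 hi)) (sq_nonneg _)

variable {ι : Type*} [Fintype ι] (σ : ℕ → ι) (d e : ℕ → ℝ)

lemma sum_squareFn_block_sq (n : ℕ) : ∑ a, squareFn (block σ e a) n ^ 2 = squareFn e n ^ 2 := by
  simp only [squareFn_sq, ← sum_block_sq σ e]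
  exact Finset.sum_comm

/-- The current value of the active block, normalized by a power of `blockNorm σ d`. -/
noncomputable def normalizedBlockSum (s : ℝ) (n : ℕ) : ℝ :=
  blockNorm σ d n ^ (-s) * partialSum (block σ d (σ n)) n

lemma squareFn_block_normalizedBlockSum_mul_le {s : ℝ} (hs : 0 ≤ s) (a : ι) (N : ℕ) :
    squareFn (block σ (fun i => normalizedBlockSum σ d s i * e i) a) N ≤
      √(∑ i ∈ Finset.range N, (maxFn (block σ d a) (i + 1) ^ 2 - maxFn (block σ d a) i ^ 2)
        * (blockNorm σ d (i + 1) ^ 2) ^ (-s)) * squareFn (block σ e a) N := by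
  have hactive : block σ (fun i => normalizedBlockSum σ d s i * e i) a
      = fun i => blockNorm σ d i ^ (-s) * partialSum (block σ d a) i * block σ e a i := by
    rw [block_mul]
    ext i
    by_cases hi : σ i = a
    · rw [normalizedBlockSum, hi]
    · simp [block, hi]
  rw [hactive]
  refine squareFn_mul_le fun i hi => ?_
  refine le_trans ?_ (rpow_neg_mul_le_sum hs
    (z := fun n => maxFn (block σ d a) n ^ 2) (v := fun n => blockNorm σ d n ^ 2)
    (fun _ _ h => pow_le_pow_left₀ (maxFn_nonneg _ _) (maxFn_mono _ h) 2) (by simp)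
    (fun _ _ h => pow_le_pow_left₀ (blockNorm_nonneg _ _ _) (blockNorm_mono _ _ h) 2)
    (fun n => pow_le_pow_left₀ (maxFn_nonneg _ _) (maxFn_block_le_blockNorm σ d a n) 2) hi.le)
  rw [mul_pow, ← Real.rpow_mul_natCast (blockNorm_nonneg _ _ _), mul_comm (-s),
    Real.rpow_natCast_mul (blockNorm_nonneg _ _ _)]
  exact mul_le_mul_of_nonneg_left (sq_le_sq' (neg_le_of_abs_le (abs_partialSum_le_maxFn _ le_rfl))
    (le_of_abs_le (abs_partialSum_le_maxFn _ le_rfl))) (by positivity)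

lemma blockSquare_normalizedBlockSum_mul_le {s : ℝ} (hs0 : 0 < s) (hs1 : s < 1) (N : ℕ) :
    blockSquare σ (fun i => normalizedBlockSum σ d s i * e i) N ≤
      √((1 - s)⁻¹) * (blockNorm σ d N ^ (1 - s) * squareFn e N) := by
  set z : ι → ℕ → ℝ := fun a n => maxFn (block σ d a) n ^ 2
  set v : ℕ → ℝ := fun n => blockNorm σ d n ^ 2 with hv
  set β : ι → ℝ := fun a => ∑ i ∈ Finset.range N, (z a (i + 1) - z a i) * v (i + 1) ^ (-s)
  have hβ_nonneg (a : ι) : 0 ≤ β a := Finset.sum_nonneg fun i _ =>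
    mul_nonneg (sub_nonneg.2 (pow_le_pow_left₀ (maxFn_nonneg _ _) (maxFn_mono _ i.le_succ) 2))
      (Real.rpow_nonneg (sq_nonneg _) _)
  have hβ_sum : ∑ a, β a ≤ (1 - s)⁻¹ * v N ^ (1 - s) := by
    refine le_trans (le_of_eq ?_) (sum_sub_mul_rpow_neg_le hs0 hs1 (v := v)
      (fun _ _ h => pow_le_pow_left₀ (blockNorm_nonneg _ _ _) (blockNorm_mono _ _ h) 2)
      (by simp [hv]) N)
    rw [Finset.sum_comm]
    simp only [← Finset.sum_mul, Finset.sum_sub_distrib, z, v, ← blockNorm_sq]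
  have hvN : v N ^ (1 - s) = (blockNorm σ d N ^ (1 - s)) ^ 2 := by
    rw [← Real.rpow_mul_natCast (blockNorm_nonneg _ _ _), mul_comm,
      Real.rpow_natCast_mul (blockNorm_nonneg _ _ _)]
  calc blockSquare σ (fun i => normalizedBlockSum σ d s i * e i) N
      ≤ ∑ a, √(β a) * √(squareFn (block σ e a) N ^ 2) :=
        Finset.sum_le_sum fun a _ => by
          rw [Real.sqrt_sq (squareFn_nonneg _ _)]
          exact squareFn_block_normalizedBlockSum_mul_le σ d e hs0.le a N
    _ ≤ √(∑ a, β a) * √(∑ a, squareFn (block σ e a) N ^ 2) :=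
        Real.sum_sqrt_mul_sqrt_le _ hβ_nonneg fun _ => sq_nonneg _
    _ ≤ √((1 - s)⁻¹ * v N ^ (1 - s)) * squareFn e N := by
        rw [sum_squareFn_block_sq, Real.sqrt_sq (squareFn_nonneg _ _)]
        gcongr
        exact squareFn_nonneg _ _
    _ = √((1 - s)⁻¹) * (blockNorm σ d N ^ (1 - s) * squareFn e N) := by
        rw [hvN, Real.sqrt_mul (inv_nonneg.2 (by linarith)),
          Real.sqrt_sq (Real.rpow_nonneg (blockNorm_nonneg _ _ _) _), mul_assoc]

end WeightedBlockSquare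

section Measurability

variable {Ω : Type*} {m : MeasurableSpace Ω} {d : ℕ → Ω → ℝ} {n : ℕ}

lemma measurable_partialSum (hd : ∀ i < n, Measurable (d i)) :
    Measurable fun ω => partialSum (d · ω) n :=
  Finset.measurable_fun_sum _ fun i hi => hd i (Finset.mem_range.1 hi)

lemma measurable_maxFn (hd : ∀ i < n, Measurable (d i)) : Measurable fun ω => maxFn (d · ω) n := by
  induction n with
  | zero => simp
  | succ n ih =>
    simp only [maxFn_succ, ← partialSum_succ]
    exact (ih fun i hi => hd i (by omega)).max (measurable_partialSum hd).abs

lemma measurable_squareFn (hd : ∀ i < n, Measurable (d i)) :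
    Measurable fun ω => squareFn (d · ω) n :=
  (Finset.measurable_fun_sum _ fun i hi => (hd i (Finset.mem_range.1 hi)).pow_const 2).sqrt

lemma measurable_davisIntegrand (hd : ∀ i < n, Measurable (d i)) :
    Measurable fun ω => davisIntegrand (d · ω) n :=
  (measurable_partialSum hd).div ((measurable_maxFn hd).max (measurable_squareFn hd))

variable {ι : Type*} [MeasurableSpace ι] [MeasurableSingletonClass ι]
  {σ : ℕ → Ω → ι} {a : Ω → ι}

lemma measurable_block [Countable ι] (ha : Measurable a) {i : ℕ} (hσ : Measurable (σ i))
    (hd : Measurable (d i)) : Measurable fun ω => block (σ · ω) (d · ω) (a ω) i := by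
  classical
  simp only [block, Set.indicator_apply, Set.mem_preimage, Set.mem_singleton_iff]
  exact Measurable.ite (measurableSet_eq_fun hσ ha) hd measurable_const

lemma measurable_activeBlockSum [Countable ι] (hσ : ∀ i ≤ n, Measurable (σ i))
    (hd : ∀ i < n, Measurable (d i)) :
    Measurable fun ω => partialSum (block (σ · ω) (d · ω) (σ n ω)) n :=
  measurable_partialSum fun i hi => measurable_block (hσ n le_rfl) (hσ i hi.le) (hd i hi)

variable [Fintype ι]

lemma measurable_blockNorm (hσ : ∀ i < n, Measurable (σ i)) (hd : ∀ i < n, Measurable (d i)) :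
    Measurable fun ω => blockNorm (σ · ω) (d · ω) n :=
  (Finset.measurable_fun_sum _ fun _ _ => (measurable_maxFn fun i hi =>
    measurable_block measurable_const (hσ i hi) (hd i hi)).pow_const 2).sqrt

lemma measurable_blockTotal (hσ : ∀ i < n, Measurable (σ i)) (hd : ∀ i < n, Measurable (d i)) :
    Measurable fun ω => blockTotal (σ · ω) (d · ω) n :=
  Finset.measurable_fun_sum _ fun _ _ => measurable_maxFn fun i hi =>
    measurable_block measurable_const (hσ i hi) (hd i hi)

lemma measurable_blockIntegrand (hσ : ∀ i ≤ n, Measurable (σ i))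
    (hd : ∀ i < n, Measurable (d i)) :
    Measurable fun ω => blockIntegrand (σ · ω) (d · ω) n := by
  have hu := measurable_activeBlockSum hσ hd
  have hM : Measurable fun ω => maxFn (block (σ · ω) (d · ω) (σ n ω)) n :=
    measurable_maxFn fun i hi => measurable_block (hσ n le_rfl) (hσ i hi.le) (hd i hi)
  exact (((hu.const_mul 4).sub ((hM.const_mul 2).mul (hu.div hu.abs))).sub
    ((measurable_partialSum hd).const_mul 4)).div
      ((measurable_blockNorm (fun i hi => hσ i hi.le) hd).max ((measurable_maxFn hd).const_mul 4))

lemma measurable_normalizedBlockSum (hσ : ∀ i ≤ n, Measurable (σ i))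
    (hd : ∀ i < n, Measurable (d i)) (s : ℝ) :
    Measurable fun ω => normalizedBlockSum (σ · ω) (d · ω) s n :=
  ((measurable_blockNorm (fun i hi => hσ i hi.le) hd).pow_const (-s)).mul
    (measurable_activeBlockSum hσ hd)

end Measurability

section MartingaleDifferences

variable {Ω : Type*} {mΩ : MeasurableSpace Ω} {μ : Measure Ω} {ℱ : Filtration ℕ mΩ}
  {d : ℕ → Ω → ℝ}

/-- A martingale difference sequence; `d n` is the increment from time `n` to time `n + 1`. -/
structure IsMartingaleDiff (ℱ : Filtration ℕ mΩ) (μ : Measure Ω) (d : ℕ → Ω → ℝ) : Prop where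
  measurable_succ : ∀ n, Measurable[ℱ (n + 1)] (d n)
  integrable : ∀ n, Integrable (d n) μ
  condExp_eq_zero : ∀ n, μ[d n | ℱ n] =ᵐ[μ] 0

namespace IsMartingaleDiff

lemma measurable_of_lt (hd : IsMartingaleDiff ℱ μ d) {i n : ℕ} (h : i < n) :
    Measurable[ℱ n] (d i) :=
  (hd.measurable_succ i).mono (ℱ.mono h) le_rfl

lemma measurable (hd : IsMartingaleDiff ℱ μ d) (i : ℕ) : Measurable (d i) :=
  (hd.measurable_succ i).mono (ℱ.le _) le_rfl

lemma memLp_one (hd : IsMartingaleDiff ℱ μ d) (n : ℕ) : MemLp (d n) 1 μ :=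
  memLp_one_iff_integrable.2 (hd.integrable n)

lemma condExp_mul_eq_zero (hd : IsMartingaleDiff ℱ μ d) {n : ℕ} {h : Ω → ℝ}
    (hh : Measurable[ℱ n] h) (hi : Integrable (fun ω => h ω * d n ω) μ) :
    μ[fun ω => h ω * d n ω | ℱ n] =ᵐ[μ] 0 := by
  filter_upwards [condExp_mul_of_stronglyMeasurable_left hh.stronglyMeasurable hi
    (hd.integrable n), hd.condExp_eq_zero n] with ω hmul hzero
  exact hmul.trans (by rw [Pi.mul_apply, hzero, Pi.zero_apply, mul_zero])

lemma transform (hd : IsMartingaleDiff ℱ μ d) {h : ℕ → Ω → ℝ}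
    (hh : ∀ n, Measurable[ℱ n] (h n)) (hi : ∀ n, Integrable (fun ω => h n ω * d n ω) μ) :
    IsMartingaleDiff ℱ μ (fun n ω => h n ω * d n ω) where
  measurable_succ n := ((hh n).mono (ℱ.mono n.le_succ) le_rfl).mul (hd.measurable_succ n)
  integrable := hi
  condExp_eq_zero n := hd.condExp_mul_eq_zero (hh n) (hi n)

lemma integrable_bdd_mul (hd : IsMartingaleDiff ℱ μ d) {n : ℕ} {h : Ω → ℝ}
    (hh : Measurable[ℱ n] h) {C : ℝ} (hC : ∀ ω, |h ω| ≤ C) :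
    Integrable (fun ω => h ω * d n ω) μ :=
  (hd.integrable n).bdd_mul (c := C) (hh.mono (ℱ.le n) le_rfl).aestronglyMeasurable
    (ae_of_all _ hC)

lemma integral_le_of_le_add_integral [IsFiniteMeasure μ] (hd : IsMartingaleDiff ℱ μ d)
    {h : ℕ → Ω → ℝ} (hh : ∀ n, Measurable[ℱ n] (h n)) {C c : ℝ} (hC : ∀ n ω, |h n ω| ≤ C)
    {X Y : Ω → ℝ} (hX : Integrable X μ) (hY : Integrable Y μ) {N : ℕ}
    (hXY : ∀ ω, X ω ≤ c * (∑ n ∈ Finset.range N, h n ω * d n ω) + Y ω) :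
    ∫ ω, X ω ∂μ ≤ ∫ ω, Y ω ∂μ := by
  have hterm (n : ℕ) : Integrable (fun ω => h n ω * d n ω) μ := hd.integrable_bdd_mul (hh n) (hC n)
  have hsum : Integrable (fun ω => ∑ n ∈ Finset.range N, h n ω * d n ω) μ :=
    integrable_finsetSum _ fun n _ => hterm n
  have hzero (n : ℕ) : ∫ ω, h n ω * d n ω ∂μ = 0 := by
    rw [← integral_condExp (ℱ.le n), integral_congr_ae (hd.condExp_mul_eq_zero (hh n) (hterm n))]
    simp
  calc ∫ ω, X ω ∂μ ≤ ∫ ω, (c * (∑ n ∈ Finset.range N, h n ω * d n ω) + Y ω) ∂μ :=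
        integral_mono hX ((hsum.const_mul c).add hY) hXY
    _ = ∫ ω, Y ω ∂μ := by
        rw [integral_add (hsum.const_mul c) hY, integral_const_mul,
          integral_finsetSum _ fun n _ => hterm n, Finset.sum_eq_zero fun n _ => hzero n,
          mul_zero, zero_add]

end IsMartingaleDiff

lemma maxFn_le_sum_abs (d : ℕ → ℝ) (N : ℕ) : maxFn d N ≤ ∑ i ∈ Finset.range N, |d i| := by
  induction N with
  | zero => simp
  | succ N ih =>
    rw [Finset.sum_range_succ]
    linarith [maxFn_succ_le d N]

lemma squareFn_le_sum_abs (d : ℕ → ℝ) (N : ℕ) : squareFn d N ≤ ∑ i ∈ Finset.range N, |d i| := by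
  induction N with
  | zero => simp
  | succ N ih =>
    rw [Finset.sum_range_succ]
    linarith [squareFn_succ_le d N]

variable {ι : Type*} [Fintype ι]

lemma blockNorm_le_sum_abs (σ : ℕ → ι) (d : ℕ → ℝ) (N : ℕ) :
    blockNorm σ d N ≤ ∑ i ∈ Finset.range N, |d i| := by
  induction N with
  | zero => simp
  | succ N ih =>
    rw [Finset.sum_range_succ]
    linarith [blockNorm_succ_le σ d N]

lemma blockTotal_le_sum_abs (σ : ℕ → ι) (d : ℕ → ℝ) (N : ℕ) :
    blockTotal σ d N ≤ ∑ i ∈ Finset.range N, |d i| := by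
  induction N with
  | zero => simp
  | succ N ih =>
    rw [Finset.sum_range_succ]
    linarith [blockTotal_succ_le σ d N]

lemma memLp_of_le_sum_abs {r : ℝ≥0∞} (hd : ∀ n, MemLp (d n) r μ) {X : Ω → ℝ} {N : ℕ}
    (hX : Measurable X) (hX0 : ∀ ω, 0 ≤ X ω) (h : ∀ ω, X ω ≤ ∑ i ∈ Finset.range N, |d i ω|) :
    MemLp X r μ := by
  refine (memLp_finsetSum (Finset.range N) fun i _ => (hd i).abs).mono
    hX.aestronglyMeasurable (ae_of_all _ fun ω => ?_)
  rw [Real.norm_eq_abs, abs_of_nonneg (hX0 ω)]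
  exact (h ω).trans (le_abs_self _)

lemma memLp_maxFn {r : ℝ≥0∞} (hmeas : ∀ n, Measurable (d n)) (hd : ∀ n, MemLp (d n) r μ) (N : ℕ) :
    MemLp (fun ω => maxFn (d · ω) N) r μ :=
  memLp_of_le_sum_abs hd (measurable_maxFn fun i _ => hmeas i) (fun _ => maxFn_nonneg _ _)
    fun _ => maxFn_le_sum_abs _ N

lemma memLp_squareFn {r : ℝ≥0∞} (hmeas : ∀ n, Measurable (d n)) (hd : ∀ n, MemLp (d n) r μ)
    (N : ℕ) : MemLp (fun ω => squareFn (d · ω) N) r μ :=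
  memLp_of_le_sum_abs hd (measurable_squareFn fun i _ => hmeas i) (fun _ => squareFn_nonneg _ _)
    fun _ => squareFn_le_sum_abs _ N

variable [MeasurableSpace ι] [MeasurableSingletonClass ι] {σ : ℕ → Ω → ι}

lemma memLp_blockNorm {r : ℝ≥0∞} (hmeas : ∀ n, Measurable (d n)) (hd : ∀ n, MemLp (d n) r μ)
    (hσ : ∀ n, Measurable (σ n)) (N : ℕ) : MemLp (fun ω => blockNorm (σ · ω) (d · ω) N) r μ :=
  memLp_of_le_sum_abs hd (measurable_blockNorm (fun i _ => hσ i) fun i _ => hmeas i)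
    (fun _ => blockNorm_nonneg _ _ _) fun _ => blockNorm_le_sum_abs _ _ N

lemma memLp_blockTotal {r : ℝ≥0∞} (hmeas : ∀ n, Measurable (d n)) (hd : ∀ n, MemLp (d n) r μ)
    (hσ : ∀ n, Measurable (σ n)) (N : ℕ) : MemLp (fun ω => blockTotal (σ · ω) (d · ω) N) r μ :=
  memLp_of_le_sum_abs hd (measurable_blockTotal (fun i _ => hσ i) fun i _ => hmeas i)
    (fun _ => blockTotal_nonneg _ _ _) fun _ => blockTotal_le_sum_abs _ _ N

namespace IsMartingaleDiff

variable [IsFiniteMeasure μ]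

theorem integral_maxFn_le (hd : IsMartingaleDiff ℱ μ d) (N : ℕ) :
    ∫ ω, maxFn (d · ω) N ∂μ ≤ 18 * ∫ ω, squareFn (d · ω) N ∂μ := by
  rw [← integral_const_mul]
  exact hd.integral_le_of_le_add_integral
    (fun n => measurable_davisIntegrand fun i hi => hd.measurable_of_lt hi)
    (fun _ _ => abs_davisIntegrand_le _ _)
    ((memLp_maxFn hd.measurable hd.memLp_one N).integrable le_rfl)
    (((memLp_squareFn hd.measurable hd.memLp_one N).integrable le_rfl).const_mul 18)
    fun _ => maxFn_le_integral_add_squareFn _ N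

theorem integral_blockNorm_le (hd : IsMartingaleDiff ℱ μ d) (hσ : ∀ n, Measurable[ℱ n] (σ n))
    (N : ℕ) :
    ∫ ω, blockNorm (σ · ω) (d · ω) N ∂μ ≤ 144 * ∫ ω, maxFn (d · ω) N ∂μ := by
  rw [← integral_const_mul]
  exact hd.integral_le_of_le_add_integral
    (fun n => measurable_blockIntegrand (fun i hi => (hσ i).mono (ℱ.mono hi) le_rfl)
      fun i hi => hd.measurable_of_lt hi)
    (fun _ _ => abs_blockIntegrand_le _ _ _)
    ((memLp_blockNorm hd.measurable hd.memLp_one (fun n => (hσ n).mono (ℱ.le n) le_rfl)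
      N).integrable le_rfl)
    (((memLp_maxFn hd.measurable hd.memLp_one N).integrable le_rfl).const_mul 144)
    fun _ => blockNorm_le_integral_add_maxFn _ _ N

end IsMartingaleDiff

end MartingaleDifferences

section MaximalBootstrap

variable {Ω : Type*} {mΩ : MeasurableSpace Ω} {μ : Measure Ω}

lemma lintegral_mul_ofReal_le_of_setIntegral_le {m : MeasurableSpace Ω} (hm : m ≤ mΩ)
    {X Y : Ω → ℝ} (hX : Integrable X μ) (hY : Integrable Y μ) (hX0 : ∀ ω, 0 ≤ X ω)
    (hY0 : ∀ ω, 0 ≤ Y ω)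
    (h : ∀ E, MeasurableSet[m] E → ∫ ω in E, X ω ∂μ ≤ ∫ ω in E, Y ω ∂μ)
    {φ : Ω → ℝ≥0∞} (hφ : Measurable[m] φ) :
    ∫⁻ ω, φ ω * ENNReal.ofReal (X ω) ∂μ ≤ ∫⁻ ω, φ ω * ENNReal.ofReal (Y ω) ∂μ := by
  have hweight {Z : Ω → ℝ} (hZ : Integrable Z μ) : ∫⁻ ω, φ ω * ENNReal.ofReal (Z ω) ∂μ
      = ∫⁻ ω, φ ω ∂((μ.withDensity fun ω => ENNReal.ofReal (Z ω)).trim hm) := by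
    rw [lintegral_trim hm hφ, lintegral_withDensity_eq_lintegral_mul₀
      hZ.aestronglyMeasurable.aemeasurable.ennreal_ofReal (hφ.mono hm le_rfl).aemeasurable]
    exact lintegral_congr fun ω => mul_comm _ _
  rw [hweight hX, hweight hY]
  refine lintegral_mono' (Measure.le_iff.2 fun E hE => ?_) le_rfl
  rw [trim_measurableSet_eq hm hE, trim_measurableSet_eq hm hE, withDensity_apply _ (hm _ hE),
    withDensity_apply _ (hm _ hE),
    ← ofReal_integral_eq_lintegral_ofReal hX.integrableOn (ae_of_all _ hX0),
    ← ofReal_integral_eq_lintegral_ofReal hY.integrableOn (ae_of_all _ hY0)]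
  exact ENNReal.ofReal_le_ofReal (h E hE)

lemma eLpNorm_ofReal_eq {r : ℝ} (hr : 0 < r) {A : Ω → ℝ} (hA0 : ∀ ω, 0 ≤ A ω) :
    eLpNorm A (ENNReal.ofReal r) μ = (∫⁻ ω, ENNReal.ofReal (A ω) ^ r ∂μ) ^ (1 / r) := by
  rw [eLpNorm_eq_lintegral_rpow_enorm_toReal (by simpa using hr) ENNReal.ofReal_ne_top,
    ENNReal.toReal_ofReal hr.le]
  simp only [Real.enorm_eq_ofReal (hA0 _)]

lemma rpow_one_div_le_of_le_mul_rpow {r : ℝ} (hr : 0 < r) {I b : ℝ≥0∞} (hI : I ≠ ∞)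
    (h : I ≤ b * I ^ (1 - 1 / r)) : I ^ (1 / r) ≤ b := by
  rcases eq_or_ne I 0 with h0 | h0
  · rw [h0, ENNReal.zero_rpow_of_pos (by positivity)]
    exact zero_le
  have hsplit : I ^ (1 / r) * I ^ (1 - 1 / r) = I := by
    rw [← ENNReal.rpow_add _ _ h0 hI, add_sub_cancel, ENNReal.rpow_one]
  exact (ENNReal.mul_le_mul_iff_left (by simp [ENNReal.rpow_eq_zero_iff, h0, hI])
    (by simp [ENNReal.rpow_eq_top_iff, h0, hI])).1 (hsplit.trans_le h)

lemma eLpNorm_le_of_lintegral_rpow_le {r : ℝ} (hr : 1 < r) {A B : Ω → ℝ}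
    (hA : MemLp A (ENNReal.ofReal r) μ) (hB : AEMeasurable B μ) (hA0 : ∀ ω, 0 ≤ A ω)
    (hB0 : ∀ ω, 0 ≤ B ω) {c : ℝ≥0∞}
    (h : ∫⁻ ω, ENNReal.ofReal (A ω) ^ r ∂μ ≤
      c * ∫⁻ ω, ENNReal.ofReal (A ω) ^ (r - 1) * ENNReal.ofReal (B ω) ∂μ) :
    eLpNorm A (ENNReal.ofReal r) μ ≤ c * eLpNorm B (ENNReal.ofReal r) μ := by
  have hr0 : 0 < r := one_pos.trans hr
  have hfin := hA.eLpNorm_ne_top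
  rw [eLpNorm_ofReal_eq hr0 hA0] at hfin ⊢
  rw [eLpNorm_ofReal_eq hr0 hB0]
  have hconj : (r / (r - 1)).HolderConjugate r := (Real.HolderConjugate.conjExponent hr).symm
  have hholder := ENNReal.lintegral_mul_le_Lp_mul_Lq μ hconj
    (hA.aestronglyMeasurable.aemeasurable.ennreal_ofReal.pow_const (r - 1)) hB.ennreal_ofReal
  have hexp : 1 / (r / (r - 1)) = 1 - 1 / r := by field_simp
  simp only [Pi.mul_apply, ← ENNReal.rpow_mul, mul_div_cancel₀ r (sub_pos.2 hr).ne',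
    hexp] at hholder
  refine rpow_one_div_le_of_le_mul_rpow hr0 (fun htop => hfin ?_) (h.trans ?_)
  · rw [htop, ENNReal.top_rpow_of_pos (by positivity)]
  · refine (mul_le_mul_right hholder c).trans_eq ?_
    ring

variable {ℱ : Filtration ℕ mΩ}

lemma lintegral_sum_increment_mul_le {θ X : ℕ → Ω → ℝ} {Y : Ω → ℝ} {N : ℕ}
    (hθ : ∀ n, Measurable[ℱ n] (θ n)) (hθ_mono : ∀ ω, Monotone (θ · ω)) (hθ0 : ∀ ω, θ 0 ω = 0)
    (hX : ∀ n ≤ N, Integrable (X n) μ) (hY : Integrable Y μ) (hX0 : ∀ n ≤ N, ∀ ω, 0 ≤ X n ω)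
    (hY0 : ∀ ω, 0 ≤ Y ω)
    (hXY : ∀ n ≤ N, ∀ E, MeasurableSet[ℱ n] E → ∫ ω in E, X n ω ∂μ ≤ ∫ ω in E, Y ω ∂μ) :
    ∫⁻ ω, ENNReal.ofReal (∑ i ∈ Finset.range N, (θ (i + 1) ω - θ i ω) * X (i + 1) ω) ∂μ ≤
      ∫⁻ ω, ENNReal.ofReal (θ N ω) * ENNReal.ofReal (Y ω) ∂μ := by
  have hstep_nonneg (i : ℕ) (ω : Ω) : 0 ≤ θ (i + 1) ω - θ i ω :=
    sub_nonneg.2 (hθ_mono ω i.le_succ)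
  have hstep_meas (i : ℕ) :
      Measurable[ℱ (i + 1)] fun ω => ENNReal.ofReal (θ (i + 1) ω - θ i ω) :=
    ((hθ (i + 1)).sub ((hθ i).mono (ℱ.mono i.le_succ) le_rfl)).ennreal_ofReal
  have hstep_aemeas {Z : Ω → ℝ} (hZ : Integrable Z μ) (i : ℕ) :
      AEMeasurable (fun ω => ENNReal.ofReal (θ (i + 1) ω - θ i ω) * ENNReal.ofReal (Z ω)) μ :=
    ((hstep_meas i).mono (ℱ.le _) le_rfl).aemeasurable.mul
      hZ.aestronglyMeasurable.aemeasurable.ennreal_ofReal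
  calc ∫⁻ ω, ENNReal.ofReal (∑ i ∈ Finset.range N, (θ (i + 1) ω - θ i ω) * X (i + 1) ω) ∂μ
      = ∫⁻ ω, ∑ i ∈ Finset.range N, ENNReal.ofReal (θ (i + 1) ω - θ i ω)
          * ENNReal.ofReal (X (i + 1) ω) ∂μ := by
        refine lintegral_congr fun ω => ?_
        rw [ENNReal.ofReal_sum_of_nonneg fun i hi =>
          mul_nonneg (hstep_nonneg i ω) (hX0 _ (Finset.mem_range.1 hi) ω)]
        simp only [ENNReal.ofReal_mul (hstep_nonneg _ ω)]
    _ = ∑ i ∈ Finset.range N, ∫⁻ ω, ENNReal.ofReal (θ (i + 1) ω - θ i ω)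
          * ENNReal.ofReal (X (i + 1) ω) ∂μ :=
        lintegral_finsetSum' _ fun i hi => hstep_aemeas (hX _ (Finset.mem_range.1 hi)) i
    _ ≤ ∑ i ∈ Finset.range N, ∫⁻ ω, ENNReal.ofReal (θ (i + 1) ω - θ i ω)
          * ENNReal.ofReal (Y ω) ∂μ :=
        Finset.sum_le_sum fun i hi => by
          have hiN : i + 1 ≤ N := Finset.mem_range.1 hi
          exact lintegral_mul_ofReal_le_of_setIntegral_le (ℱ.le _) (hX _ hiN) hY (hX0 _ hiN) hY0
            (hXY _ hiN) (hstep_meas i)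
    _ = ∫⁻ ω, ENNReal.ofReal (θ N ω) * ENNReal.ofReal (Y ω) ∂μ := by
        rw [← lintegral_finsetSum' _ fun i _ => hstep_aemeas hY i]
        refine lintegral_congr fun ω => ?_
        rw [← Finset.sum_mul, ← ENNReal.ofReal_sum_of_nonneg fun i _ => hstep_nonneg i ω,
          Finset.sum_range_sub (θ · ω), hθ0, sub_zero]

lemma eLpNorm_le_of_rpow_le_sum {r c : ℝ} (hr : 1 < r) (hc : 0 ≤ c) {A X : ℕ → Ω → ℝ} {Y : Ω → ℝ}
    {N : ℕ} (hA : ∀ n, Measurable[ℱ n] (A n)) (hA_mono : ∀ ω, Monotone (A · ω))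
    (hA0 : ∀ ω, A 0 ω = 0) (hAN : MemLp (A N) (ENNReal.ofReal r) μ)
    (hX : ∀ n ≤ N, Integrable (X n) μ) (hY : Integrable Y μ) (hX0 : ∀ n ≤ N, ∀ ω, 0 ≤ X n ω)
    (hY0 : ∀ ω, 0 ≤ Y ω)
    (hXY : ∀ n ≤ N, ∀ E, MeasurableSet[ℱ n] E → ∫ ω in E, X n ω ∂μ ≤ ∫ ω in E, Y ω ∂μ)
    (h : ∀ ω, A N ω ^ r ≤ c * ∑ i ∈ Finset.range N,
      (A (i + 1) ω ^ (r - 1) - A i ω ^ (r - 1)) * X (i + 1) ω) :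
    eLpNorm (A N) (ENNReal.ofReal r) μ ≤ ENNReal.ofReal c * eLpNorm Y (ENNReal.ofReal r) μ := by
  have hr1 : 0 < r - 1 := sub_pos.2 hr
  have hA_nonneg (n : ℕ) (ω : Ω) : 0 ≤ A n ω := (hA0 ω).symm.trans_le (hA_mono ω n.zero_le)
  refine eLpNorm_le_of_lintegral_rpow_le hr hAN hY.aestronglyMeasurable.aemeasurable
    (hA_nonneg N) hY0 ?_
  calc ∫⁻ ω, ENNReal.ofReal (A N ω) ^ r ∂μ
      ≤ ∫⁻ ω, ENNReal.ofReal c * ENNReal.ofReal (∑ i ∈ Finset.range N,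
          (A (i + 1) ω ^ (r - 1) - A i ω ^ (r - 1)) * X (i + 1) ω) ∂μ :=
        lintegral_mono fun ω => by
          rw [ENNReal.ofReal_rpow_of_nonneg (hA_nonneg N ω) (by linarith), ← ENNReal.ofReal_mul hc]
          exact ENNReal.ofReal_le_ofReal (h ω)
    _ ≤ ENNReal.ofReal c * ∫⁻ ω, ENNReal.ofReal (A N ω ^ (r - 1)) * ENNReal.ofReal (Y ω) ∂μ := by
        rw [lintegral_const_mul' _ _ ENNReal.ofReal_ne_top]
        refine mul_le_mul_right ?_ _
        exact lintegral_sum_increment_mul_le (fun n => (hA n).pow_const (r - 1))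
          (fun ω _ _ hij => Real.rpow_le_rpow (hA_nonneg _ ω) (hA_mono ω hij) hr1.le)
          (fun ω => by rw [hA0, Real.zero_rpow hr1.ne']) hX hY hX0 hY0 hXY
    _ = ENNReal.ofReal c
          * ∫⁻ ω, ENNReal.ofReal (A N ω) ^ (r - 1) * ENNReal.ofReal (Y ω) ∂μ := by
        simp only [ENNReal.ofReal_rpow_of_nonneg (hA_nonneg N _) hr1.le]

lemma rpow_sub_rpow_le {x y r : ℝ} (hy : 0 ≤ y) (hyx : y ≤ x) (hr : 1 ≤ r) :
    x ^ r - y ^ r ≤ r * (x ^ (r - 1) * (x - y)) := by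
  rcases (hy.trans hyx).eq_or_lt with h | h
  · obtain rfl : y = x := le_antisymm hyx (h ▸ hy)
    simp
  have hbernoulli : 1 + r * (y / x - 1) ≤ (1 + (y / x - 1)) ^ r :=
    one_add_mul_self_le_rpow_one_add (by linarith [div_nonneg hy h.le]) hr
  rw [add_sub_cancel, Real.div_rpow hy h.le, le_div_iff₀ (by positivity)] at hbernoulli
  have hpow : x ^ r = x * x ^ (r - 1) := by
    rw [← Real.rpow_one_add' h.le (by linarith), add_sub_cancel]
  have hexpand : (1 + r * (y / x - 1)) * x ^ r = x ^ r - r * (x ^ (r - 1) * (x - y)) := by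
    rw [hpow]
    field_simp
    ring
  linarith

lemma sum_mul_sub_eq_sum_sub_mul (θ A : ℕ → ℝ) (hθ : θ 0 = 0) (n : ℕ) :
    ∑ i ∈ Finset.range n, θ (i + 1) * (A (i + 1) - A i)
      = ∑ i ∈ Finset.range n, (θ (i + 1) - θ i) * (A n - A i) := by
  induction n with
  | zero => simp
  | succ n ih =>
    have hshift : ∑ i ∈ Finset.range n, (θ (i + 1) - θ i) * (A (n + 1) - A i)
        = ∑ i ∈ Finset.range n, (θ (i + 1) - θ i) * (A n - A i)
          + θ n * (A (n + 1) - A n) := by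
      rw [← sub_zero (θ n), ← hθ, ← Finset.sum_range_sub θ, Finset.sum_mul,
        ← Finset.sum_add_distrib]
      exact Finset.sum_congr rfl fun i _ => by ring
    rw [Finset.sum_range_succ, Finset.sum_range_succ, ih, hshift]
    ring

lemma rpow_le_sum_of_jump_le {A : ℕ → ℝ} {B r : ℝ} {N : ℕ} (hr : 1 < r) (hA : Monotone A)
    (hA0 : A 0 = 0) (hjump : ∀ n < N, A (n + 1) - A n ≤ B) :
    A N ^ r ≤ r * ∑ i ∈ Finset.range N,
      (A (i + 1) ^ (r - 1) - A i ^ (r - 1)) * (A N - A (i + 1) + B) := by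
  have hA_nonneg (n : ℕ) : 0 ≤ A n := hA0.symm.trans_le (hA n.zero_le)
  calc A N ^ r = ∑ i ∈ Finset.range N, (A (i + 1) ^ r - A i ^ r) := by
        rw [Finset.sum_range_sub (fun i => A i ^ r), hA0, Real.zero_rpow (by linarith), sub_zero]
    _ ≤ ∑ i ∈ Finset.range N, r * (A (i + 1) ^ (r - 1) * (A (i + 1) - A i)) :=
        Finset.sum_le_sum fun i _ => rpow_sub_rpow_le (hA_nonneg i) (hA i.le_succ) hr.le
    _ = r * ∑ i ∈ Finset.range N, (A (i + 1) ^ (r - 1) - A i ^ (r - 1)) * (A N - A i) := by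
        rw [← Finset.mul_sum, sum_mul_sub_eq_sum_sub_mul (fun i => A i ^ (r - 1))]
        rw [hA0, Real.zero_rpow (by linarith)]
    _ ≤ _ := by
        gcongr with i hi
        · exact sub_nonneg.2 (Real.rpow_le_rpow (hA_nonneg i) (hA i.le_succ) (by linarith))
        · linarith [hjump i (Finset.mem_range.1 hi)]

theorem eLpNorm_le_of_garsia_neveu [IsFiniteMeasure μ] {r : ℝ} (hr : 1 < r) {A : ℕ → Ω → ℝ}
    {B : Ω → ℝ} {N : ℕ} (hA : ∀ n, Measurable[ℱ n] (A n)) (hA_mono : ∀ ω, Monotone (A · ω))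
    (hA0 : ∀ ω, A 0 ω = 0) (hAN : MemLp (A N) (ENNReal.ofReal r) μ) (hB : Integrable B μ)
    (hB0 : ∀ ω, 0 ≤ B ω) (hjump : ∀ n < N, ∀ ω, A (n + 1) ω - A n ω ≤ B ω)
    (hcond : ∀ n ≤ N, ∀ E, MeasurableSet[ℱ n] E →
      ∫ ω in E, (A N ω - A n ω) ∂μ ≤ ∫ ω in E, B ω ∂μ) :
    eLpNorm (A N) (ENNReal.ofReal r) μ ≤
      ENNReal.ofReal r * eLpNorm (fun ω => 2 * B ω) (ENNReal.ofReal r) μ := by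
  have hA_nonneg (n : ℕ) (ω : Ω) : 0 ≤ A n ω := (hA0 ω).symm.trans_le (hA_mono ω n.zero_le)
  have hAN_int : Integrable (A N) μ := hAN.integrable (by simpa using hr.le)
  have hdiff {n : ℕ} (hn : n ≤ N) : Integrable (fun ω => A N ω - A n ω) μ :=
    hAN_int.sub (hAN_int.mono' ((hA n).mono (ℱ.le n) le_rfl).aestronglyMeasurable
      (ae_of_all _ fun ω => by
        rw [Real.norm_eq_abs, abs_of_nonneg (hA_nonneg n ω)]
        exact hA_mono ω hn))
  refine eLpNorm_le_of_rpow_le_sum hr (by linarith) hA hA_mono hA0 hAN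
    (X := fun n ω => A N ω - A n ω + B ω) (fun n hn => (hdiff hn).add hB) (hB.const_mul 2)
    (fun n hn ω => add_nonneg (sub_nonneg.2 (hA_mono ω hn)) (hB0 ω))
    (fun ω => mul_nonneg two_pos.le (hB0 ω)) (fun n hn E hE => ?_)
    fun ω => rpow_le_sum_of_jump_le hr (hA_mono ω) (hA0 ω) fun n hn => hjump n hn ω
  rw [integral_add (hdiff hn).integrableOn hB.integrableOn, integral_const_mul, two_mul]
  linarith [hcond n hn E hE]

lemma rpow_sub_rpow_le_of_one_lt {x y p : ℝ} (hy : 0 ≤ y) (hyx : y ≤ x) (hp : 1 < p) :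
    x ^ p - y ^ p ≤ p / (p - 1) * ((x ^ (p - 1) - y ^ (p - 1)) * x) := by
  have hx := hy.trans hyx
  have hp1 : 0 < p - 1 := sub_pos.2 hp
  have h := rpow_sub_rpow_le (r := p / (p - 1)) (Real.rpow_nonneg hy (p - 1))
    (Real.rpow_le_rpow hy hyx hp1.le) (by rw [le_div_iff₀ hp1]; linarith)
  have hexp : (p - 1) * (p / (p - 1) - 1) = 1 := by field_simp; ring
  rw [← Real.rpow_mul hx, ← Real.rpow_mul hy, ← Real.rpow_mul hx, mul_div_cancel₀ _ hp1.ne', hexp,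
    Real.rpow_one] at h
  linarith

lemma maxFn_rpow_le_sum {p : ℝ} (hp : 1 < p) (d : ℕ → ℝ) (N : ℕ) :
    maxFn d N ^ p ≤ p / (p - 1) * ∑ i ∈ Finset.range N,
      (maxFn d (i + 1) ^ (p - 1) - maxFn d i ^ (p - 1)) * |partialSum d (i + 1)| := by
  have htelescope := Finset.sum_range_sub (fun i => maxFn d i ^ p) N
  rw [maxFn_zero, Real.zero_rpow (by linarith), sub_zero] at htelescope
  rw [← htelescope, Finset.mul_sum]
  refine Finset.sum_le_sum fun i _ => ?_
  refine (rpow_sub_rpow_le_of_one_lt (maxFn_nonneg d i) (maxFn_mono d i.le_succ) hp).trans_eq ?_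
  -- either the maximum does not grow, or it is attained at time `i + 1`
  rcases max_choice (maxFn d i) |partialSum d (i + 1)| with h | h <;>
    rw [partialSum_succ] at h ⊢ <;> simp [maxFn_succ, h]

end MaximalBootstrap

namespace IsMartingaleDiff

variable {Ω : Type*} {mΩ : MeasurableSpace Ω} {μ : Measure Ω} {ℱ : Filtration ℕ mΩ}
  {d : ℕ → Ω → ℝ}

lemma integrable_partialSum (hd : IsMartingaleDiff ℱ μ d) (n : ℕ) :
    Integrable (fun ω => partialSum (d · ω) n) μ :=
  integrable_finsetSum _ fun i _ => hd.integrable i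

lemma martingale_partialSum [IsFiniteMeasure μ] (hd : IsMartingaleDiff ℱ μ d) :
    Martingale (fun n ω => partialSum (d · ω) n) ℱ μ := by
  refine martingale_of_condExp_sub_eq_zero_nat
    (fun n => (measurable_partialSum fun i hi => hd.measurable_of_lt hi).stronglyMeasurable)
    hd.integrable_partialSum fun n => ?_
  have hstep : (fun ω => partialSum (d · ω) (n + 1)) - (fun ω => partialSum (d · ω) n) = d n := by
    ext ω
    simp [partialSum_succ]
  rw [hstep]
  exact hd.condExp_eq_zero n

theorem eLpNorm_maxFn_le [IsFiniteMeasure μ] (hd : IsMartingaleDiff ℱ μ d) {p : ℝ} (hp : 1 < p)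
    (hdp : ∀ n, MemLp (d n) (ENNReal.ofReal p) μ) (N : ℕ) :
    eLpNorm (fun ω => maxFn (d · ω) N) (ENNReal.ofReal p) μ ≤
      ENNReal.ofReal (p / (p - 1)) *
        eLpNorm (fun ω => partialSum (d · ω) N) (ENNReal.ofReal p) μ := by
  have hmart := hd.martingale_partialSum
  rw [← eLpNorm_norm fun ω => partialSum (d · ω) N]
  refine eLpNorm_le_of_rpow_le_sum (A := fun n ω => maxFn (d · ω) n)
    (X := fun n ω => |partialSum (d · ω) n|) (Y := fun ω => ‖partialSum (d · ω) N‖) hp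
    (div_nonneg (by linarith) (by linarith))
    (fun n => measurable_maxFn fun i hi => hd.measurable_of_lt hi) (fun ω => maxFn_mono _)
    (fun ω => maxFn_zero _) (memLp_maxFn hd.measurable hdp N)
    (fun n _ => (hd.integrable_partialSum n).abs) (hd.integrable_partialSum N).norm
    (fun _ _ _ => abs_nonneg _) (fun _ => norm_nonneg _) (fun n hn E hE => ?_)
    fun ω => maxFn_rpow_le_sum hp _ N
  calc ∫ ω in E, |partialSum (d · ω) n| ∂μ
      = ∫ ω in E, |(μ[fun ω => partialSum (d · ω) N | ℱ n]) ω| ∂μ :=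
        setIntegral_congr_ae (ℱ.le n E hE) ((hmart.condExp_ae_eq hn).mono fun ω h _ => by rw [h])
    _ ≤ ∫ ω in E, |partialSum (d · ω) N| ∂μ :=
        setIntegral_abs_condExp_le hE fun ω => partialSum (d · ω) N

end IsMartingaleDiff

section Restart

variable {Ω : Type*} {mΩ : MeasurableSpace Ω} {μ : Measure Ω} {ℱ : Filtration ℕ mΩ}
  {d : ℕ → Ω → ℝ}

/-- The increments of `d` from time `n` on, restricted to the event `E`. -/
noncomputable def restartedDiff (n : ℕ) (E : Set Ω) (d : ℕ → Ω → ℝ) : ℕ → Ω → ℝ :=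
  (Set.Ici n).indicator fun k => E.indicator (d k)

omit mΩ in
lemma restartedDiff_of_mem {n : ℕ} {E : Set Ω} {ω : Ω} (h : ω ∈ E) :
    (restartedDiff n E d · ω) = (Set.Ici n).indicator (d · ω) := by
  ext k
  by_cases hk : k ∈ Set.Ici n <;> simp [restartedDiff, hk, h]

omit mΩ in
lemma restartedDiff_of_notMem {n : ℕ} {E : Set Ω} {ω : Ω} (h : ω ∉ E) :
    (restartedDiff n E d · ω) = 0 := by
  ext k
  by_cases hk : k ∈ Set.Ici n <;> simp [restartedDiff, hk, h]

namespace IsMartingaleDiff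

lemma indicator (hd : IsMartingaleDiff ℱ μ d) {E : ℕ → Set Ω}
    (hE : ∀ k, MeasurableSet[ℱ k] (E k)) : IsMartingaleDiff ℱ μ fun k => (E k).indicator (d k) where
  measurable_succ k := (hd.measurable_succ k).indicator (ℱ.mono k.le_succ _ (hE k))
  integrable k := (hd.integrable k).indicator (ℱ.le k _ (hE k))
  condExp_eq_zero k := by
    filter_upwards [condExp_indicator (hd.integrable k) (hE k), hd.condExp_eq_zero k] with ω h h0
    simp [h, h0]

lemma restart (hd : IsMartingaleDiff ℱ μ d) {n : ℕ} {E : Set Ω} (hE : MeasurableSet[ℱ n] E) :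
    IsMartingaleDiff ℱ μ (restartedDiff n E d) := by
  classical
  have hevent (k : ℕ) : MeasurableSet[ℱ k] (if n ≤ k then E else ∅) := by
    split_ifs with h
    · exact ℱ.mono h _ hE
    · exact @MeasurableSet.empty _ (ℱ k)
  convert hd.indicator hevent with k
  by_cases hk : n ≤ k
  · simp [restartedDiff, hk]
  · simp [restartedDiff, hk, Pi.zero_def]

variable [IsFiniteMeasure μ]

/-- Restarting the martingale on events reduces an `L^r` bound to `L^1` bounds. -/
theorem eLpNorm_le_of_forall_integral_le (hd : IsMartingaleDiff ℱ μ d) {r : ℝ} (hr : 1 < r)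
    (hdr : ∀ n, MemLp (d n) (ENNReal.ofReal r) μ) {F : Ω → (ℕ → ℝ) → ℕ → ℝ}
    {G : Ω → (ℕ → ℝ) → ℝ} {B : Ω → ℝ} {N : ℕ}
    (hF : ∀ e, IsMartingaleDiff ℱ μ e → ∀ n, Measurable[ℱ n] fun ω => F ω (e · ω) n)
    (hF_zero : ∀ ω x, F ω x 0 = 0) (hF_mono : ∀ ω x, Monotone (F ω x))
    (hF_succ : ∀ ω x n, F ω x (n + 1) ≤ F ω x n + |x n|)
    (hF_tail : ∀ ω x n, F ω x N ≤ F ω x n + F ω ((Set.Ici n).indicator x) N)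
    (hFG : ∀ e, IsMartingaleDiff ℱ μ e → ∫ ω, F ω (e · ω) N ∂μ ≤ ∫ ω, G ω (e · ω) ∂μ)
    (hG_nonneg : ∀ ω x, 0 ≤ G ω x) (hG_zero : ∀ ω, G ω 0 = 0) (hB : Integrable B μ)
    (hGB : ∀ ω n, G ω ((Set.Ici n).indicator (d · ω)) ≤ B ω) (hdB : ∀ n < N, ∀ ω, |d n ω| ≤ B ω) :
    eLpNorm (fun ω => F ω (d · ω) N) (ENNReal.ofReal r) μ ≤
      ENNReal.ofReal r * eLpNorm (fun ω => 2 * B ω) (ENNReal.ofReal r) μ := by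
  have hF_nonneg (ω x n) : 0 ≤ F ω x n := (hF_zero ω x).symm.trans_le (hF_mono ω x n.zero_le)
  have hF_le (ω x n) : F ω x n ≤ ∑ i ∈ Finset.range n, |x i| := by
    induction n with
    | zero => simp [hF_zero]
    | succ n ih =>
      rw [Finset.sum_range_succ]
      linarith [hF_succ ω x n]
  have hF_memLp {e} (he : IsMartingaleDiff ℱ μ e) {q : ℝ≥0∞} (heq : ∀ n, MemLp (e n) q μ) (n) :
      MemLp (fun ω => F ω (e · ω) n) q μ :=
    memLp_of_le_sum_abs heq ((hF e he n).mono (ℱ.le n) le_rfl) (fun ω => hF_nonneg ω _ n)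
      fun ω => hF_le ω _ n
  have hF_int {e} (he : IsMartingaleDiff ℱ μ e) (n) : Integrable (fun ω => F ω (e · ω) n) μ :=
    memLp_one_iff_integrable.1 (hF_memLp he he.memLp_one n)
  refine eLpNorm_le_of_garsia_neveu (A := fun n ω => F ω (d · ω) n) hr (hF d hd)
    (fun ω => hF_mono ω _) (fun ω => hF_zero ω _) (hF_memLp hd hdr N) hB
    (fun ω => (hG_nonneg ω _).trans (hGB ω 0))
    (fun n hn ω => by linarith [hF_succ ω (d · ω) n, hdB n hn ω]) fun n _ E hE => ?_
  have hE' := ℱ.le n E hE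
  have hrestart := hd.restart hE
  calc ∫ ω in E, (F ω (d · ω) N - F ω (d · ω) n) ∂μ
      = ∫ ω, E.indicator (fun ω => F ω (d · ω) N - F ω (d · ω) n) ω ∂μ :=
        (integral_indicator hE').symm
    _ ≤ ∫ ω, F ω (restartedDiff n E d · ω) N ∂μ := by
        refine integral_mono (((hF_int hd N).sub (hF_int hd n)).indicator hE')
          (hF_int hrestart N) fun ω => ?_
        by_cases h : ω ∈ E
        · simp only [Set.indicator_of_mem h, restartedDiff_of_mem h]
          linarith [hF_tail ω (d · ω) n]
        · simpa only [Set.indicator_of_notMem h] using hF_nonneg ω _ N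
    _ ≤ ∫ ω, G ω (restartedDiff n E d · ω) ∂μ := hFG _ hrestart
    _ ≤ ∫ ω, E.indicator B ω ∂μ := by
        refine integral_mono_of_nonneg (ae_of_all _ fun ω => hG_nonneg ω _) (hB.indicator hE')
          (ae_of_all _ fun ω => ?_)
        by_cases h : ω ∈ E
        · simpa only [Set.indicator_of_mem h, restartedDiff_of_mem h] using hGB ω n
        · simp only [Set.indicator_of_notMem h, restartedDiff_of_notMem h, hG_zero, le_refl]
    _ = ∫ ω in E, B ω ∂μ := integral_indicator hE'

end IsMartingaleDiff

end Restart

section BlockBounds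

variable {Ω : Type*} {mΩ : MeasurableSpace Ω} {μ : Measure Ω} {ℱ : Filtration ℕ mΩ}
  {d : ℕ → Ω → ℝ}

lemma eLpNorm_const_mul {c : ℝ} (hc : 0 ≤ c) (f : Ω → ℝ) (p : ℝ≥0∞) :
    eLpNorm (fun ω => c * f ω) p μ = ENNReal.ofReal c * eLpNorm f p μ := by
  have h := eLpNorm_const_smul c f p μ
  rwa [Real.enorm_eq_ofReal hc] at h

lemma isMartingaleDiff_block {ι : Type*} [MeasurableSpace ι] [MeasurableSingletonClass ι]
    {σ : ℕ → Ω → ι} (hd : IsMartingaleDiff ℱ μ d) (hσ : ∀ n, Measurable[ℱ n] (σ n)) (a : ι) :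
    IsMartingaleDiff ℱ μ fun n ω => block (σ · ω) (d · ω) a n :=
  hd.indicator (E := fun n => σ n ⁻¹' {a}) fun n => hσ n (measurableSet_singleton a)

variable [IsFiniteMeasure μ] {ι : Type*} [Fintype ι] [MeasurableSpace ι]
  [MeasurableSingletonClass ι] {σ : ℕ → Ω → ι}

namespace IsMartingaleDiff

theorem eLpNorm_blockNorm_le (hd : IsMartingaleDiff ℱ μ d) {p : ℝ} (hp : 1 < p)
    (hdp : ∀ n, MemLp (d n) (ENNReal.ofReal p) μ) (hσ : ∀ n, Measurable[ℱ n] (σ n)) (N : ℕ) :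
    eLpNorm (fun ω => blockNorm (σ · ω) (d · ω) N) (ENNReal.ofReal p) μ ≤
      ENNReal.ofReal (p * (576 * (p / (p - 1)))) *
        eLpNorm (fun ω => partialSum (d · ω) N) (ENNReal.ofReal p) μ := by
  have hgarsia := hd.eLpNorm_le_of_forall_integral_le hp hdp (N := N)
    (F := fun ω x => blockNorm (σ · ω) x) (G := fun _ x => 144 * maxFn x N)
    (B := fun ω => 288 * maxFn (d · ω) N)
    (fun e he n => measurable_blockNorm (fun i hi => (hσ i).mono (ℱ.mono hi.le) le_rfl)
      fun i hi => he.measurable_of_lt hi)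
    (fun _ _ => blockNorm_zero _ _) (fun _ _ => blockNorm_mono _ _)
    (fun _ _ n => blockNorm_succ_le _ _ n) (fun _ _ n => blockNorm_le_add_tail _ _ n N)
    (fun e he => by
      rw [integral_const_mul]
      exact he.integral_blockNorm_le hσ N)
    (fun _ _ => mul_nonneg (by norm_num) (maxFn_nonneg _ _)) (fun _ => by simp)
    ((memLp_one_iff_integrable.1 (memLp_maxFn hd.measurable hd.memLp_one N)).const_mul 288)
    (fun ω n => by linarith [maxFn_tail_le (d · ω) n N])
    fun n hn ω => by
      linarith [abs_le_maxFn_add_maxFn (d · ω) n, maxFn_mono (d · ω) hn.le,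
        maxFn_mono (d · ω) (show n + 1 ≤ N from hn), maxFn_nonneg (d · ω) N]
  calc eLpNorm (fun ω => blockNorm (σ · ω) (d · ω) N) (ENNReal.ofReal p) μ
      ≤ ENNReal.ofReal p * (ENNReal.ofReal 576 *
          eLpNorm (fun ω => maxFn (d · ω) N) (ENNReal.ofReal p) μ) := by
        rw [← eLpNorm_const_mul (by norm_num)]
        simpa only [← mul_assoc, show (2 : ℝ) * 288 = 576 by norm_num] using hgarsia
    _ ≤ ENNReal.ofReal p * (ENNReal.ofReal 576 * (ENNReal.ofReal (p / (p - 1)) *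
          eLpNorm (fun ω => partialSum (d · ω) N) (ENNReal.ofReal p) μ)) := by
        gcongr
        exact hd.eLpNorm_maxFn_le hp hdp N
    _ = _ := by
        rw [ENNReal.ofReal_mul (by linarith), ENNReal.ofReal_mul (by norm_num)]
        ring

theorem integral_blockTotal_le (hd : IsMartingaleDiff ℱ μ d) (hσ : ∀ n, Measurable[ℱ n] (σ n))
    (N : ℕ) :
    ∫ ω, blockTotal (σ · ω) (d · ω) N ∂μ ≤ 18 * ∫ ω, blockSquare (σ · ω) (d · ω) N ∂μ := by
  have hblock := isMartingaleDiff_block hd hσ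
  simp only [blockTotal, blockSquare]
  rw [integral_finsetSum _ fun a _ => memLp_one_iff_integrable.1
      (memLp_maxFn (hblock a).measurable (hblock a).memLp_one N),
    integral_finsetSum _ fun a _ => memLp_one_iff_integrable.1
      (memLp_squareFn (hblock a).measurable (hblock a).memLp_one N), Finset.mul_sum]
  exact Finset.sum_le_sum fun a _ => (hblock a).integral_maxFn_le N

theorem eLpNorm_blockTotal_le (hd : IsMartingaleDiff ℱ μ d) {r : ℝ} (hr : 1 < r)
    (hdr : ∀ n, MemLp (d n) (ENNReal.ofReal r) μ) (hσ : ∀ n, Measurable[ℱ n] (σ n)) (N : ℕ) :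
    eLpNorm (fun ω => blockTotal (σ · ω) (d · ω) N) (ENNReal.ofReal r) μ ≤
      ENNReal.ofReal (r * 36) *
        eLpNorm (fun ω => blockSquare (σ · ω) (d · ω) N) (ENNReal.ofReal r) μ := by
  have hblock := isMartingaleDiff_block hd hσ
  have hint : Integrable (fun ω => blockSquare (σ · ω) (d · ω) N) μ :=
    integrable_finsetSum _ fun a _ => memLp_one_iff_integrable.1
      (memLp_squareFn (hblock a).measurable (hblock a).memLp_one N)
  have hgarsia := hd.eLpNorm_le_of_forall_integral_le hr hdr (N := N)
    (F := fun ω x => blockTotal (σ · ω) x) (G := fun ω x => 18 * blockSquare (σ · ω) x N)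
    (B := fun ω => 18 * blockSquare (σ · ω) (d · ω) N)
    (fun e he n => measurable_blockTotal (fun i hi => (hσ i).mono (ℱ.mono hi.le) le_rfl)
      fun i hi => he.measurable_of_lt hi)
    (fun _ _ => blockTotal_zero _ _) (fun _ _ => blockTotal_mono _ _)
    (fun _ _ n => blockTotal_succ_le _ _ n) (fun _ _ n => blockTotal_le_add_tail _ _ n N)
    (fun e he => by
      rw [integral_const_mul]
      exact he.integral_blockTotal_le hσ N)
    (fun _ _ => mul_nonneg (by norm_num) (blockSquare_nonneg _ _ _))
    (fun _ => by simp) (hint.const_mul 18)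
    (fun ω n => by
      gcongr
      exact blockSquare_mono_of_abs_le _ fun i _ => by
        by_cases hi : i ∈ Set.Ici n <;> simp [hi])
    fun n hn ω => by
      linarith [abs_le_blockSquare (σ · ω) (d · ω) hn, blockSquare_nonneg (σ · ω) (d · ω) N]
  simp only [← mul_assoc, show (2 : ℝ) * 18 = 36 by norm_num] at hgarsia
  rwa [eLpNorm_const_mul (by norm_num), ← mul_assoc, ← ENNReal.ofReal_mul (by linarith)]
    at hgarsia

end IsMartingaleDiff

end BlockBounds

section Exponents

variable {Ω : Type*} {mΩ : MeasurableSpace Ω} {μ : Measure Ω}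

lemma eLpNorm_rpow_of_nonneg {p s : ℝ} (hs : 0 < s) {F : Ω → ℝ} (hF : ∀ ω, 0 ≤ F ω) :
    eLpNorm (fun ω => F ω ^ s) (ENNReal.ofReal (p / s)) μ = eLpNorm F (ENNReal.ofReal p) μ ^ s := by
  have h := eLpNorm_norm_rpow F hs (p := ENNReal.ofReal (p / s)) (μ := μ)
  rw [← ENNReal.ofReal_mul' hs.le, div_mul_cancel₀ _ hs.ne'] at h
  simpa only [Real.norm_eq_abs, abs_of_nonneg (hF _)] using h

lemma eLpNorm_mul_le_of_holderTriple {p q r : ℝ} (h : p.HolderTriple q r) {F G : Ω → ℝ}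
    (hF : AEStronglyMeasurable F μ) (hG : AEStronglyMeasurable G μ) :
    eLpNorm (fun ω => F ω * G ω) (ENNReal.ofReal r) μ ≤
      eLpNorm F (ENNReal.ofReal p) μ * eLpNorm G (ENNReal.ofReal q) μ := by
  have := h.ennrealOfReal
  simpa only [ENNReal.coe_one, one_mul] using
    eLpNorm_le_eLpNorm_mul_eLpNorm_of_nnnorm (p := ENNReal.ofReal p) (q := ENNReal.ofReal q)
      (r := ENNReal.ofReal r) hF hG (fun a b => a * b) 1
      (ae_of_all _ fun ω => by rw [nnnorm_mul, one_mul])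

lemma eLpNorm_mono_of_nonneg {F G : Ω → ℝ} (hF : ∀ ω, 0 ≤ F ω) (h : ∀ ω, F ω ≤ G ω) (p : ℝ≥0∞) :
    eLpNorm F p μ ≤ eLpNorm G p μ :=
  eLpNorm_mono_real fun ω => by
    rw [Real.norm_eq_abs, abs_of_nonneg (hF ω)]
    exact h ω

lemma holderTriple_of_one_div_add_one_div {p q r : ℝ} (hp : 0 < p) (hq : 0 < q)
    (h : 1 / p + 1 / q = 1 / r) : p.HolderTriple q r := by
  simp only [one_div] at h
  simpa only [h, inv_inv] using Real.HolderTriple.of_pos hp hq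

lemma exists_interpolation_exponents {p q r : ℝ} (hp : 1 < p) (hq : 1 < q)
    (hpqr : 1 / p + 1 / q = 1 / r) :
    ∃ s t : ℝ, 0 < s ∧ s < 1 ∧ 1 < t ∧ (p / (1 - s)).HolderTriple q t ∧
      (p / s).HolderTriple t r := by
  have hp0 : 0 < p := by linarith
  have hq0 : 0 < q := by linarith
  have hq' : 0 < 1 - 1 / q := sub_pos.2 ((div_lt_one hq0).2 hq)
  obtain ⟨v, hv0, hv⟩ := exists_between (lt_min one_pos (mul_pos hp0 hq'))
  obtain ⟨hv1, hvp⟩ := lt_min_iff.1 hv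
  have hvp : v / p < 1 - 1 / q := by rwa [div_lt_iff₀ hp0, mul_comm]
  have hs : 0 < 1 - v := by linarith
  have ht : 0 < v / p + 1 / q := by positivity
  refine ⟨1 - v, 1 / (v / p + 1 / q), hs, by linarith, ?_, ?_, ?_⟩
  · rw [lt_div_iff₀ ht]
    linarith
  · rw [sub_sub_cancel]
    refine holderTriple_of_one_div_add_one_div (by positivity) hq0 ?_
    rw [one_div_div, one_div_one_div]
  · refine holderTriple_of_one_div_add_one_div (by positivity) (by positivity) ?_
    rw [one_div_div, one_div_one_div, ← hpqr]
    field_simp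
    ring

end Exponents

section BlockParaproduct

variable {ι : Type*}

/-- The increments of the block paraproduct: `e n` is multiplied by the sum of the earlier
increments of `d` that lie in the same block. -/
noncomputable def blockParaDiff (σ : ℕ → ι) (d e : ℕ → ℝ) (n : ℕ) : ℝ :=
  partialSum (block σ d (σ n)) n * e n

variable [Fintype ι] (σ : ℕ → ι) (d e : ℕ → ℝ)

lemma abs_activeBlockSum_le_blockNorm (n : ℕ) :
    |partialSum (block σ d (σ n)) n| ≤ blockNorm σ d n :=
  (abs_partialSum_le_maxFn _ le_rfl).trans (maxFn_block_le_blockNorm σ d _ n)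

lemma abs_normalizedBlockSum_le {s : ℝ} (hs : s < 1) (n : ℕ) :
    |normalizedBlockSum σ d s n| ≤ blockNorm σ d n ^ (1 - s) := by
  have hF := blockNorm_nonneg σ d n
  rw [normalizedBlockSum, abs_mul, abs_of_nonneg (Real.rpow_nonneg hF _)]
  calc blockNorm σ d n ^ (-s) * |partialSum (block σ d (σ n)) n|
      ≤ blockNorm σ d n ^ (-s) * blockNorm σ d n := by
        gcongr
        exact abs_activeBlockSum_le_blockNorm σ d n
    _ = blockNorm σ d n ^ (1 - s) := by
        rw [mul_comm, ← Real.rpow_one_add' hF (by linarith), sub_eq_add_neg]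

lemma blockNorm_rpow_mul_normalizedBlockSum (s : ℝ) (n : ℕ) :
    blockNorm σ d n ^ s * normalizedBlockSum σ d s n = partialSum (block σ d (σ n)) n := by
  rcases (blockNorm_nonneg σ d n).eq_or_lt with h | h
  · have hzero := abs_activeBlockSum_le_blockNorm σ d n
    rw [← h, abs_nonpos_iff] at hzero
    rw [normalizedBlockSum, hzero, mul_zero, mul_zero]
  · rw [normalizedBlockSum, ← mul_assoc, ← Real.rpow_add h, add_neg_cancel, Real.rpow_zero, one_mul]

lemma blockTotal_blockParaDiff_le {s : ℝ} (hs : 0 ≤ s) (N : ℕ) :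
    blockTotal σ (blockParaDiff σ d e) N ≤
      2 * (blockNorm σ d N ^ s * blockTotal σ (fun n => normalizedBlockSum σ d s n * e n) N) := by
  have h : blockParaDiff σ d e =
      fun n => blockNorm σ d n ^ s * (normalizedBlockSum σ d s n * e n) := by
    ext n
    rw [← mul_assoc, blockNorm_rpow_mul_normalizedBlockSum, blockParaDiff]
  rw [h, ← mul_assoc]
  exact blockTotal_mul_le σ _ (fun i _ hij =>
    Real.rpow_le_rpow (blockNorm_nonneg σ d i) (blockNorm_mono σ d hij) hs)
    (Real.rpow_nonneg (blockNorm_nonneg σ d 0) _) N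

end BlockParaproduct

section BlockParaproductBound

variable {Ω : Type*} {mΩ : MeasurableSpace Ω} {μ : Measure Ω} {ℱ : Filtration ℕ mΩ}
  {d e : ℕ → Ω → ℝ} {p q r s t : ℝ}

lemma injOn_finOfNat (N : ℕ) : Set.InjOn (Fin.ofNat (N + 1)) (Set.Iic N) := fun i hi j hj hij => by
  simpa [Fin.ext_iff, Nat.mod_eq_of_lt (Nat.lt_succ_of_le hi),
    Nat.mod_eq_of_lt (Nat.lt_succ_of_le hj)] using hij

lemma IsMartingaleDiff.eLpNorm_squareFn_le [IsFiniteMeasure μ] (hd : IsMartingaleDiff ℱ μ d)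
    (hp : 1 < p) (hdp : ∀ n, MemLp (d n) (ENNReal.ofReal p) μ) (N : ℕ) :
    eLpNorm (fun ω => squareFn (d · ω) N) (ENNReal.ofReal p) μ ≤
      ENNReal.ofReal (p * (576 * (p / (p - 1)))) *
        eLpNorm (fun ω => partialSum (d · ω) N) (ENNReal.ofReal p) μ := by
  have hinj : Set.InjOn (Fin.ofNat (N + 1)) (Finset.range N) :=
    (injOn_finOfNat N).mono fun i hi => (Finset.mem_range.1 hi).le
  exact (eLpNorm_mono_of_nonneg (fun _ => squareFn_nonneg _ _)
    (fun ω => squareFn_le_blockNorm_of_injOn (d · ω) hinj) _).trans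
    (hd.eLpNorm_blockNorm_le hp hdp (σ := fun n _ => Fin.ofNat (N + 1) n)
      (fun _ => measurable_const) N)

variable {ι : Type*} [Fintype ι] [MeasurableSpace ι] [MeasurableSingletonClass ι]
  {σ : ℕ → Ω → ι}

lemma memLp_normalizedBlockSum_mul (hd : IsMartingaleDiff ℱ μ d) (he : IsMartingaleDiff ℱ μ e)
    (hdp : ∀ n, MemLp (d n) (ENNReal.ofReal p) μ) (heq : ∀ n, MemLp (e n) (ENNReal.ofReal q) μ)
    (hσ : ∀ n, Measurable (σ n)) (hs : s < 1) (h : (p / (1 - s)).HolderTriple q t) (n : ℕ) :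
    MemLp (fun ω => normalizedBlockSum (σ · ω) (d · ω) s n * e n ω) (ENNReal.ofReal t) μ := by
  have hs' : 0 < 1 - s := by linarith
  have hF := memLp_blockNorm hd.measurable hdp hσ n
  have hb := measurable_normalizedBlockSum (fun i (_ : i ≤ n) => hσ i)
    (fun i _ => hd.measurable i) s
  have hbF : eLpNorm (fun ω => normalizedBlockSum (σ · ω) (d · ω) s n)
      (ENNReal.ofReal (p / (1 - s))) μ < ∞ := by
    refine (eLpNorm_mono_real fun ω => abs_normalizedBlockSum_le _ _ hs n).trans_lt ?_
    rw [eLpNorm_rpow_of_nonneg hs' fun _ => blockNorm_nonneg _ _ _]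
    exact ENNReal.rpow_lt_top_of_nonneg hs'.le hF.eLpNorm_ne_top
  exact ⟨(hb.mul (he.measurable n)).aestronglyMeasurable,
    (eLpNorm_mul_le_of_holderTriple h hb.aestronglyMeasurable
      (he.measurable n).aestronglyMeasurable).trans_lt
        (ENNReal.mul_lt_top hbF (heq n).eLpNorm_lt_top)⟩

variable [IsFiniteMeasure μ]

lemma eLpNorm_blockTotal_normalizedBlockSum_mul_le (hd : IsMartingaleDiff ℱ μ d)
    (he : IsMartingaleDiff ℱ μ e) (hdp : ∀ n, MemLp (d n) (ENNReal.ofReal p) μ)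
    (heq : ∀ n, MemLp (e n) (ENNReal.ofReal q) μ) (hσ : ∀ n, Measurable[ℱ n] (σ n))
    (hs0 : 0 < s) (hs1 : s < 1) (ht : 1 < t) (h : (p / (1 - s)).HolderTriple q t) (N : ℕ) :
    eLpNorm (fun ω => blockTotal (σ · ω)
        (fun n => normalizedBlockSum (σ · ω) (d · ω) s n * e n ω) N) (ENNReal.ofReal t) μ ≤
      ENNReal.ofReal (t * 36 * √((1 - s)⁻¹)) *
        (eLpNorm (fun ω => blockNorm (σ · ω) (d · ω) N) (ENNReal.ofReal p) μ ^ (1 - s) *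
          eLpNorm (fun ω => squareFn (e · ω) N) (ENNReal.ofReal q) μ) := by
  have hσ' (n : ℕ) : Measurable (σ n) := (hσ n).mono (ℱ.le n) le_rfl
  have hbe := memLp_normalizedBlockSum_mul hd he hdp heq hσ' hs1 h
  have htransform : IsMartingaleDiff ℱ μ
      fun n ω => normalizedBlockSum (σ · ω) (d · ω) s n * e n ω :=
    he.transform (fun n => measurable_normalizedBlockSum
      (fun i hi => (hσ i).mono (ℱ.mono hi) le_rfl) (fun i hi => hd.measurable_of_lt hi) s)
      fun n => (hbe n).integrable (ENNReal.one_le_ofReal.2 ht.le)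
  have hF := (memLp_blockNorm hd.measurable hdp hσ' N).aemeasurable.pow_const (1 - s)
  have hS := (memLp_squareFn he.measurable heq N).aestronglyMeasurable
  calc _ ≤ ENNReal.ofReal (t * 36) * eLpNorm (fun ω => √((1 - s)⁻¹) *
          (blockNorm (σ · ω) (d · ω) N ^ (1 - s) * squareFn (e · ω) N)) (ENNReal.ofReal t) μ :=
        (htransform.eLpNorm_blockTotal_le ht hbe hσ N).trans (mul_le_mul' le_rfl
          (eLpNorm_mono_of_nonneg (fun _ => blockSquare_nonneg _ _ _)
            (fun ω => blockSquare_normalizedBlockSum_mul_le _ _ _ hs0 hs1 N) _))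
    _ ≤ _ := by
        rw [eLpNorm_const_mul (Real.sqrt_nonneg _), ← mul_assoc,
          ← ENNReal.ofReal_mul (by positivity)]
        gcongr
        rw [← eLpNorm_rpow_of_nonneg (by linarith) fun _ => blockNorm_nonneg _ _ _]
        exact eLpNorm_mul_le_of_holderTriple h hF.aestronglyMeasurable hS

lemma eLpNorm_blockTotal_blockParaDiff_le (hd : IsMartingaleDiff ℱ μ d)
    (he : IsMartingaleDiff ℱ μ e) (hdp : ∀ n, MemLp (d n) (ENNReal.ofReal p) μ)
    (heq : ∀ n, MemLp (e n) (ENNReal.ofReal q) μ) (hσ : ∀ n, Measurable[ℱ n] (σ n))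
    (hs0 : 0 < s) (hs1 : s < 1) (ht : 1 < t) (h₁ : (p / (1 - s)).HolderTriple q t)
    (h₂ : (p / s).HolderTriple t r) (N : ℕ) :
    eLpNorm (fun ω => blockTotal (σ · ω) (blockParaDiff (σ · ω) (d · ω) (e · ω)) N)
        (ENNReal.ofReal r) μ ≤
      ENNReal.ofReal (2 * (t * 36 * √((1 - s)⁻¹))) *
        (eLpNorm (fun ω => blockNorm (σ · ω) (d · ω) N) (ENNReal.ofReal p) μ *
          eLpNorm (fun ω => squareFn (e · ω) N) (ENNReal.ofReal q) μ) := by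
  have hσ' (n : ℕ) : Measurable (σ n) := (hσ n).mono (ℱ.le n) le_rfl
  have hF := (memLp_blockNorm hd.measurable hdp hσ' N).aemeasurable.pow_const s
  have hT := (memLp_blockTotal (fun n => (measurable_normalizedBlockSum (fun i _ => hσ' i)
    (fun i _ => hd.measurable i) s).mul (he.measurable n))
    (memLp_normalizedBlockSum_mul hd he hdp heq hσ' hs1 h₁) hσ' N).aestronglyMeasurable
  have hbound := eLpNorm_blockTotal_normalizedBlockSum_mul_le hd he hdp heq hσ hs0 hs1 ht h₁ N
  set T : Ω → ℝ := fun ω => blockTotal (σ · ω)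
    (fun n => normalizedBlockSum (σ · ω) (d · ω) s n * e n ω) N
  set φ := eLpNorm (fun ω => blockNorm (σ · ω) (d · ω) N) (ENNReal.ofReal p) μ with hφ
  set ψ := eLpNorm (fun ω => squareFn (e · ω) N) (ENNReal.ofReal q) μ
  have hφs : φ ^ s * φ ^ (1 - s) = φ := by
    rw [← ENNReal.rpow_add_of_nonneg _ _ hs0.le (by linarith), add_sub_cancel, ENNReal.rpow_one]
  calc _ ≤ eLpNorm (fun ω => 2 * (blockNorm (σ · ω) (d · ω) N ^ s * T ω)) (ENNReal.ofReal r) μ :=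
        eLpNorm_mono_of_nonneg (fun _ => blockTotal_nonneg _ _ _)
          (fun ω => blockTotal_blockParaDiff_le _ _ _ hs0.le N) _
    _ ≤ ENNReal.ofReal 2 * (φ ^ s * eLpNorm T (ENNReal.ofReal t) μ) := by
        rw [eLpNorm_const_mul (by norm_num), hφ,
          ← eLpNorm_rpow_of_nonneg hs0 fun _ => blockNorm_nonneg _ _ _]
        gcongr
        exact eLpNorm_mul_le_of_holderTriple h₂ hF.aestronglyMeasurable hT
    _ ≤ ENNReal.ofReal 2 * (φ ^ s *
          (ENNReal.ofReal (t * 36 * √((1 - s)⁻¹)) * (φ ^ (1 - s) * ψ))) := by gcongr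
    _ = ENNReal.ofReal (2 * (t * 36 * √((1 - s)⁻¹))) * (φ ^ s * φ ^ (1 - s) * ψ) := by
        rw [ENNReal.ofReal_mul (p := 2) (by norm_num)]
        ring
    _ = _ := by rw [hφs]

end BlockParaproductBound

section Resets

/-- A sequence recording the most recent of a set of reset times. -/
structure IsResetSeq (σ : ℕ → ℕ) : Prop where
  zero : σ 0 = 0
  succ : ∀ n, σ (n + 1) = σ n ∨ σ (n + 1) = n + 1

namespace IsResetSeq

variable {σ : ℕ → ℕ} (h : IsResetSeq σ)
include h

lemma le (n : ℕ) : σ n ≤ n := by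
  induction n with
  | zero => exact h.zero.le
  | succ n ih => rcases h.succ n with h | h <;> omega

lemma monotone : Monotone σ := monotone_nat_of_le_succ fun n => by
  have := h.le n
  rcases h.succ n with h | h <;> omega

lemma apply_apply (n : ℕ) : σ (σ n) = σ n := by
  induction n with
  | zero => rw [h.zero, h.zero]
  | succ n ih => rcases h.succ n with hn | hn <;> simp only [hn, ih]

lemma eq_of_le {i n : ℕ} (h₁ : σ n ≤ i) (h₂ : i ≤ n) : σ i = σ n :=
  le_antisymm (h.monotone h₂) (by simpa only [h.apply_apply] using h.monotone h₁)

lemma partialSum_block (d : ℕ → ℝ) {n m : ℕ} (hm : σ n ≤ m) (hmn : m ≤ n + 1) :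
    partialSum (block σ d (σ n)) m = ∑ i ∈ Finset.Ico (σ n) m, d i := by
  have hpast : ∑ i ∈ Finset.Ico 0 (σ n), block σ d (σ n) i = 0 :=
    Finset.sum_eq_zero fun i hi => Set.indicator_of_notMem (s := σ ⁻¹' {σ n}) (f := d)
      (((h.le i).trans_lt (Finset.mem_Ico.1 hi).2).ne)
  rw [partialSum, Finset.range_eq_Ico, ← Finset.sum_Ico_consecutive _ (Nat.zero_le _) hm, hpast,
    zero_add]
  refine Finset.sum_congr rfl fun i hi => ?_
  obtain ⟨hni, him⟩ := Finset.mem_Ico.1 hi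
  rw [← h.eq_of_le hni (by omega), block_self]

end IsResetSeq

/-- Some time `u` with `a ≤ u ≤ n` satisfies `thr (n + 1) ≤ |P u (n + 1)|`. -/
def ExceedsSince (P : ℕ → ℕ → ℝ) (thr : ℕ → ℝ) (a n : ℕ) : Prop :=
  ∃ u, a ≤ u ∧ u ≤ n ∧ thr (n + 1) ≤ |P u (n + 1)|

open Classical in
/-- The greedy resets: time `n + 1` is a reset as soon as some `P u (n + 1)`, with `u` at or after
the previous reset, reaches the threshold. -/
noncomputable def resetSeq (P : ℕ → ℕ → ℝ) (thr : ℕ → ℝ) : ℕ → ℕ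
  | 0 => 0
  | n + 1 => if ExceedsSince P thr (resetSeq P thr n) n then n + 1 else resetSeq P thr n

/-- `W a` dominates all values of `P` over intervals ending by time `N` in the block opened by the
reset `a`. -/
def IsBlockBound (P : ℕ → ℕ → ℝ) (σ : ℕ → ℕ) (N : ℕ) (W : ℕ → ℝ) : Prop :=
  ∀ n < N, ∀ u, σ n ≤ u → u ≤ n → |P u (n + 1)| ≤ W (σ n)

variable {P : ℕ → ℕ → ℝ} {thr : ℕ → ℝ}

variable (P thr) in
lemma isResetSeq_resetSeq : IsResetSeq (resetSeq P thr) where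
  zero := rfl
  succ n := by
    rw [resetSeq]
    split_ifs <;> simp

lemma resetSeq_succ_of_exceedsSince {n : ℕ} (h : ExceedsSince P thr (resetSeq P thr n) n) :
    resetSeq P thr (n + 1) = n + 1 := by
  rw [resetSeq, if_pos h]

lemma exists_exceedsSince {u v : ℕ} (huv : u < v) (h : thr v ≤ |P u v|) :
    ∃ n, u ≤ n ∧ n < v ∧ ExceedsSince P thr (resetSeq P thr n) n := by
  by_contra! hcon
  have hle (n : ℕ) (hun : u ≤ n) : n < v → resetSeq P thr n ≤ u := by
    induction n, hun using Nat.le_induction with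
    | base => exact fun _ => (isResetSeq_resetSeq P thr).le u
    | succ n hun ih =>
      intro hnv
      rw [resetSeq, if_neg (hcon n hun (by omega))]
      exact ih (by omega)
  obtain ⟨n, rfl⟩ := Nat.exists_eq_succ_of_ne_zero (Nat.ne_zero_of_lt huv)
  exact hcon n (by omega) (by omega) ⟨u, hle n (by omega) (by omega), by omega, h⟩

variable {N m : ℕ} {n : Fin (m + 1) → ℕ} {s : Finset (Fin m)}

lemma injOn_resetSeq_of_exceedsSince (hn : StrictMono n) {t : Fin m → ℕ}
    (ht : ∀ k ∈ s, n k.castSucc ≤ t k ∧ t k < n k.succ ∧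
      ExceedsSince P thr (resetSeq P thr (t k)) (t k)) :
    Set.InjOn (fun k => resetSeq P thr (t k)) s := by
  have hreset := isResetSeq_resetSeq P thr
  refine StrictMonoOn.injOn fun k hk l hl hkl => ?_
  calc resetSeq P thr (t k) < t k + 1 := Nat.lt_succ_of_le (hreset.le _)
    _ = resetSeq P thr (t k + 1) := (resetSeq_succ_of_exceedsSince (ht k hk).2.2).symm
    _ ≤ resetSeq P thr (t l) := hreset.monotone ((ht k hk).2.1.trans_le
        ((hn.monotone (Fin.succ_le_castSucc_iff.2 hkl)).trans (ht l hl).1))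

/-- Distinct intervals of a partition on which `P` reaches the threshold use up distinct resets. -/
lemma sum_le_sum_of_isBlockBound (hn : StrictMono n) (hN : n (Fin.last m) ≤ N) {W : ℕ → ℝ}
    (hW0 : ∀ a, 0 ≤ W a) (hW : IsBlockBound P (resetSeq P thr) N W) {c : Fin m → ℝ}
    (hs : ∀ k ∈ s, thr (n k.succ) ≤ |P (n k.castSucc) (n k.succ)|)
    (hc : ∀ k ∈ s, ∀ t, n k.castSucc < t → c k ≤ thr t) :
    ∑ k ∈ s, c k ≤ ∑ a ∈ Finset.range N, W a := by
  have hex (k : Fin m) : ∃ t, k ∈ s → n k.castSucc ≤ t ∧ t < n k.succ ∧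
      ExceedsSince P thr (resetSeq P thr t) t := by
    by_cases hk : k ∈ s
    · obtain ⟨t, ht⟩ := exists_exceedsSince (hn k.castSucc_lt_succ) (hs k hk)
      exact ⟨t, fun _ => ht⟩
    · exact ⟨0, fun h => absurd h hk⟩
  choose t ht using hex
  have htN {k : Fin m} (hk : k ∈ s) : t k < N :=
    (ht k hk).2.1.trans_le ((hn.monotone (Fin.le_last _)).trans hN)
  calc ∑ k ∈ s, c k ≤ ∑ k ∈ s, W (resetSeq P thr (t k)) := Finset.sum_le_sum fun k hk => by
        obtain ⟨hkt, -, u, hu, hut, hthr⟩ := ht k hk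
        exact (hc k hk _ (Nat.lt_succ_of_le hkt)).trans (hthr.trans (hW _ (htN hk) u hu hut))
    _ = ∑ a ∈ s.image fun k => resetSeq P thr (t k), W a :=
        (Finset.sum_image (injOn_resetSeq_of_exceedsSince hn ht)).symm
    _ ≤ ∑ a ∈ Finset.range N, W a := by
        refine Finset.sum_le_sum_of_subset_of_nonneg (fun a ha => ?_) fun a _ _ => hW0 a
        obtain ⟨k, hk, rfl⟩ := Finset.mem_image.1 ha
        exact Finset.mem_range.2 (((isResetSeq_resetSeq P thr).le _).trans_lt (htN hk))

end Resets

section Levels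

lemma rpow_eq_rpow_sub_one_mul {x ϱ : ℝ} (hx : 0 ≤ x) (hϱ : 1 < ϱ) :
    x ^ ϱ = x ^ (ϱ - 1) * x := by
  rw [mul_comm, ← Real.rpow_one_add' hx (by linarith), add_sub_cancel]

variable {m : ℕ} {x : Fin (m + 1) → ℝ} {p : Fin m → ℝ} {U ϱ : ℝ} {s : Finset (Fin m)}

lemma sum_rpow_le_of_doubling (hϱ : 1 < ϱ) (hx : Monotone x) (hx0 : 0 ≤ x 0)
    (hxU : x (Fin.last m) ≤ U) (hp : ∀ k, 0 ≤ p k) (hpx : ∀ k, p k ≤ x k.succ)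
    (hs : ∀ k ∈ s, 2 * x k.castSucc < x k.succ) : ∑ k ∈ s, p k ^ ϱ ≤ 2 * U ^ ϱ := by
  have hU : 0 ≤ U := hx0.trans ((hx (Fin.zero_le _)).trans hxU)
  have htelescope : ∑ k : Fin m, (x k.succ - x k.castSucc) = x (Fin.last m) - x 0 := by
    rw [Finset.sum_sub_distrib]
    linarith [Fin.sum_univ_succ x, Fin.sum_univ_castSucc x]
  calc ∑ k ∈ s, p k ^ ϱ ≤ ∑ k ∈ s, U ^ (ϱ - 1) * (2 * (x k.succ - x k.castSucc)) :=
        Finset.sum_le_sum fun k hk => by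
          rw [rpow_eq_rpow_sub_one_mul (hp k) hϱ]
          have hpU : p k ≤ U := (hpx k).trans ((hx (Fin.le_last _)).trans hxU)
          have := hs k hk
          exact mul_le_mul (Real.rpow_le_rpow (hp k) hpU (by linarith)) (by linarith [hpx k])
            (hp k) (by positivity)
    _ = 2 * U ^ (ϱ - 1) * ∑ k ∈ s, (x k.succ - x k.castSucc) := by
        rw [Finset.mul_sum]
        exact Finset.sum_congr rfl fun _ _ => by ring
    _ ≤ 2 * U ^ (ϱ - 1) * U := by
        gcongr
        refine (Finset.sum_le_univ_sum_of_nonneg fun k =>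
          sub_nonneg.2 (hx k.castSucc_lt_succ.le)).trans ?_
        linarith
    _ = 2 * U ^ ϱ := by rw [rpow_eq_rpow_sub_one_mul hU hϱ, mul_assoc]

/-- The growth rate of the level sums that is compatible with a finite `ϱ`-variation: half of the
decay exponent `ϱ - 1` of the heights is spent on the level sums, and the other half is left for
the summation over the levels. -/
noncomputable def levelRatio (ϱ : ℝ) : ℝ := 2 ^ ((ϱ - 1) / 2)

lemma one_lt_levelRatio (hϱ : 1 < ϱ) : 1 < levelRatio ϱ :=
  Real.one_lt_rpow (by norm_num) (by linarith)

lemma half_pow_rpow (ϱ : ℝ) (l : ℕ) :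
    ((1 / 2 : ℝ) ^ l) ^ (ϱ - 1) = ((levelRatio ϱ)⁻¹ ^ l) ^ 2 := by
  have hsq : levelRatio ϱ ^ 2 = 2 ^ (ϱ - 1) := by
    rw [levelRatio, ← Real.rpow_mul_natCast (by norm_num)]
    push_cast
    rw [div_mul_cancel₀ _ two_ne_zero]
  rw [← pow_mul, mul_comm, pow_mul, inv_pow, hsq, one_div, inv_pow, Real.inv_rpow (by positivity),
    inv_pow, ← Real.rpow_natCast_mul (by norm_num), mul_comm, Real.rpow_mul_natCast (by norm_num)]

lemma sum_rpow_le_of_level (hϱ : 1 < ϱ) (hx : Monotone x) (hx0 : 0 ≤ x 0)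
    (hxU : x (Fin.last m) ≤ U) (hp : ∀ k, 0 ≤ p k) {l : ℕ}
    (hpl : ∀ k ∈ s, p k ≤ (1 / 2) ^ l * x k.succ) (hs : ∀ k ∈ s, x k.succ ≤ 2 * x k.castSucc)
    (hsum : ∑ k ∈ s, (1 / 2) ^ (l + 1) * x k.castSucc ≤ levelRatio ϱ ^ (l + 1) * U) :
    ∑ k ∈ s, p k ^ ϱ ≤ 4 * levelRatio ϱ * U ^ ϱ * (levelRatio ϱ)⁻¹ ^ l := by
  have hU : 0 ≤ U := hx0.trans ((hx (Fin.zero_le _)).trans hxU)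
  have hκ : levelRatio ϱ ≠ 0 := by linarith [one_lt_levelRatio hϱ]
  have hl : (0 : ℝ) ≤ (1 / 2) ^ l := by positivity
  calc ∑ k ∈ s, p k ^ ϱ
      ≤ ∑ k ∈ s, ((1 / 2) ^ l * U) ^ (ϱ - 1) * (4 * ((1 / 2) ^ (l + 1) * x k.castSucc)) :=
        Finset.sum_le_sum fun k hk => by
          rw [rpow_eq_rpow_sub_one_mul (hp k) hϱ]
          refine mul_le_mul (Real.rpow_le_rpow (hp k) ?_ (by linarith)) ?_ (hp k) (by positivity)
          · exact (hpl k hk).trans (by gcongr; exact (hx (Fin.le_last _)).trans hxU)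
          · have := mul_le_mul_of_nonneg_left (hs k hk) hl
            rw [pow_succ]
            linarith [hpl k hk]
    _ = ((levelRatio ϱ)⁻¹ ^ l) ^ 2 * U ^ (ϱ - 1) *
          (4 * ∑ k ∈ s, (1 / 2) ^ (l + 1) * x k.castSucc) := by
        rw [← Finset.mul_sum, ← Finset.mul_sum, Real.mul_rpow hl hU, half_pow_rpow]
    _ ≤ ((levelRatio ϱ)⁻¹ ^ l) ^ 2 * U ^ (ϱ - 1) * (4 * (levelRatio ϱ ^ (l + 1) * U)) := by gcongr
    _ = 4 * levelRatio ϱ * U ^ ϱ * (levelRatio ϱ)⁻¹ ^ l := by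
        have hcancel : (levelRatio ϱ)⁻¹ ^ l * levelRatio ϱ ^ l = 1 := by
          rw [← mul_pow, inv_mul_cancel₀ hκ, one_pow]
        rw [rpow_eq_rpow_sub_one_mul hU hϱ]
        linear_combination
          4 * levelRatio ϱ * (levelRatio ϱ)⁻¹ ^ l * (U ^ (ϱ - 1) * U) * hcancel

lemma sum_le_of_levels {ι : Type*} {s : Finset ι} {p x F : ι → ℝ} {B θ : ℝ} (hB : 0 ≤ B)
    (hθ0 : 0 ≤ θ) (hθ1 : θ < 1) (hp : ∀ k ∈ s, 0 < p k) (hpx : ∀ k ∈ s, p k ≤ x k)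
    (h : ∀ l : ℕ, ∀ t ⊆ s, (∀ k ∈ t, (1 / 2) ^ (l + 1) * x k < p k ∧ p k ≤ (1 / 2) ^ l * x k) →
      ∑ k ∈ t, F k ≤ B * θ ^ l) :
    ∑ k ∈ s, F k ≤ B * (1 - θ)⁻¹ := by
  classical
  have hlevel (k : ι) : ∃ l : ℕ, k ∈ s → (1 / 2) ^ (l + 1) * x k < p k ∧
      p k ≤ (1 / 2) ^ l * x k := by
    by_cases hk : k ∈ s
    · have hx := (hp k hk).trans_le (hpx k hk)
      obtain ⟨l, hl, hl'⟩ := exists_nat_pow_near_of_lt_one (y := (1 / 2 : ℝ))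
        (div_pos (hp k hk) hx) (div_le_one_of_le₀ (hpx k hk) hx.le) (by norm_num) (by norm_num)
      exact ⟨l, fun _ => ⟨(lt_div_iff₀ hx).1 hl, (div_le_iff₀ hx).1 hl'⟩⟩
    · exact ⟨0, fun h => absurd h hk⟩
  choose lev hlev using hlevel
  calc ∑ k ∈ s, F k = ∑ l ∈ s.image lev, ∑ k ∈ s with lev k = l, F k :=
        (Finset.sum_fiberwise_of_maps_to (fun k hk => Finset.mem_image_of_mem lev hk) F).symm
    _ ≤ ∑ l ∈ s.image lev, B * θ ^ l := Finset.sum_le_sum fun l _ =>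
        h l _ (Finset.filter_subset _ _) fun k hk => by
          obtain ⟨hks, rfl⟩ := Finset.mem_filter.1 hk
          exact hlev k hks
    _ ≤ B * (1 - θ)⁻¹ := by
        rw [← Finset.mul_sum, ← tsum_geometric_of_lt_one hθ0 hθ1]
        gcongr
        exact (summable_geometric_of_lt_one hθ0 hθ1).sum_le_tsum _ fun _ _ => by positivity

variable {P : ℕ → ℕ → ℝ} {N : ℕ} {n : Fin (m + 1) → ℕ} {X : ℕ → ℝ} {W : ℕ → ℕ → ℝ}

/-- The constant of the pathwise variation estimate: the first term comes from the intervals on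
which the running bound doubles, the second one from the geometric series over the levels. -/
noncomputable def variationConst (ϱ : ℝ) : ℝ :=
  2 + 4 * levelRatio ϱ * (1 - (levelRatio ϱ)⁻¹)⁻¹

lemma variationConst_pos (hϱ : 1 < ϱ) : 0 < variationConst ϱ := by
  have hκ := one_lt_levelRatio hϱ
  have := inv_pos.2 (sub_pos.2 (inv_lt_one_of_one_lt₀ hκ))
  rw [variationConst]
  positivity

/-- The levels compare `P u v` with dyadic fractions of a running bound `X v`. Intervals on which
the running bound doubles are summed by telescoping; on the others it is comparable at all times,
so the resets with threshold `(1 / 2) ^ (l + 1) * X` detect the intervals of level `l`. -/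
lemma sum_rpow_le_of_isBlockBound (hϱ : 1 < ϱ) (hn : StrictMono n) (hN : n (Fin.last m) ≤ N)
    (hX : Monotone X) (hX0 : ∀ t, 0 ≤ X t) (hPX : ∀ u v, u < v → |P u v| ≤ X v)
    (hW0 : ∀ l a, 0 ≤ W l a)
    (hW : ∀ l, IsBlockBound P (resetSeq P fun t => (1 / 2) ^ (l + 1) * X t) N (W l))
    (hXU : X N ≤ U) (hWU : ∀ l, ∑ a ∈ Finset.range N, W l a ≤ levelRatio ϱ ^ (l + 1) * U) :
    ∑ k : Fin m, |P (n k.castSucc) (n k.succ)| ^ ϱ ≤ variationConst ϱ * U ^ ϱ := by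
  have hκ := one_lt_levelRatio hϱ
  have hU : 0 ≤ U := (hX0 N).trans hXU
  set p : Fin m → ℝ := fun k => |P (n k.castSucc) (n k.succ)|
  have hp (k : Fin m) : 0 ≤ p k := abs_nonneg _
  have hpX (k : Fin m) : p k ≤ X (n k.succ) := hPX _ _ (hn k.castSucc_lt_succ)
  have hXn : Monotone fun k => X (n k) := hX.comp hn.monotone
  have hXlast : X (n (Fin.last m)) ≤ U := (hX hN).trans hXU
  set doubling := Finset.univ.filter fun k : Fin m => 2 * X (n k.castSucc) < X (n k.succ)
  set rest := Finset.univ.filter fun k : Fin m => ¬ 2 * X (n k.castSucc) < X (n k.succ)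
  have hrest : ∑ k ∈ rest with p k ≠ 0, p k ^ ϱ ≤
      4 * levelRatio ϱ * U ^ ϱ * (1 - (levelRatio ϱ)⁻¹)⁻¹ := by
    refine sum_le_of_levels (x := fun k => X (n k.succ)) (by positivity) (by positivity)
      (inv_lt_one_of_one_lt₀ hκ) (fun k hk => (hp k).lt_of_ne' (Finset.mem_filter.1 hk).2)
      (fun k _ => hpX k) fun l t ht htl => ?_
    have hlevel := sum_le_sum_of_isBlockBound hn hN (hW0 l) (hW l)
      (c := fun k => (1 / 2) ^ (l + 1) * X (n k.castSucc)) (fun k hk => (htl k hk).1.le)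
      fun k _ t ht => mul_le_mul_of_nonneg_left (hX ht.le) (by positivity)
    exact sum_rpow_le_of_level hϱ hXn (hX0 _) hXlast hp (fun k hk => (htl k hk).2)
      (fun k hk => not_lt.1 (Finset.mem_filter.1 (Finset.mem_filter.1 (ht hk)).1).2)
      (hlevel.trans (hWU l))
  have hpos : ∑ k ∈ rest with p k ≠ 0, p k ^ ϱ = ∑ k ∈ rest, p k ^ ϱ :=
    Finset.sum_filter_of_ne fun k _ hk h0 => hk (by rw [h0, Real.zero_rpow (by linarith)])
  calc ∑ k : Fin m, p k ^ ϱ = ∑ k ∈ doubling, p k ^ ϱ + ∑ k ∈ rest with p k ≠ 0, p k ^ ϱ := by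
        rw [hpos, Finset.sum_filter_add_sum_filter_not]
    _ ≤ 2 * U ^ ϱ + 4 * levelRatio ϱ * U ^ ϱ * (1 - (levelRatio ϱ)⁻¹)⁻¹ :=
        add_le_add (sum_rpow_le_of_doubling hϱ hXn (hX0 _) hXlast hp hpX
          fun k hk => (Finset.mem_filter.1 hk).2) hrest
    _ = variationConst ϱ * U ^ ϱ := by
        rw [variationConst]
        ring

end Levels

section Relabelling

lemma partialSum_congr {d e : ℕ → ℝ} {n : ℕ} (h : ∀ i < n, d i = e i) :
    partialSum d n = partialSum e n :=
  Finset.sum_congr rfl fun i hi => h i (Finset.mem_range.1 hi)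

lemma maxFn_congr {d e : ℕ → ℝ} {n : ℕ} (h : ∀ i < n, d i = e i) : maxFn d n = maxFn e n := by
  have hle {d e : ℕ → ℝ} (h : ∀ i < n, d i = e i) : maxFn d n ≤ maxFn e n :=
    maxFn_le fun i hi => partialSum_congr (fun j hj => h j (hj.trans_le hi)) ▸
      abs_partialSum_le_maxFn e hi
  exact le_antisymm (hle h) (hle fun i hi => (h i hi).symm)

variable {ι κ : Type*} {σ : ℕ → ι} {φ : ι → κ} {s : Set ι} {N : ℕ} {a : ι}

lemma block_comp_apply (hφ : Set.InjOn φ s) (ha : a ∈ s) {i : ℕ} (hi : σ i ∈ s) (d : ℕ → ℝ) :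
    block (φ ∘ σ) d (φ a) i = block σ d a i := by
  classical
  simp only [block, Set.indicator_apply, Set.mem_preimage, Set.mem_singleton_iff,
    Function.comp_apply, hφ.eq_iff hi ha]

lemma maxFn_block_comp (hφ : Set.InjOn φ s) (ha : a ∈ s) (hσ : ∀ i < N, σ i ∈ s) {d d' : ℕ → ℝ}
    (hd : ∀ i < N, d i = d' i) : maxFn (block (φ ∘ σ) d (φ a)) N = maxFn (block σ d' a) N := by
  refine maxFn_congr fun i hi => ?_
  rw [block_comp_apply hφ ha (hσ i hi), block, block]
  by_cases h : i ∈ σ ⁻¹' {a} <;> simp [h, hd i hi]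

lemma blockParaDiff_comp_apply (hφ : Set.InjOn φ s) (hσ : ∀ i < N, σ i ∈ s) (d e : ℕ → ℝ) :
    ∀ i < N, blockParaDiff (φ ∘ σ) d e i = blockParaDiff σ d e i := fun i hi => by
  rw [blockParaDiff, blockParaDiff]
  congr 1
  exact partialSum_congr fun j hj => block_comp_apply hφ (hσ i hi) (hσ j (hj.trans hi)) d

end Relabelling

section BlockWeights

variable {ι : Type*} (σ : ℕ → ι) (d e : ℕ → ℝ)

/-- A bound for all truncated paraproducts over intervals inside the block with label `a`. Its
three maximal functions estimate the terms of `truncParaproduct_eq_sub_sub`. -/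
noncomputable def blockWeight (N : ℕ) (a : ι) : ℝ :=
  2 * maxFn (block σ (blockParaDiff σ d e) a) N +
    2 * (maxFn (block σ d a) N * maxFn (block σ e a) N)

lemma blockWeight_nonneg (N : ℕ) (a : ι) : 0 ≤ blockWeight σ d e N a :=
  add_nonneg (mul_nonneg zero_le_two (maxFn_nonneg _ _))
    (mul_nonneg zero_le_two (mul_nonneg (maxFn_nonneg _ _) (maxFn_nonneg _ _)))

lemma blockWeight_mono (a : ι) : Monotone fun N => blockWeight σ d e N a := fun M N h => by
  have h₁ := maxFn_mono (block σ (blockParaDiff σ d e) a) h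
  have h₂ := maxFn_mono (block σ d a) h
  have h₃ := maxFn_mono (block σ e a) h
  have h₂N := maxFn_nonneg (block σ d a) N
  have h₃M := maxFn_nonneg (block σ e a) M
  simp only [blockWeight]
  gcongr

lemma sum_blockWeight_le [Fintype ι] (N : ℕ) :
    ∑ a, blockWeight σ d e N a ≤
      2 * blockTotal σ (blockParaDiff σ d e) N + 2 * (blockNorm σ d N * blockNorm σ e N) := by
  simp only [blockWeight, Finset.sum_add_distrib, ← Finset.mul_sum]
  have := Real.sum_mul_le_sqrt_mul_sqrt Finset.univ (fun a => maxFn (block σ d a) N)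
    fun a => maxFn (block σ e a) N
  exact add_le_add le_rfl (mul_le_mul_of_nonneg_left this zero_le_two)

lemma blockWeight_comp {κ : Type*} {σ : ℕ → ι} {φ : ι → κ} {s : Set ι} {N : ℕ} {a : ι}
    (hφ : Set.InjOn φ s) (ha : a ∈ s) (hσ : ∀ i < N, σ i ∈ s) :
    blockWeight (φ ∘ σ) d e N (φ a) = blockWeight σ d e N a := by
  simp only [blockWeight, maxFn_block_comp hφ ha hσ (d := d) fun _ _ => rfl,
    maxFn_block_comp hφ ha hσ (d := e) fun _ _ => rfl,
    maxFn_block_comp hφ ha hσ (blockParaDiff_comp_apply hφ hσ d e)]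

/-- The sum of the block weights over all labels `a < N`. -/
noncomputable def totalWeight (σ : ℕ → ℕ) (N : ℕ) : ℝ :=
  ∑ a ∈ Finset.range N, blockWeight σ d e N a

lemma totalWeight_nonneg (σ : ℕ → ℕ) (N : ℕ) : 0 ≤ totalWeight d e σ N :=
  Finset.sum_nonneg fun _ _ => blockWeight_nonneg _ _ _ _ _

lemma totalWeight_mono (σ : ℕ → ℕ) : Monotone (totalWeight d e σ) := fun _ _ h =>
  (Finset.sum_le_sum fun a _ => blockWeight_mono σ d e a h).trans
    (Finset.sum_le_sum_of_subset_of_nonneg (Finset.range_subset_range.2 h)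
      fun _ _ _ => blockWeight_nonneg _ _ _ _ _)

lemma totalWeight_le {σ : ℕ → ℕ} {N : ℕ} (hσ : ∀ n < N, σ n ≤ N) :
    totalWeight d e σ N ≤
      2 * blockTotal (Fin.ofNat (N + 1) ∘ σ) (blockParaDiff (Fin.ofNat (N + 1) ∘ σ) d e) N +
        2 * (blockNorm (Fin.ofNat (N + 1) ∘ σ) d N * blockNorm (Fin.ofNat (N + 1) ∘ σ) e N) :=
  calc totalWeight d e σ N ≤ ∑ a ∈ Finset.range (N + 1), blockWeight σ d e N a :=
        Finset.sum_le_sum_of_subset_of_nonneg (Finset.range_subset_range.2 N.le_succ)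
          fun _ _ _ => blockWeight_nonneg _ _ _ _ _
    _ = ∑ a : Fin (N + 1), blockWeight (Fin.ofNat (N + 1) ∘ σ) d e N a := by
        rw [← Fin.sum_univ_eq_sum_range]
        refine Finset.sum_congr rfl fun a _ => ?_
        rw [← blockWeight_comp d e (injOn_finOfNat N) (Nat.lt_succ_iff.1 a.2) hσ,
          Fin.ofNat_val_eq_self]
    _ ≤ _ := sum_blockWeight_le _ _ _ N

end BlockWeights

section Paraproducts

variable {Ω : Type*}

/-- The increments `f (n + 1) - f n` of a process, indexed by the left end point. In this indexing,
which is the one of `partialSum`, `increment f n` is `procDiff f (n + 1)`. -/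
def increment (f : ℕ → Ω → ℝ) (n : ℕ) (ω : Ω) : ℝ := f (n + 1) ω - f n ω

variable (f g : ℕ → Ω → ℝ) (ω : Ω)

lemma sum_Ico_increment {u v : ℕ} (h : u ≤ v) :
    ∑ i ∈ Finset.Ico u v, increment f i ω = f v ω - f u ω :=
  Finset.sum_Ico_sub (f · ω) h

lemma sum_Ioo_procDiff {u n : ℕ} (h : u ≤ n) :
    ∑ i ∈ Finset.Ioo u (n + 1), procDiff f i ω = f n ω - f u ω := by
  have hIoo : Finset.Ioo u (n + 1) = Finset.Ico (u + 1) (n + 1) := by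
    ext
    simp
  rw [hIoo, ← Finset.sum_Ico_add' _ u n 1]
  exact sum_Ico_increment f ω h

lemma truncParaproduct_eq_sum (u v : ℕ) :
    truncParaproduct f g u v ω = ∑ n ∈ Finset.Ico u v, (f n ω - f u ω) * increment g n ω := by
  have hIoc : Finset.Ioc u v = Finset.Ico (u + 1) (v + 1) := by
    ext
    simp
  rw [truncParaproduct, hIoc, ← Finset.sum_Ico_add' _ u v 1]
  refine Finset.sum_congr rfl fun n hn => ?_
  rw [← Finset.sum_mul, sum_Ioo_procDiff f ω (Finset.mem_Ico.1 hn).1]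
  rfl

lemma truncParaproduct_eq_sub_sub {a u v : ℕ} (hau : a ≤ u) (huv : u ≤ v) :
    truncParaproduct f g u v ω = truncParaproduct f g a v ω - truncParaproduct f g a u ω
      - (f u ω - f a ω) * (g v ω - g u ω) := by
  rw [truncParaproduct_eq_sum, truncParaproduct_eq_sum, truncParaproduct_eq_sum,
    ← Finset.sum_Ico_consecutive _ hau huv, ← sum_Ico_increment g ω huv, Finset.mul_sum,
    add_sub_cancel_left, ← Finset.sum_sub_distrib]
  exact Finset.sum_congr rfl fun n _ => by ring

namespace IsResetSeq

variable {σ : ℕ → ℕ} (h : IsResetSeq σ) {n m N : ℕ}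
include h

lemma abs_sub_le_maxFn_block (hm : σ n ≤ m) (hmn : m ≤ n + 1) (hnN : n < N) :
    |f m ω - f (σ n) ω| ≤ maxFn (block σ (increment f · ω) (σ n)) N := by
  rw [← sum_Ico_increment f ω hm, ← h.partialSum_block _ hm hmn]
  exact abs_partialSum_le_maxFn _ (by omega)

lemma abs_truncParaproduct_le_maxFn_block (hm : σ n ≤ m) (hmn : m ≤ n + 1) (hnN : n < N) :
    |truncParaproduct f g (σ n) m ω| ≤
      maxFn (block σ (blockParaDiff σ (increment f · ω) (increment g · ω)) (σ n)) N := by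
  have hsum : truncParaproduct f g (σ n) m ω = partialSum
      (block σ (blockParaDiff σ (increment f · ω) (increment g · ω)) (σ n)) m := by
    rw [truncParaproduct_eq_sum, h.partialSum_block _ hm hmn]
    refine Finset.sum_congr rfl fun i hi => ?_
    obtain ⟨hni, him⟩ := Finset.mem_Ico.1 hi
    rw [blockParaDiff, h.eq_of_le hni (by omega), h.partialSum_block _ hni (by omega),
      sum_Ico_increment f ω hni]
  rw [hsum]
  exact abs_partialSum_le_maxFn _ (by omega)

lemma isBlockBound (N : ℕ) :
    IsBlockBound (truncParaproduct f g · · ω) σ N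
      (blockWeight σ (increment f · ω) (increment g · ω) N) := fun n hn u hu hun => by
  have hv := hu.trans (hun.trans n.le_succ)
  have hu₀ := h.abs_truncParaproduct_le_maxFn_block f g ω hu (hun.trans n.le_succ) hn
  have hv₀ := h.abs_truncParaproduct_le_maxFn_block f g ω hv le_rfl hn
  have hf := h.abs_sub_le_maxFn_block f ω hu (hun.trans n.le_succ) hn
  have hg : |g (n + 1) ω - g u ω| ≤ 2 * maxFn (block σ (increment g · ω) (σ n)) N := by
    have hgu := h.abs_sub_le_maxFn_block g ω hu (hun.trans n.le_succ) hn
    have hgv := h.abs_sub_le_maxFn_block g ω hv le_rfl hn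
    have := abs_sub (g (n + 1) ω - g (σ n) ω) (g u ω - g (σ n) ω)
    rw [sub_sub_sub_cancel_right] at this
    linarith
  have hfg : |(f u ω - f (σ n) ω) * (g (n + 1) ω - g u ω)| ≤
      maxFn (block σ (increment f · ω) (σ n)) N *
        (2 * maxFn (block σ (increment g · ω) (σ n)) N) := by
    rw [abs_mul]
    exact mul_le_mul hf hg (abs_nonneg _) (maxFn_nonneg _ _)
  beta_reduce
  rw [truncParaproduct_eq_sub_sub f g ω hu (hun.trans n.le_succ), blockWeight]
  refine (abs_sub _ _).trans ((add_le_add (abs_sub _ _) le_rfl).trans ?_)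
  linarith

end IsResetSeq

end Paraproducts

section Adaptedness

variable {Ω ι : Type*} {m : MeasurableSpace Ω} [MeasurableSpace ι] [MeasurableSingletonClass ι]
  [Countable ι] {σ : ℕ → Ω → ι} {d e : ℕ → Ω → ℝ} {n : ℕ}

lemma measurable_blockParaDiff (hσ : ∀ i ≤ n, Measurable (σ i)) (hd : ∀ i < n, Measurable (d i))
    (he : Measurable (e n)) :
    Measurable fun ω => blockParaDiff (σ · ω) (d · ω) (e · ω) n :=
  (measurable_activeBlockSum hσ hd).mul he

lemma measurable_blockWeight (hσ : ∀ i < n, Measurable (σ i)) (hd : ∀ i < n, Measurable (d i))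
    (he : ∀ i < n, Measurable (e i)) (a : ι) :
    Measurable fun ω => blockWeight (σ · ω) (d · ω) (e · ω) n a := by
  have hblock {c : ℕ → Ω → ℝ} (hc : ∀ i < n, Measurable (c i)) :
      Measurable fun ω => maxFn (block (σ · ω) (c · ω) a) n :=
    measurable_maxFn fun i hi => measurable_block measurable_const (hσ i hi) (hc i hi)
  have hpara (i : ℕ) (hi : i < n) :
      Measurable fun ω => blockParaDiff (σ · ω) (d · ω) (e · ω) i :=
    measurable_blockParaDiff (fun j hj => hσ j (hj.trans_lt hi)) (fun j hj => hd j (hj.trans hi))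
      (he i hi)
  exact ((hblock hpara).const_mul 2).add (((hblock hd).mul (hblock he)).const_mul 2)

lemma measurable_totalWeight {σ : ℕ → Ω → ℕ} (hσ : ∀ n, Measurable (σ n))
    (hd : ∀ n, Measurable (d n)) (he : ∀ n, Measurable (e n)) (N : ℕ) :
    Measurable fun ω => totalWeight (d · ω) (e · ω) (σ · ω) N :=
  Finset.measurable_fun_sum _ fun a _ =>
    measurable_blockWeight (fun i _ => hσ i) (fun i _ => hd i) (fun i _ => he i) a

lemma measurable_truncParaproduct {f g : ℕ → Ω → ℝ} {v : ℕ} (hf : ∀ i ≤ v, Measurable (f i))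
    (hg : ∀ i ≤ v, Measurable (g i)) (u : ℕ) :
    Measurable fun ω => truncParaproduct f g u v ω := by
  refine Finset.measurable_fun_sum _ fun j hj => Finset.measurable_fun_sum _ fun i hi => ?_
  have hj' := Finset.mem_Ioc.1 hj
  have hi' := Finset.mem_Ioo.1 hi
  exact ((hf i (by omega)).sub (hf (i - 1) (by omega))).mul
    ((hg j (by omega)).sub (hg (j - 1) (by omega)))

lemma measurableSet_exceedsSince {a : Ω → ℕ} (ha : Measurable a) {P : ℕ → ℕ → Ω → ℝ}
    {thr : ℕ → Ω → ℝ} (hP : ∀ u, Measurable (P u (n + 1))) (hthr : Measurable (thr (n + 1))) :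
    MeasurableSet {ω | ExceedsSince (P · · ω) (thr · ω) (a ω) n} := by
  simp only [ExceedsSince, Set.ofPred_exists]
  exact MeasurableSet.iUnion fun u => (measurableSet_le ha measurable_const).inter
    ((MeasurableSet.const _).inter (measurableSet_le hthr (hP u).abs))

lemma measurable_resetSeq {mΩ : MeasurableSpace Ω} {ℱ : Filtration ℕ mΩ} {P : ℕ → ℕ → Ω → ℝ}
    {thr : ℕ → Ω → ℝ} (hP : ∀ u v, Measurable[ℱ v] (P u v)) (hthr : ∀ n, Measurable[ℱ n] (thr n))
    (n : ℕ) : Measurable[ℱ n] fun ω => resetSeq (P · · ω) (thr · ω) n := by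
  classical
  induction n with
  | zero => exact measurable_const
  | succ n ih =>
    have hpast := ih.mono (ℱ.mono n.le_succ) le_rfl
    simp only [resetSeq]
    exact Measurable.ite (measurableSet_exceedsSince hpast (hP · (n + 1)) (hthr (n + 1)))
      measurable_const hpast

end Adaptedness

section Supremum

variable {Ω : Type*} {mΩ : MeasurableSpace Ω} {μ : Measure Ω} {r : ℝ}

lemma eLpNorm_ennreal_eq (hr : 0 < r) (Z : Ω → ℝ≥0∞) :
    eLpNorm Z (ENNReal.ofReal r) μ = (∫⁻ ω, Z ω ^ r ∂μ) ^ (1 / r) := by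
  rw [eLpNorm_eq_lintegral_rpow_enorm_toReal (by simpa using hr) ENNReal.ofReal_ne_top,
    ENNReal.toReal_ofReal hr.le]
  simp only [enorm_eq_self]

lemma eLpNorm_ennreal_le_iff (hr : 0 < r) {Z : Ω → ℝ≥0∞} {D : ℝ≥0∞} :
    eLpNorm Z (ENNReal.ofReal r) μ ≤ D ↔ ∫⁻ ω, Z ω ^ r ∂μ ≤ D ^ r := by
  rw [eLpNorm_ennreal_eq hr, one_div, ENNReal.rpow_inv_le_iff hr]

lemma iSup_rpow (hr : 0 < r) (z : ℕ → ℝ≥0∞) : (⨆ n, z n) ^ r = ⨆ n, z n ^ r :=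
  (ENNReal.orderIsoRpow r hr).map_iSup z

lemma eLpNorm_iSup_le_of_monotone (hr : 0 < r) {Z : ℕ → Ω → ℝ≥0∞} (hZm : ∀ N, Measurable (Z N))
    (hZ : ∀ ω, Monotone (Z · ω)) {D : ℝ≥0∞} (hD : ∀ N, eLpNorm (Z N) (ENNReal.ofReal r) μ ≤ D) :
    eLpNorm (fun ω => ⨆ N, Z N ω) (ENNReal.ofReal r) μ ≤ D := by
  simp only [eLpNorm_ennreal_le_iff hr, iSup_rpow hr] at hD ⊢
  rw [lintegral_iSup (fun N => (hZm N).pow_const r)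
    fun i j hij ω => ENNReal.rpow_le_rpow (hZ ω hij) hr.le]
  exact iSup_le hD

lemma eLpNorm_iSup_mul_le (hr : 0 < r) {B : ℕ → Ω → ℝ≥0∞} (hB : ∀ l, Measurable (B l))
    (w : ℕ → ℝ≥0∞) {D : ℝ≥0∞} (hD : ∀ l, eLpNorm (B l) (ENNReal.ofReal r) μ ≤ D) :
    eLpNorm (fun ω => ⨆ l, w l * B l ω) (ENNReal.ofReal r) μ ≤ (∑' l, w l ^ r) ^ (1 / r) * D := by
  simp only [eLpNorm_ennreal_le_iff hr, iSup_rpow hr, ENNReal.mul_rpow_of_nonneg _ _ hr.le,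
    one_div, ENNReal.rpow_inv_rpow hr.ne'] at hD ⊢
  calc ∫⁻ ω, ⨆ l, w l ^ r * B l ω ^ r ∂μ ≤ ∫⁻ ω, ∑' l, w l ^ r * B l ω ^ r ∂μ :=
        lintegral_mono fun ω => iSup_le fun l => ENNReal.le_tsum l
    _ = ∑' l, w l ^ r * ∫⁻ ω, B l ω ^ r ∂μ := by
        rw [lintegral_tsum fun l => (((hB l).pow_const r).const_mul _).aemeasurable]
        exact tsum_congr fun l => lintegral_const_mul _ ((hB l).pow_const r)
    _ ≤ ∑' l, w l ^ r * D ^ r := ENNReal.tsum_le_tsum fun l => mul_le_mul_right (hD l) _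
    _ = (∑' l, w l ^ r) * D ^ r := ENNReal.tsum_mul_right

end Supremum

section TotalWeightBound

variable {Ω : Type*} {mΩ : MeasurableSpace Ω} {μ : Measure Ω} [IsFiniteMeasure μ]
  {ℱ : Filtration ℕ mΩ} {d e : ℕ → Ω → ℝ} {p q r s t : ℝ}

lemma eLpNorm_blockTotal_add_blockNorm_mul_le {ι : Type*} [Fintype ι] [MeasurableSpace ι]
    [MeasurableSingletonClass ι] {σ : ℕ → Ω → ι} (hd : IsMartingaleDiff ℱ μ d)
    (he : IsMartingaleDiff ℱ μ e) (hdp : ∀ n, MemLp (d n) (ENNReal.ofReal p) μ)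
    (heq : ∀ n, MemLp (e n) (ENNReal.ofReal q) μ) (hσ : ∀ n, Measurable[ℱ n] (σ n))
    (hp : 1 < p) (hq : 1 < q) (hpqr : p.HolderTriple q r) (hs0 : 0 < s) (hs1 : s < 1) (ht : 1 < t)
    (h₁ : (p / (1 - s)).HolderTriple q t) (h₂ : (p / s).HolderTriple t r) (N : ℕ) :
    eLpNorm (fun ω => 2 * blockTotal (σ · ω) (blockParaDiff (σ · ω) (d · ω) (e · ω)) N +
        2 * (blockNorm (σ · ω) (d · ω) N * blockNorm (σ · ω) (e · ω) N)) (ENNReal.ofReal r) μ ≤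
      ENNReal.LpAddConst (ENNReal.ofReal r) *
        (ENNReal.ofReal 2 * ENNReal.ofReal (2 * (t * 36 * √((1 - s)⁻¹))) + ENNReal.ofReal 2) *
        (ENNReal.ofReal (p * (576 * (p / (p - 1)))) *
          eLpNorm (fun ω => partialSum (d · ω) N) (ENNReal.ofReal p) μ *
        (ENNReal.ofReal (q * (576 * (q / (q - 1)))) *
          eLpNorm (fun ω => partialSum (e · ω) N) (ENNReal.ofReal q) μ)) := by
  have hσ' (n : ℕ) : Measurable (σ n) := (hσ n).mono (ℱ.le n) le_rfl
  have hTm : Measurable fun ω =>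
      blockTotal (σ · ω) (blockParaDiff (σ · ω) (d · ω) (e · ω)) N :=
    measurable_blockTotal (fun i _ => hσ' i) fun i _ => measurable_blockParaDiff
      (fun j _ => hσ' j) (fun j _ => hd.measurable j) (he.measurable i)
  have hFm : Measurable fun ω => blockNorm (σ · ω) (d · ω) N :=
    measurable_blockNorm (fun i _ => hσ' i) fun i _ => hd.measurable i
  have hGm : Measurable fun ω => blockNorm (σ · ω) (e · ω) N :=
    measurable_blockNorm (fun i _ => hσ' i) fun i _ => he.measurable i
  have hF := hd.eLpNorm_blockNorm_le hp hdp hσ N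
  have hT := (eLpNorm_blockTotal_blockParaDiff_le hd he hdp heq hσ hs0 hs1 ht h₁ h₂ N).trans
    (mul_le_mul_right (mul_le_mul' hF (he.eLpNorm_squareFn_le hq heq N)) _)
  have hFG := (eLpNorm_mul_le_of_holderTriple hpqr hFm.aestronglyMeasurable
    hGm.aestronglyMeasurable).trans (mul_le_mul' hF (he.eLpNorm_blockNorm_le hq heq hσ N))
  refine (eLpNorm_add_le' (hTm.const_mul 2).aestronglyMeasurable
    ((hFm.mul hGm).const_mul 2).aestronglyMeasurable _).trans ?_
  rw [eLpNorm_const_mul zero_le_two, eLpNorm_const_mul zero_le_two, mul_assoc, add_mul, mul_assoc]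
  gcongr
  exact hFG

lemma exists_eLpNorm_totalWeight_le {p q r : ℝ} (hp : 1 < p) (hq : 1 < q)
    (hpqr : 1 / p + 1 / q = 1 / r) :
    ∃ C : ℝ≥0, ∀ (Ω : Type*) (mΩ : MeasurableSpace Ω) (μ : Measure Ω) (_ : IsFiniteMeasure μ)
      (ℱ : Filtration ℕ mΩ) (d e : ℕ → Ω → ℝ), IsMartingaleDiff ℱ μ d → IsMartingaleDiff ℱ μ e →
      (∀ n, MemLp (d n) (ENNReal.ofReal p) μ) → (∀ n, MemLp (e n) (ENNReal.ofReal q) μ) →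
      ∀ σ : ℕ → Ω → ℕ, (∀ n, Measurable[ℱ n] (σ n)) → (∀ n ω, σ n ω ≤ n) → ∀ N,
      eLpNorm (fun ω => totalWeight (d · ω) (e · ω) (σ · ω) N) (ENNReal.ofReal r) μ ≤
        C * (eLpNorm (fun ω => partialSum (d · ω) N) (ENNReal.ofReal p) μ *
          eLpNorm (fun ω => partialSum (e · ω) N) (ENNReal.ofReal q) μ) := by
  obtain ⟨s, t, hs0, hs1, ht, h₁, h₂⟩ := exists_interpolation_exponents hp hq hpqr
  have hpqr' := holderTriple_of_one_div_add_one_div (zero_lt_one.trans hp) (zero_lt_one.trans hq)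
    hpqr
  set C := ENNReal.LpAddConst (ENNReal.ofReal r) *
    (ENNReal.ofReal 2 * ENNReal.ofReal (2 * (t * 36 * √((1 - s)⁻¹))) + ENNReal.ofReal 2) *
    (ENNReal.ofReal (p * (576 * (p / (p - 1)))) *
      ENNReal.ofReal (q * (576 * (q / (q - 1))))) with hC
  have hCtop : C ≠ ∞ := by
    have := (ENNReal.LpAddConst_lt_top (ENNReal.ofReal r)).ne
    finiteness
  refine ⟨C.toNNReal, fun Ω mΩ μ _ ℱ d e hd he hdp heq σ hσ hσn N => ?_⟩
  have hσ' (n : ℕ) : Measurable[ℱ n] fun ω => Fin.ofNat (N + 1) (σ n ω) :=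
    (measurable_from_nat (f := Fin.ofNat (N + 1))).comp (hσ n)
  calc eLpNorm (fun ω => totalWeight (d · ω) (e · ω) (σ · ω) N) (ENNReal.ofReal r) μ
      ≤ _ := eLpNorm_mono_of_nonneg (fun _ => totalWeight_nonneg _ _ _ _)
        (fun ω => totalWeight_le _ _ fun n hn => (hσn n ω).trans hn.le) _
    _ ≤ _ := eLpNorm_blockTotal_add_blockNorm_mul_le hd he hdp heq hσ' hp hq hpqr' hs0 hs1 ht
        h₁ h₂ N
    _ = _ := by
        rw [ENNReal.coe_toNNReal hCtop, hC]
        ring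

end TotalWeightBound

section MartingaleIncrements

variable {Ω : Type*} {mΩ : MeasurableSpace Ω} {μ : Measure Ω} {ℱ : Filtration ℕ mΩ}
  {f : ℕ → Ω → ℝ}

lemma measurable_martingale_of_le (hf : Martingale f ℱ μ) {i n : ℕ} (h : i ≤ n) :
    Measurable[ℱ n] (f i) :=
  (hf.1 i).measurable.mono (ℱ.mono h) le_rfl

lemma isMartingaleDiff_increment (hf : Martingale f ℱ μ) :
    IsMartingaleDiff ℱ μ (increment f) where
  measurable_succ n := (measurable_martingale_of_le hf le_rfl).sub
    (measurable_martingale_of_le hf n.le_succ)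
  integrable n := (hf.integrable (n + 1)).sub (hf.integrable n)
  condExp_eq_zero n := by
    filter_upwards [condExp_sub (hf.integrable (n + 1)) (hf.integrable n) (ℱ n),
      hf.2 n (n + 1) n.le_succ, hf.2 n n le_rfl] with ω hsub hsucc hself
    exact hsub.trans (by rw [Pi.sub_apply, hsucc, hself, sub_self, Pi.zero_apply])

lemma eLpNorm_le_martingaleLpNorm (p : ℝ) (f : ℕ → Ω → ℝ) (n : ℕ) :
    eLpNorm (f n) (ENNReal.ofReal p) μ ≤ martingaleLpNorm μ p f :=
  le_iSup (fun n => eLpNorm (f n) (ENNReal.ofReal p) μ) n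

lemma memLp_increment (hf : Martingale f ℱ μ) {p : ℝ} (hfp : martingaleLpNorm μ p f ≠ ∞) (n : ℕ) :
    MemLp (increment f n) (ENNReal.ofReal p) μ := by
  have hmem (n : ℕ) : MemLp (f n) (ENNReal.ofReal p) μ :=
    ⟨(hf.integrable n).1, (eLpNorm_le_martingaleLpNorm p f n).trans_lt hfp.lt_top⟩
  exact (hmem (n + 1)).sub (hmem n)

lemma eLpNorm_partialSum_increment_le (hf : Martingale f ℱ μ) {p : ℝ} (hp : 1 ≤ p) (N : ℕ) :
    eLpNorm (fun ω => partialSum (increment f · ω) N) (ENNReal.ofReal p) μ ≤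
      2 * martingaleLpNorm μ p f := by
  have hsum : (fun ω => partialSum (increment f · ω) N) = f N - f 0 := by
    ext ω
    exact Finset.sum_range_sub (f · ω) N
  rw [hsum, two_mul]
  exact (eLpNorm_sub_le (hf.integrable N).1 (hf.integrable 0).1
    (ENNReal.one_le_ofReal.2 hp)).trans
      (add_le_add (eLpNorm_le_martingaleLpNorm p f N) (eLpNorm_le_martingaleLpNorm p f 0))

end MartingaleIncrements

section LimitWeight

/-- The limit of `totalWeight d e σ N` as `N` tends to infinity. -/
noncomputable def limitWeight (d e : ℕ → ℝ) (σ : ℕ → ℕ) : ℝ≥0∞ :=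
  ⨆ N, ENNReal.ofReal (totalWeight d e σ N)

lemma ofReal_totalWeight_le_limitWeight (d e : ℕ → ℝ) (σ : ℕ → ℕ) (N : ℕ) :
    ENNReal.ofReal (totalWeight d e σ N) ≤ limitWeight d e σ :=
  le_iSup (fun N => ENNReal.ofReal (totalWeight d e σ N)) N

lemma measurable_limitWeight {Ω : Type*} {_ : MeasurableSpace Ω} {d e : ℕ → Ω → ℝ}
    {σ : ℕ → Ω → ℕ} (hσ : ∀ n, Measurable (σ n)) (hd : ∀ n, Measurable (d n))
    (he : ∀ n, Measurable (e n)) : Measurable fun ω => limitWeight (d · ω) (e · ω) (σ · ω) :=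
  Measurable.iSup fun N => (measurable_totalWeight hσ hd he N).ennreal_ofReal

lemma exists_eLpNorm_limitWeight_le {p q r : ℝ} (hp : 1 < p) (hq : 1 < q)
    (hpqr : 1 / p + 1 / q = 1 / r) :
    ∃ C : ℝ≥0, ∀ (Ω : Type*) (mΩ : MeasurableSpace Ω) (μ : Measure Ω) (_ : IsFiniteMeasure μ)
      (ℱ : Filtration ℕ mΩ) (f g : ℕ → Ω → ℝ), Martingale f ℱ μ → Martingale g ℱ μ →
      martingaleLpNorm μ p f ≠ ∞ → martingaleLpNorm μ q g ≠ ∞ →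
      ∀ σ : ℕ → Ω → ℕ, (∀ n, Measurable[ℱ n] (σ n)) → (∀ n ω, σ n ω ≤ n) →
      eLpNorm (fun ω => limitWeight (increment f · ω) (increment g · ω) (σ · ω))
          (ENNReal.ofReal r) μ ≤
        C * (martingaleLpNorm μ p f * martingaleLpNorm μ q g) := by
  obtain ⟨C, hC⟩ := exists_eLpNorm_totalWeight_le hp hq hpqr
  refine ⟨C * 4, fun Ω mΩ μ _ ℱ f g hf hg hfp hgq σ hσ hσn => ?_⟩
  have hd := isMartingaleDiff_increment hf
  have he := isMartingaleDiff_increment hg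
  have hr : 0 < r := (holderTriple_of_one_div_add_one_div (by linarith) (by linarith) hpqr).pos'
  refine eLpNorm_iSup_le_of_monotone hr
    (fun N => (measurable_totalWeight (fun n => (hσ n).mono (ℱ.le n) le_rfl) hd.measurable
      he.measurable N).ennreal_ofReal)
    (fun ω M N h => ENNReal.ofReal_le_ofReal (totalWeight_mono _ _ _ h)) fun N => ?_
  rw [eLpNorm_ennreal_eq hr, ← eLpNorm_ofReal_eq hr fun _ => totalWeight_nonneg _ _ _ _]
  calc _ ≤ C * (eLpNorm (fun ω => partialSum (increment f · ω) N) (ENNReal.ofReal p) μ *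
          eLpNorm (fun ω => partialSum (increment g · ω) N) (ENNReal.ofReal q) μ) :=
        hC Ω mΩ μ inferInstance ℱ _ _ hd he (memLp_increment hf hfp) (memLp_increment hg hgq)
          σ hσ hσn N
    _ ≤ C * (2 * martingaleLpNorm μ p f * (2 * martingaleLpNorm μ q g)) := by
        gcongr
        · exact eLpNorm_partialSum_increment_le hf hp.le N
        · exact eLpNorm_partialSum_increment_le hg hq.le N
    _ = _ := by
        push_cast
        ring

end LimitWeight

section Degenerate

variable {Ω : Type*} {mΩ : MeasurableSpace Ω} {μ : Measure Ω} {ℱ : Filtration ℕ mΩ}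
  {f g : ℕ → Ω → ℝ} {p q r : ℝ}

lemma martingale_ae_eq_zero (hf : Martingale f ℱ μ) (hp : 0 < p)
    (h : martingaleLpNorm μ p f = 0) : ∀ᵐ ω ∂μ, ∀ n, f n ω = 0 :=
  ae_all_iff.2 fun n => (eLpNorm_eq_zero_iff (hf.integrable n).1 (by simpa using hp)).1
    (le_zero_iff.1 ((eLpNorm_le_martingaleLpNorm p f n).trans h.le))

lemma ae_truncParaproduct_eq_zero (hf : Martingale f ℱ μ) (hg : Martingale g ℱ μ)
    (hp : 0 < p) (hq : 0 < q) (h : martingaleLpNorm μ p f * martingaleLpNorm μ q g = 0) :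
    ∀ᵐ ω ∂μ, ∀ u v, truncParaproduct f g u v ω = 0 := by
  rcases mul_eq_zero.1 h with h | h
  · filter_upwards [martingale_ae_eq_zero hf hp h] with ω hω u v
    simp [truncParaproduct, procDiff, hω]
  · filter_upwards [martingale_ae_eq_zero hg hq h] with ω hω u v
    simp [truncParaproduct, procDiff, hω]

lemma eLpNorm_le_of_ne_top (hf : Martingale f ℱ μ) (hg : Martingale g ℱ μ) (hp : 0 < p)
    (hq : 0 < q) {X : Ω → ℝ≥0∞} {K : ℝ≥0∞} (hK : K ≠ 0)
    (hzero : ∀ ω, (∀ u v, truncParaproduct f g u v ω = 0) → X ω = 0)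
    (hmain : martingaleLpNorm μ p f ≠ ∞ → martingaleLpNorm μ q g ≠ ∞ →
      eLpNorm X (ENNReal.ofReal r) μ ≤ K * (martingaleLpNorm μ p f * martingaleLpNorm μ q g)) :
    eLpNorm X (ENNReal.ofReal r) μ ≤ K * (martingaleLpNorm μ p f * martingaleLpNorm μ q g) := by
  by_cases h0 : martingaleLpNorm μ p f * martingaleLpNorm μ q g = 0
  · have hX : X =ᵐ[μ] 0 := (ae_truncParaproduct_eq_zero hf hg hp hq h0).mono hzero
    rw [eLpNorm_congr_ae hX, eLpNorm_zero]
    exact bot_le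
  by_cases htop : martingaleLpNorm μ p f * martingaleLpNorm μ q g = ∞
  · rw [htop, ENNReal.mul_top hK]
    exact le_top
  · exact hmain (fun h => htop (by rw [h, ENNReal.top_mul (right_ne_zero_of_mul h0)]))
      fun h => htop (by rw [h, ENNReal.mul_top (left_ne_zero_of_mul h0)])

lemma paraproductVariation_eq_zero {ϱ : ℝ} (hϱ : 0 < ϱ) {ω : Ω}
    (h : ∀ u v, truncParaproduct f g u v ω = 0) : paraproductVariation ϱ f g ω = 0 := by
  simp [paraproductVariation, h, ENNReal.zero_rpow_of_pos hϱ, hϱ]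

lemma paraproductJumpCount_eq_zero {lam : ℝ} (hlam : 0 < lam) {ω : Ω}
    (h : ∀ u v, truncParaproduct f g u v ω = 0) : paraproductJumpCount lam f g ω = 0 := by
  simp [paraproductJumpCount, h, not_le.2 hlam]

end Degenerate

section ParaproductResets

variable {Ω : Type*} {mΩ : MeasurableSpace Ω} {μ : Measure Ω} {ℱ : Filtration ℕ mΩ}
  {f g : ℕ → Ω → ℝ}

lemma measurable_resetSeq_truncParaproduct (hf : Martingale f ℱ μ) (hg : Martingale g ℱ μ)
    {thr : ℕ → Ω → ℝ} (hthr : ∀ n, Measurable[ℱ n] (thr n)) (n : ℕ) :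
    Measurable[ℱ n] fun ω => resetSeq (truncParaproduct f g · · ω) (thr · ω) n :=
  measurable_resetSeq (fun u _ => measurable_truncParaproduct
    (fun _ hi => measurable_martingale_of_le hf hi)
    (fun _ hi => measurable_martingale_of_le hg hi) u) hthr n

lemma paraproductJumpCount_le {lam : ℝ} (hlam : 0 < lam) (f g : ℕ → Ω → ℝ) (ω : Ω) :
    paraproductJumpCount lam f g ω ≤ ENNReal.ofReal lam⁻¹ *
      limitWeight (increment f · ω) (increment g · ω)
        (resetSeq (truncParaproduct f g · · ω) fun _ => lam) := by
  refine iSup_le fun m => iSup_le fun n => iSup_le fun hn => ?_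
  set σ := resetSeq (truncParaproduct f g · · ω) fun _ => lam
  set N := n (Fin.last m)
  set s := Finset.univ.filter fun k : Fin m =>
    lam ≤ |truncParaproduct f g (n k.castSucc) (n k.succ) ω|
  have hcount : s.card * lam ≤ totalWeight (increment f · ω) (increment g · ω) σ N := by
    rw [← nsmul_eq_mul, ← Finset.sum_const]
    exact sum_le_sum_of_isBlockBound hn le_rfl (fun _ => blockWeight_nonneg _ _ _ _ _)
      ((isResetSeq_resetSeq _ _).isBlockBound f g ω N)
      (fun _ hk => (Finset.mem_filter.1 hk).2) fun _ _ _ _ => le_rfl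
  calc (s.card : ℝ≥0∞) = ENNReal.ofReal lam⁻¹ * ENNReal.ofReal (s.card * lam) := by
        rw [← ENNReal.ofReal_mul (inv_nonneg.2 hlam.le), mul_comm, mul_inv_cancel_right₀ hlam.ne',
          ENNReal.ofReal_natCast]
    _ ≤ _ := by
        gcongr
        exact (ENNReal.ofReal_le_ofReal hcount).trans (ofReal_totalWeight_le_limitWeight _ _ _ _)

theorem exists_eLpNorm_paraproductJumpCount_le {p q r : ℝ} (hp : 1 < p) (hq : 1 < q)
    (hpqr : 1 / p + 1 / q = 1 / r) :
    ∃ C : ℝ≥0, ∀ (Ω : Type*) (mΩ : MeasurableSpace Ω) (μ : Measure Ω) (_ : IsFiniteMeasure μ)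
      (ℱ : Filtration ℕ mΩ) (f g : ℕ → Ω → ℝ), Martingale f ℱ μ → Martingale g ℱ μ →
      ∀ lam : ℝ, 0 < lam → eLpNorm (paraproductJumpCount lam f g) (ENNReal.ofReal r) μ ≤
        C * ENNReal.ofReal lam⁻¹ * (martingaleLpNorm μ p f * martingaleLpNorm μ q g) := by
  obtain ⟨C, hC⟩ := exists_eLpNorm_limitWeight_le hp hq hpqr
  refine ⟨C + 1, fun Ω mΩ μ _ ℱ f g hf hg lam hlam => ?_⟩
  refine eLpNorm_le_of_ne_top hf hg (by linarith) (by linarith) (by simp [hlam])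
    (fun ω => paraproductJumpCount_eq_zero hlam) fun hfp hgq => ?_
  calc eLpNorm (paraproductJumpCount lam f g) (ENNReal.ofReal r) μ
      ≤ ENNReal.ofReal lam⁻¹ * eLpNorm (fun ω => limitWeight (increment f · ω) (increment g · ω)
          (resetSeq (truncParaproduct f g · · ω) fun _ => lam)) (ENNReal.ofReal r) μ :=
        eLpNorm_le_nnreal_smul_eLpNorm_of_ae_le_mul' (c := lam⁻¹.toNNReal)
          (ae_of_all _ fun ω => by
            simp only [enorm_eq_self]
            exact paraproductJumpCount_le hlam f g ω) _
    _ ≤ ENNReal.ofReal lam⁻¹ *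
          ((C + 1 : ℝ≥0) * (martingaleLpNorm μ p f * martingaleLpNorm μ q g)) := by
        gcongr
        refine (hC Ω mΩ μ inferInstance ℱ f g hf hg hfp hgq _
          (measurable_resetSeq_truncParaproduct hf hg fun _ => measurable_const)
          fun n _ => (isResetSeq_resetSeq _ _).le n).trans ?_
        gcongr
        exact le_self_add
    _ = _ := by ring

end ParaproductResets

section ParaproductLevels

variable {Ω : Type*} {mΩ : MeasurableSpace Ω} {μ : Measure Ω} {ℱ : Filtration ℕ mΩ}
  {f g : ℕ → Ω → ℝ} {ϱ : ℝ}

/-- A monotone adapted majorant of all truncated paraproducts up to time `n`: the weight of the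
single block without resets. -/
noncomputable def paraproductBound (f g : ℕ → Ω → ℝ) (n : ℕ) (ω : Ω) : ℝ :=
  blockWeight (fun _ => 0) (increment f · ω) (increment g · ω) n 0

lemma abs_truncParaproduct_le_paraproductBound (f g : ℕ → Ω → ℝ) (ω : Ω) {u v : ℕ} (huv : u < v) :
    |truncParaproduct f g u v ω| ≤ paraproductBound f g v ω := by
  obtain ⟨n, rfl⟩ := Nat.exists_eq_add_one_of_ne_zero (Nat.ne_zero_of_lt huv)
  have hzero : IsResetSeq fun _ => 0 := ⟨rfl, fun _ => Or.inl rfl⟩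
  exact hzero.isBlockBound f g ω (n + 1) n n.lt_succ_self u u.zero_le (Nat.le_of_lt_succ huv)

lemma measurable_paraproductBound (hf : Martingale f ℱ μ) (hg : Martingale g ℱ μ) (n : ℕ) :
    Measurable[ℱ n] (paraproductBound f g n) :=
  measurable_blockWeight (fun _ _ => measurable_const)
    (fun _ hi => (isMartingaleDiff_increment hf).measurable_of_lt hi)
    (fun _ hi => (isMartingaleDiff_increment hg).measurable_of_lt hi) 0

/-- The reset times of level `l`: none at level `0`, and at level `l + 1` the resets at relative
height `(1 / 2) ^ (l + 1)` of the majorant `paraproductBound`. -/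
noncomputable def levelResets (f g : ℕ → Ω → ℝ) : ℕ → ℕ → Ω → ℕ
  | 0 => fun _ _ => 0
  | l + 1 => fun n ω => resetSeq (truncParaproduct f g · · ω)
      (fun t => (1 / 2) ^ (l + 1) * paraproductBound f g t ω) n

lemma measurable_levelResets (hf : Martingale f ℱ μ) (hg : Martingale g ℱ μ) (l n : ℕ) :
    Measurable[ℱ n] (levelResets f g l n) := by
  cases l with
  | zero => exact measurable_const
  | succ l =>
    exact measurable_resetSeq_truncParaproduct hf hg
      (fun n => (measurable_paraproductBound hf hg n).const_mul _) n

lemma levelResets_le (f g : ℕ → Ω → ℝ) (l n : ℕ) (ω : Ω) : levelResets f g l n ω ≤ n := by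
  cases l with
  | zero => exact n.zero_le
  | succ l => exact (isResetSeq_resetSeq _ _).le n

/-- The supremum over the levels of the limit weights, discounted geometrically so that it is
controlled by the sum of their moments. -/
noncomputable def levelSup (ϱ : ℝ) (f g : ℕ → Ω → ℝ) (ω : Ω) : ℝ≥0∞ :=
  ⨆ l, ENNReal.ofReal ((levelRatio ϱ)⁻¹ ^ l) *
    limitWeight (increment f · ω) (increment g · ω) (levelResets f g l · ω)

lemma totalWeight_le_levelSup (hϱ : 1 < ϱ) {ω : Ω} (h : levelSup ϱ f g ω ≠ ∞) (l N : ℕ) :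
    totalWeight (increment f · ω) (increment g · ω) (levelResets f g l · ω) N ≤
      levelRatio ϱ ^ l * (levelSup ϱ f g ω).toReal := by
  have hκ : 0 < levelRatio ϱ := by linarith [one_lt_levelRatio hϱ]
  rw [← inv_mul_le_iff₀ (by positivity), ← inv_pow, ← ENNReal.ofReal_le_iff_le_toReal h,
    ENNReal.ofReal_mul (by positivity)]
  refine le_iSup_of_le l ?_
  gcongr
  exact ofReal_totalWeight_le_limitWeight _ _ _ _

lemma sum_abs_truncParaproduct_rpow_le (hϱ : 1 < ϱ) {ω : Ω} (h : levelSup ϱ f g ω ≠ ∞) {m : ℕ}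
    {n : Fin (m + 1) → ℕ} (hn : StrictMono n) :
    ∑ k : Fin m, |truncParaproduct f g (n k.castSucc) (n k.succ) ω| ^ ϱ ≤
      variationConst ϱ * (levelSup ϱ f g ω).toReal ^ ϱ := by
  set N := n (Fin.last m) + 1
  have hbound : paraproductBound f g N ω ≤ (levelSup ϱ f g ω).toReal := by
    have hzero := totalWeight_le_levelSup hϱ h 0 N
    rw [pow_zero, one_mul] at hzero
    exact (Finset.single_le_sum (fun a _ => blockWeight_nonneg _ _ _ N a)
      (Finset.mem_range.2 (Nat.succ_pos _))).trans hzero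
  exact sum_rpow_le_of_isBlockBound (P := (truncParaproduct f g · · ω)) hϱ hn (Nat.le_succ _)
    (blockWeight_mono _ _ _ _) (fun _ => blockWeight_nonneg _ _ _ _ _)
    (fun u v => abs_truncParaproduct_le_paraproductBound f g ω)
    (fun l => blockWeight_nonneg (levelResets f g (l + 1) · ω) _ _ N)
    (fun l => (isResetSeq_resetSeq _ _).isBlockBound f g ω N) hbound
    fun l => totalWeight_le_levelSup hϱ h (l + 1) N

lemma paraproductVariation_le (hϱ : 1 < ϱ) (f g : ℕ → Ω → ℝ) (ω : Ω) :
    paraproductVariation ϱ f g ω ≤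
      ENNReal.ofReal (variationConst ϱ) ^ (1 / ϱ) * levelSup ϱ f g ω := by
  have hϱ0 : 0 < ϱ := by linarith
  have hc := variationConst_pos hϱ
  by_cases htop : levelSup ϱ f g ω = ∞
  · rw [htop, ENNReal.mul_top (ENNReal.rpow_pos (by simpa using hc) ENNReal.ofReal_ne_top).ne']
    exact le_top
  refine iSup_le fun m => iSup_le fun n => iSup_le fun hn => ?_
  rw [one_div, ENNReal.rpow_inv_le_iff hϱ0, ENNReal.mul_rpow_of_nonneg _ _ hϱ0.le,
    ENNReal.rpow_inv_rpow hϱ0.ne']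
  calc ∑ k : Fin m, ENNReal.ofReal |truncParaproduct f g (n k.castSucc) (n k.succ) ω| ^ ϱ
      = ENNReal.ofReal
          (∑ k : Fin m, |truncParaproduct f g (n k.castSucc) (n k.succ) ω| ^ ϱ) := by
        rw [ENNReal.ofReal_sum_of_nonneg fun k _ => Real.rpow_nonneg (abs_nonneg _) _]
        exact Finset.sum_congr rfl fun k _ => ENNReal.ofReal_rpow_of_nonneg (abs_nonneg _) hϱ0.le
    _ ≤ ENNReal.ofReal (variationConst ϱ * (levelSup ϱ f g ω).toReal ^ ϱ) :=
        ENNReal.ofReal_le_ofReal (sum_abs_truncParaproduct_rpow_le hϱ htop hn)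
    _ = ENNReal.ofReal (variationConst ϱ) * levelSup ϱ f g ω ^ ϱ := by
        rw [ENNReal.ofReal_mul hc.le, ← ENNReal.ofReal_rpow_of_nonneg ENNReal.toReal_nonneg hϱ0.le,
          ENNReal.ofReal_toReal htop]

lemma tsum_ofReal_inv_levelRatio_pow_rpow_ne_top (hϱ : 1 < ϱ) {r : ℝ} (hr : 0 < r) :
    ∑' l : ℕ, ENNReal.ofReal ((levelRatio ϱ)⁻¹ ^ l) ^ r ≠ ∞ := by
  have hκ := one_lt_levelRatio hϱ
  have hgeom (l : ℕ) : ENNReal.ofReal ((levelRatio ϱ)⁻¹ ^ l) ^ r =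
      (ENNReal.ofReal (levelRatio ϱ)⁻¹ ^ r) ^ l := by
    rw [ENNReal.ofReal_pow (by positivity), ← ENNReal.rpow_natCast_mul, mul_comm,
      ENNReal.rpow_mul_natCast]
  have hlt : ENNReal.ofReal (levelRatio ϱ)⁻¹ ^ r < 1 :=
    ENNReal.rpow_lt_one (ENNReal.ofReal_lt_one.2 (inv_lt_one_of_one_lt₀ hκ)) hr
  rw [tsum_congr hgeom, ENNReal.tsum_geometric]
  exact ENNReal.inv_ne_top.2 (tsub_pos_of_lt hlt).ne'

theorem exists_eLpNorm_paraproductVariation_le {p q r : ℝ} (hp : 1 < p) (hq : 1 < q)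
    (hpqr : 1 / p + 1 / q = 1 / r) (hϱ : 1 < ϱ) :
    ∃ C : ℝ≥0, ∀ (Ω : Type*) (mΩ : MeasurableSpace Ω) (μ : Measure Ω) (_ : IsFiniteMeasure μ)
      (ℱ : Filtration ℕ mΩ) (f g : ℕ → Ω → ℝ), Martingale f ℱ μ → Martingale g ℱ μ →
      eLpNorm (paraproductVariation ϱ f g) (ENNReal.ofReal r) μ ≤
        C * (martingaleLpNorm μ p f * martingaleLpNorm μ q g) := by
  obtain ⟨C, hC⟩ := exists_eLpNorm_limitWeight_le hp hq hpqr
  have hr : 0 < r := (holderTriple_of_one_div_add_one_div (by linarith) (by linarith) hpqr).pos'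
  set c : ℝ≥0 := (variationConst ϱ).toNNReal ^ (1 / ϱ)
  set w := (∑' l : ℕ, ENNReal.ofReal ((levelRatio ϱ)⁻¹ ^ l) ^ r) ^ (1 / r)
  have hw : w ≠ ∞ := ENNReal.rpow_ne_top_of_nonneg (by positivity)
    (tsum_ofReal_inv_levelRatio_pow_rpow_ne_top hϱ hr)
  refine ⟨c * (w.toNNReal * C) + 1, fun Ω mΩ μ _ ℱ f g hf hg => ?_⟩
  refine eLpNorm_le_of_ne_top hf hg (by linarith) (by linarith) (by simp)
    (fun ω => paraproductVariation_eq_zero (by linarith)) fun hfp hgq => ?_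
  have hd := isMartingaleDiff_increment hf
  have he := isMartingaleDiff_increment hg
  have hlevel : eLpNorm (levelSup ϱ f g) (ENNReal.ofReal r) μ ≤
      w * (C * (martingaleLpNorm μ p f * martingaleLpNorm μ q g)) :=
    eLpNorm_iSup_mul_le hr (fun l => measurable_limitWeight
      (fun n => (measurable_levelResets hf hg l n).mono (ℱ.le n) le_rfl) hd.measurable
      he.measurable) _ fun l => hC Ω mΩ μ inferInstance ℱ f g hf hg hfp hgq _
        (measurable_levelResets hf hg l) (levelResets_le f g l)
  calc eLpNorm (paraproductVariation ϱ f g) (ENNReal.ofReal r) μ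
      ≤ c * eLpNorm (levelSup ϱ f g) (ENNReal.ofReal r) μ :=
        eLpNorm_le_nnreal_smul_eLpNorm_of_ae_le_mul' (ae_of_all _ fun ω => by
          simp only [enorm_eq_self]
          rw [ENNReal.coe_rpow_of_nonneg _ (by positivity)]
          exact paraproductVariation_le hϱ f g ω) _
    _ ≤ c * (w * (C * (martingaleLpNorm μ p f * martingaleLpNorm μ q g))) := by gcongr
    _ = ((c * (w.toNNReal * C) : ℝ≥0) : ℝ≥0∞) *
          (martingaleLpNorm μ p f * martingaleLpNorm μ q g) := by
        rw [ENNReal.coe_mul, ENNReal.coe_mul, ENNReal.coe_toNNReal hw, mul_assoc, mul_assoc]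
    _ ≤ _ := by
        gcongr
        exact le_self_add

end ParaproductLevels

theorem theorem1p1 (p q r : ℝ) (hp : 1 < p) (hq : 1 < q) (hr : 1 / 2 < r)
    (hpqr : 1 / p + 1 / q = 1 / r) :
    (∀ ϱ : ℝ, 1 < ϱ → ∃ C : ℝ≥0,
      ∀ (Ω : Type*) (mΩ : MeasurableSpace Ω) (μ : Measure Ω) (_ : IsProbabilityMeasure μ)
        (ℱ : Filtration ℕ mΩ) (f g : ℕ → Ω → ℝ), Martingale f ℱ μ → Martingale g ℱ μ →
        eLpNorm (paraproductVariation ϱ f g) (ENNReal.ofReal r) μ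
          ≤ C * martingaleLpNorm μ p f * martingaleLpNorm μ q g) ∧
    (∃ C : ℝ≥0,
      ∀ (Ω : Type*) (mΩ : MeasurableSpace Ω) (μ : Measure Ω) (_ : IsProbabilityMeasure μ)
        (ℱ : Filtration ℕ mΩ) (f g : ℕ → Ω → ℝ), Martingale f ℱ μ → Martingale g ℱ μ →
        ∀ lam : ℝ, 0 < lam →
          eLpNorm (paraproductJumpCount lam f g) (ENNReal.ofReal r) μ
            ≤ C * ENNReal.ofReal lam⁻¹ * martingaleLpNorm μ p f * martingaleLpNorm μ q g) := by
  constructor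
  · intro ϱ hϱ
    obtain ⟨C, hC⟩ := exists_eLpNorm_paraproductVariation_le hp hq hpqr hϱ
    refine ⟨C, fun Ω mΩ μ _ ℱ f g hf hg => ?_⟩
    rw [mul_assoc]
    exact hC Ω mΩ μ inferInstance ℱ f g hf hg
  · obtain ⟨C, hC⟩ := exists_eLpNorm_paraproductJumpCount_le hp hq hpqr
    refine ⟨C, fun Ω mΩ μ _ ℱ f g hf hg lam hlam => ?_⟩
    rw [mul_assoc _ (martingaleLpNorm μ p f)]
    exact hC Ω mΩ μ inferInstance ℱ f g hf hg lam hlam
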